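/- Let $r\ge 1$ and $n-r\ge 2$. Let $\mathbb{R}^{n+2}_{r+1}$ be $\mathbb{R}^{n+2}$ with the inner product $\langle x,y\rangle=\sum_{i\le n-r+1}x_iy_i-\sum_{i>n-r+1}x_iy_i$, let $Q^n_r$ be the set of its isotropic lines (the projective light cone), let $G=O(n-r+1,r+1)$ be its isometry group, and let $K=O(n-r,r)\times O(1,1)$ be the fixed subgroup of the involution $\sigma$ of $G$ given by conjugation by the reflection that is $-1$ on a fixed Lorentzian plane $L_0$ and $+1$ on $L_0^\perp$. Identify $G/K$ with the Grassmannian of Lorentzian planes by $AK\mapsto A L_0$, and let $\mathfrak g=\mathfrak k\oplus\mathfrak p$ be the decomposition into the $\pm1$-eigenspaces of $\sigma$. *Surfaces.* Let $M$ be a connected smooth 2-manifold. A map $y:M\to Q^n_r$ is a timelike (Lorentzian) immersion if around each point it has a smooth lift $Y$ to $\mathbb{R}^{n+2}_{r+1}\setminus\{0\}$ for which $\langle dY,dY\rangle$ is a Lorentzian metric. Given local coordinates $(u,v)$, a lift $Y$ is canonical if $\langle dY,dY\rangle=\frac12(du\otimes dv+dv\otimes du)$; its conformal Hopf differentials $\kappa_1,\kappa_2$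 are the vectors orthogonal to $V=\mathrm{Span}\{Y,Y_u,Y_v,Y_{uv}\}$ with $Y_{uu}=-\frac{s_1}{2}Y+\kappa_1$ and $Y_{vv}=-\frac{s_2}{2}Y+\kappa_2$ for real functions $s_1,s_2$. For $\varepsilon\in\{1,-1\}$, $y$ is timelike $(\varepsilon)$-isothermic if around each point there are coordinates $(u,v)$ (called adapted) and a canonical lift with $\kappa_1=\varepsilon\kappa_2$. If $y$ is timelike $(\varepsilon)$-isothermic, a timelike immersion $\hat y:M\to Q^n_r$ is a Darboux transform of $y$ (for the sign $\varepsilon$) if around each point there are adapted coordinates $(u,v)$ of $y$ with canonical lift $Y$, and a smooth lift $\hat Y$ of $\hat y$, such that $$\langle Y,\hat Y\rangle\ne0,\qquad \hat Y_u\in\mathrm{Span}\{\hat Y,Y,Y_v\},\qquad \hat Y_v\in\mathrm{Span}\{\hat Y,Y,Y_u\}.$$ Call $y,\hat y$ a Darboux pair of timelike $(\varepsilon)$-isothermic surfaces if both are timelike $(\varepsilon)$-isothermic and each is a Darboux transform of the other (for the sign $\varepsilon$). *Curved flats.* A frame of $f:M\to G/K$ over an open set $U\subset M$ is a smooth map $F:U\to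 G$ with $F(x)K=f(x)$. Write $F^{-1}dF=\alpha_0+\alpha_1$ with $\alpha_0$ taking values in $\mathfrak k$ and $\alpha_1$ in $\mathfrak p$. Then $f$ is a curved flat if around each point it has a frame for which, at each point, $\alpha_1$ is injective on the tangent space (so that $f$ is an immersion) and takes values in an abelian subalgebra of $\mathfrak g$. **Theorem.** Let $f=y\wedge\hat y:M\to G/K$ be Lorentzian non-degenerate; that is, $y,\hat y:M\to Q^n_r$ are timelike immersions and for each $x$ the Lorentzian plane $f(x)$ is spanned by the lines $y(x)$ and $\hat y(x)$. Then the following are equivalent: 1. $f$ is a curved flat; 2. for some sign $\varepsilon\in\{1,-1\}$, $y$ and $\hat y$ form a Darboux pair of timelike $(\varepsilon)$-isothermic surfaces; 3. for some sign $\varepsilon\in\{1,-1\}$, $y$ is timelike $(\varepsilon)$-isothermic and $\hat y$ is a Darboux transform of $y$; 4. around each point $f$ has a frame for which $\alpha_\lambda=\alpha_0+\lambda\alpha_1$ satisfies $d\alpha_\lambda+\frac12[\alpha_\lambda\wedge\alpha_\lambda]=0$ for all $\lambda\in\mathbb{R}$; 5. for every frame of $f$ over any open set, $\alpha_\lambda=\alpha_0+\lambda\alpha_1$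 satisfies $d\alpha_\lambda+\frac12[\alpha_\lambda\wedge\alpha_\lambda]=0$ for all $\lambda\in\mathbb{R}$. -/

import Mathlib

open scoped Manifold ContDiff MatrixGroups LinearAlgebra.Projectivization

noncomputable section

namespace TimelikeDarboux

/-! ### The space `ℝ^{n+2}_{r+1}`, the projective light cone and the symmetric space -/

/-- The sign of the `i`-th coordinate: `n - r + 1` coordinates are positive, the last `r + 1`
are negative. -/
def sgn (n r : ℕ) (i : Fin (n + 2)) : ℝ := if (i : ℕ) + r ≤ n then 1 else -1

/-- The inner product of `ℝ^{n+2}_{r+1}`. -/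
def ip (n r : ℕ) (x y : Fin (n + 2) → ℝ) : ℝ := ∑ i, sgn n r i * x i * y i

/-- The Gram matrix of the inner product of `ℝ^{n+2}_{r+1}`. -/
def gram (n r : ℕ) : Matrix (Fin (n + 2)) (Fin (n + 2)) ℝ := Matrix.diagonal (sgn n r)

/-- The projective light cone `Q^n_r`: the isotropic lines of `ℝ^{n+2}_{r+1}`. -/
def Q (n r : ℕ) : Set (ℙ ℝ (Fin (n + 2) → ℝ)) :=
  {l | ∀ x ∈ l.submodule, ip n r x x = 0}

/-- The group `O(n-r+1, r+1)`. -/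
def G (n r : ℕ) : Subgroup (GL (Fin (n + 2)) ℝ) where
  carrier := {A | (A : Matrix (Fin (n + 2)) (Fin (n + 2)) ℝ).transpose * gram n r * A = gram n r}
  one_mem' := by simp
  mul_mem' := by
    intro A B hA hB
    simp only [Set.mem_ofPred_eq, Units.val_mul, Matrix.transpose_mul] at hA hB ⊢
    calc _ = (B : Matrix (Fin (n + 2)) (Fin (n + 2)) ℝ).transpose *
          ((A : Matrix (Fin (n + 2)) (Fin (n + 2)) ℝ).transpose * gram n r * A) * B := by
            simp only [Matrix.mul_assoc]
      _ = _ := by rw [hA, hB]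
  inv_mem' := by
    intro A hA
    simp only [Set.mem_ofPred_eq] at hA ⊢
    have h1 : (A : Matrix (Fin (n + 2)) (Fin (n + 2)) ℝ) * (A⁻¹ : GL (Fin (n + 2)) ℝ) = 1 := by
      rw [← Units.val_mul, mul_inv_cancel, Units.val_one]
    have h2 : ((A⁻¹ : GL (Fin (n + 2)) ℝ) : Matrix (Fin (n + 2)) (Fin (n + 2)) ℝ).transpose *
        (A : Matrix (Fin (n + 2)) (Fin (n + 2)) ℝ).transpose = 1 := by
      rw [← Matrix.transpose_mul, h1, Matrix.transpose_one]
    calc _ = ((A⁻¹ : GL (Fin (n + 2)) ℝ) : Matrix (Fin (n + 2)) (Fin (n + 2)) ℝ).transpose *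
          ((A : Matrix (Fin (n + 2)) (Fin (n + 2)) ℝ).transpose * gram n r * A) *
          ((A⁻¹ : GL (Fin (n + 2)) ℝ) : Matrix (Fin (n + 2)) (Fin (n + 2)) ℝ) := by rw [hA]
      _ = (((A⁻¹ : GL (Fin (n + 2)) ℝ) : Matrix (Fin (n + 2)) (Fin (n + 2)) ℝ).transpose *
          (A : Matrix (Fin (n + 2)) (Fin (n + 2)) ℝ).transpose) * gram n r *
          ((A : Matrix (Fin (n + 2)) (Fin (n + 2)) ℝ) * (A⁻¹ : GL (Fin (n + 2)) ℝ)) := by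
            simp only [Matrix.mul_assoc]
      _ = _ := by rw [h1, h2, Matrix.one_mul, Matrix.mul_one]

/-- The underlying matrix of an element of `O(n-r+1, r+1)`. -/
def mat {n r : ℕ} (A : G n r) : Matrix (Fin (n + 2)) (Fin (n + 2)) ℝ :=
  ((A : GL (Fin (n + 2)) ℝ) : Matrix (Fin (n + 2)) (Fin (n + 2)) ℝ)

/-- The reflection in the Lorentzian coordinate plane spanned by the first basis vector (which is
positive) and the last one (which is negative). Conjugation by it is the involution `σ` of
`O(n-r+1, r+1)`. -/
def refl (n : ℕ) : Matrix (Fin (n + 2)) (Fin (n + 2)) ℝ :=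
  Matrix.diagonal fun i => if i = 0 ∨ i = Fin.last (n + 1) then -1 else 1

theorem refl_mul_refl (n : ℕ) : refl n * refl n = 1 := by
  rw [refl, Matrix.diagonal_mul_diagonal, ← Matrix.diagonal_one]
  congr 1
  funext i
  split_ifs <;> norm_num

/-- The fixed subgroup `K = O(n-r, r) × O(1,1)` of the involution. -/
def K (n r : ℕ) : Subgroup (G n r) where
  carrier := {A | refl n * mat A * refl n = mat A}
  one_mem' := by simp [mat, refl_mul_refl]
  mul_mem' := by
    intro A B hA hB
    have hm : mat (A * B) = mat A * mat B := rfl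
    simp only [Set.mem_ofPred_eq] at hA hB ⊢
    calc refl n * mat (A * B) * refl n
        = (refl n * mat A * (refl n * refl n)) * mat B * refl n := by
          rw [refl_mul_refl, hm]; simp only [Matrix.mul_assoc, Matrix.one_mul]
      _ = (refl n * mat A * refl n) * (refl n * mat B * refl n) := by
          simp only [Matrix.mul_assoc]
      _ = mat (A * B) := by rw [hA, hB, hm]
  inv_mem' := by
    intro A hA
    simp only [Set.mem_ofPred_eq] at hA ⊢
    have h1 : mat A * mat A⁻¹ = 1 := by
      change mat (A * A⁻¹) = 1
      rw [mul_inv_cancel]; simp [mat]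
    have h2 : mat A⁻¹ * mat A = 1 := by
      change mat (A⁻¹ * A) = 1
      rw [inv_mul_cancel]; simp [mat]
    have h3 : refl n * mat A⁻¹ * refl n * mat A = 1 := by
      conv_lhs => rw [← hA]
      calc _ = refl n * mat A⁻¹ * (refl n * refl n) * mat A * refl n := by
            simp only [Matrix.mul_assoc]
        _ = refl n * (mat A⁻¹ * mat A) * refl n := by
            rw [refl_mul_refl]; simp only [Matrix.mul_assoc, Matrix.one_mul]
        _ = 1 := by rw [h2, Matrix.mul_one, refl_mul_refl]
    calc refl n * mat A⁻¹ * refl n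
        = refl n * mat A⁻¹ * refl n * (mat A * mat A⁻¹) := by rw [h1, Matrix.mul_one]
      _ = (refl n * mat A⁻¹ * refl n * mat A) * mat A⁻¹ := by simp only [Matrix.mul_assoc]
      _ = _ := by rw [h3, Matrix.one_mul]

/-- The Lorentzian coordinate plane, as the `-1`-eigenspace of the reflection. -/
def basePlane (n : ℕ) : Submodule ℝ (Fin (n + 2) → ℝ) where
  carrier := {x | (refl n).mulVec x = -x}
  zero_mem' := by simp
  add_mem' := by
    intro x y hx hy
    simp only [Set.mem_ofPred_eq] at hx hy ⊢
    rw [Matrix.mulVec_add, hx, hy, neg_add]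
  smul_mem' := by
    intro c x hx
    simp only [Set.mem_ofPred_eq] at hx ⊢
    rw [Matrix.mulVec_smul, hx, smul_neg]

theorem map_basePlane_le {n r : ℕ} (B : G n r) (hB : B ∈ K n r) :
    (basePlane n).map (Matrix.mulVecLin (mat B)) ≤ basePlane n := by
  rintro _ ⟨x, hx, rfl⟩
  have hB' : refl n * mat B * refl n = mat B := hB
  have hx' : (refl n).mulVec x = -x := hx
  have hc : refl n * mat B = mat B * refl n := by
    conv_rhs => rw [← hB']
    rw [Matrix.mul_assoc _ (refl n) (refl n), refl_mul_refl, Matrix.mul_one]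
  change (refl n).mulVec ((mat B).mulVec x) = -((mat B).mulVec x)
  rw [Matrix.mulVec_mulVec, hc, ← Matrix.mulVec_mulVec, hx', Matrix.mulVec_neg]

/-- The identification of `O(n-r+1, r+1) / O(n-r, r) × O(1,1)` with the Grassmannian of Lorentzian
planes in `ℝ^{n+2}_{r+1}`: the coset of `A` is sent to the image of the coordinate plane
under `A`. -/
def plane {n r : ℕ} (q : G n r ⧸ K n r) : Submodule ℝ (Fin (n + 2) → ℝ) :=
  Quotient.liftOn' q (fun A => (basePlane n).map (Matrix.mulVecLin (mat A))) (by
    have key : ∀ A B : G n r, A⁻¹ * B ∈ K n r →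
        (basePlane n).map (Matrix.mulVecLin (mat B)) ≤
          (basePlane n).map (Matrix.mulVecLin (mat A)) := by
      intro A B h
      have hB : mat B = mat A * mat (A⁻¹ * B) := by
        change mat B = mat (A * (A⁻¹ * B))
        rw [mul_inv_cancel_left]
      rw [hB, Matrix.mulVecLin_mul, Submodule.map_comp]
      exact Submodule.map_mono (map_basePlane_le _ h)
    intro A B h
    have h' : A⁻¹ * B ∈ K n r := QuotientGroup.leftRel_apply.mp h
    refine le_antisymm (key B A ?_) (key A B h')
    have := (K n r).inv_mem h'
    simpa using this)

/-- The projection of a matrix to the `+1`-eigenspace `𝔨` of the involution. -/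
def projK {n : ℕ} (A : Matrix (Fin (n + 2)) (Fin (n + 2)) ℝ) :
    Matrix (Fin (n + 2)) (Fin (n + 2)) ℝ :=
  (1 / 2 : ℝ) • (A + refl n * A * refl n)

/-- The projection of a matrix to the `-1`-eigenspace `𝔭` of the involution. -/
def projP {n : ℕ} (A : Matrix (Fin (n + 2)) (Fin (n + 2)) ℝ) :
    Matrix (Fin (n + 2)) (Fin (n + 2)) ℝ :=
  (1 / 2 : ℝ) • (A - refl n * A * refl n)

/-! ### Surfaces in the projective light cone -/

variable {M : Type*} [TopologicalSpace M] [ChartedSpace (EuclideanSpace ℝ (Fin 2)) M]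

/-- The partial derivative of `g` with respect to the `k`-th coordinate of the chart `e`; the
coordinates `(u, v)` are number `0` and number `1`. -/
def coordDeriv {W : Type*} [NormedAddCommGroup W] [NormedSpace ℝ W]
    (e : OpenPartialHomeomorph M (EuclideanSpace ℝ (Fin 2))) (k : Fin 2) (g : M → W) (x : M) : W :=
  fderiv ℝ (g ∘ e.symm) (e x) (EuclideanSpace.single k 1)

/-- `Y` is a smooth lift of `y` to the punctured light cone over the set `U`. -/
def IsLift {n r : ℕ} (y : M → Q n r) (U : Set M) (Y : M → Fin (n + 2) → ℝ) : Prop :=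
  ContMDiffOn (𝓡 2) 𝓘(ℝ, Fin (n + 2) → ℝ) ∞ Y U ∧
    ∀ x ∈ U, Y x ≠ 0 ∧ (y x : ℙ ℝ (Fin (n + 2) → ℝ)).submodule = Submodule.span ℝ {Y x}

/-- The metric induced by a lift, on the tangent space at `x`. -/
def inducedMetric (n r : ℕ) (Y : M → Fin (n + 2) → ℝ) (x : M) (X Z : TangentSpace (𝓡 2) x) : ℝ :=
  ip n r (mfderiv (𝓡 2) 𝓘(ℝ, Fin (n + 2) → ℝ) Y x X)
    (mfderiv (𝓡 2) 𝓘(ℝ, Fin (n + 2) → ℝ) Y x Z)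

/-- `y` is a timelike surface, that is, a Lorentzian immersion: it is smooth (it has smooth local
lifts) and the induced conformal structure is Lorentzian. A quadratic form on a plane has
signature `(1,1)` exactly if it takes positive and negative values; in particular it is then
nondegenerate, which makes `y` an immersion. -/
def IsTimelikeImmersion {n r : ℕ} (y : M → Q n r) : Prop :=
  ∀ p : M, ∃ U : Set M, IsOpen U ∧ p ∈ U ∧ ∃ Y : M → Fin (n + 2) → ℝ, IsLift y U Y ∧
    ∀ x ∈ U, (∃ X, 0 < inducedMetric n r Y x X X) ∧ (∃ X, inducedMetric n r Y x X X < 0)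

/-- The chart `e = (u, v)` is an asymptotic coordinate of `y`, and `Y` is the canonical lift with
respect to it: `⟨dY, dY⟩ = (du ⊗ dv + dv ⊗ du) / 2`. -/
def IsCanonicalLift [IsManifold (𝓡 2) ∞ M] {n r : ℕ} (y : M → Q n r)
    (e : OpenPartialHomeomorph M (EuclideanSpace ℝ (Fin 2))) (Y : M → Fin (n + 2) → ℝ) : Prop :=
  e ∈ IsManifold.maximalAtlas (𝓡 2) ∞ M ∧ IsLift y e.source Y ∧
    ∀ x ∈ e.source,
      ip n r (coordDeriv e 0 Y x) (coordDeriv e 0 Y x) = 0 ∧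
      ip n r (coordDeriv e 1 Y x) (coordDeriv e 1 Y x) = 0 ∧
      ip n r (coordDeriv e 0 Y x) (coordDeriv e 1 Y x) = 1 / 2

/-- The conformal tangent space `Span {Y, Y_u, Y_v, Y_uv}` at `x`. -/
def conformalTangent {n : ℕ} (e : OpenPartialHomeomorph M (EuclideanSpace ℝ (Fin 2)))
    (Y : M → Fin (n + 2) → ℝ) (x : M) : Submodule ℝ (Fin (n + 2) → ℝ) :=
  Submodule.span ℝ {Y x, coordDeriv e 0 Y x, coordDeriv e 1 Y x,
    coordDeriv e 1 (coordDeriv e 0 Y) x}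

/-- `κ₁, κ₂` are the values at `x` of the conformal Hopf differentials of the canonical lift `Y`:
they are conformal normal vectors with `Y_uu = -(s₁/2) Y + κ₁` and `Y_vv = -(s₂/2) Y + κ₂`. -/
def AreHopf {n : ℕ} (r : ℕ) (e : OpenPartialHomeomorph M (EuclideanSpace ℝ (Fin 2)))
    (Y : M → Fin (n + 2) → ℝ) (x : M) (κ₁ κ₂ : Fin (n + 2) → ℝ) : Prop :=
  (∀ w ∈ conformalTangent e Y x, ip n r κ₁ w = 0) ∧
  (∀ w ∈ conformalTangent e Y x, ip n r κ₂ w = 0) ∧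
  (∃ s₁ : ℝ, coordDeriv e 0 (coordDeriv e 0 Y) x = -(s₁ / 2) • Y x + κ₁) ∧
  (∃ s₂ : ℝ, coordDeriv e 1 (coordDeriv e 1 Y) x = -(s₂ / 2) • Y x + κ₂)

/-- The chart `e` is an adapted coordinate of `y` with canonical lift `Y`, for the sign `ε`:
`κ₁ = ε κ₂`. -/
def IsAdapted [IsManifold (𝓡 2) ∞ M] {n r : ℕ} (ε : ℤˣ) (y : M → Q n r)
    (e : OpenPartialHomeomorph M (EuclideanSpace ℝ (Fin 2))) (Y : M → Fin (n + 2) → ℝ) : Prop :=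
  IsCanonicalLift y e Y ∧
    ∀ x ∈ e.source, ∃ κ₁ κ₂ : Fin (n + 2) → ℝ, AreHopf r e Y x κ₁ κ₂ ∧ κ₁ = ε • κ₂

/-- `y` is a timelike `(+)`-isothermic (`ε = 1`) or `(-)`-isothermic (`ε = -1`) surface. -/
def IsIsothermic [IsManifold (𝓡 2) ∞ M] {n r : ℕ} (ε : ℤˣ) (y : M → Q n r) : Prop :=
  ∀ p : M, ∃ e Y, p ∈ e.source ∧ IsAdapted ε y e Y

/-- `z` is a Darboux transform of the timelike `(ε)`-isothermic surface `y`: it is a timelike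
immersion, and around each point there are an adapted coordinate `(u, v)` of `y` with canonical
lift `Y` and a lift `Z` of `z` such that `⟨Y, Z⟩ ≠ 0`, `Z_u ∈ Span {Z, Y, Y_v}` and
`Z_v ∈ Span {Z, Y, Y_u}`. -/
def IsDarbouxTransform [IsManifold (𝓡 2) ∞ M] {n r : ℕ} (ε : ℤˣ) (y z : M → Q n r) : Prop :=
  IsIsothermic ε y ∧ IsTimelikeImmersion z ∧
  ∀ p : M, ∃ e Y, p ∈ e.source ∧ IsAdapted ε y e Y ∧ ∃ Z, IsLift z e.source Z ∧
    ∀ x ∈ e.source, ip n r (Y x) (Z x) ≠ 0 ∧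
      coordDeriv e 0 Z x ∈ Submodule.span ℝ {Z x, Y x, coordDeriv e 1 Y x} ∧
      coordDeriv e 1 Z x ∈ Submodule.span ℝ {Z x, Y x, coordDeriv e 0 Y x}

/-- `y` and `z` form a Darboux pair of timelike `(ε)`-isothermic surfaces: both are
`(ε)`-isothermic, and each is a Darboux transform of the other. -/
def IsDarbouxPair [IsManifold (𝓡 2) ∞ M] {n r : ℕ} (ε : ℤˣ) (y z : M → Q n r) : Prop :=
  IsDarbouxTransform ε y z ∧ IsDarbouxTransform ε z y

/-! ### Frames, curved flats and the loop of Maurer-Cartan forms -/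

attribute [local instance] LieRing.ofAssociativeRing

/-- `f = y ∧ z`: the plane `f x` is spanned by the lines `y x` and `z x`. -/
def IsWedge {n r : ℕ} (f : M → G n r ⧸ K n r) (y z : M → Q n r) : Prop :=
  ∀ x, plane (f x) = (y x : ℙ ℝ (Fin (n + 2) → ℝ)).submodule ⊔
    (z x : ℙ ℝ (Fin (n + 2) → ℝ)).submodule

/-- `F` is a smooth frame of `f` over the open set `U`. -/
def IsFrame {n r : ℕ} (f : M → G n r ⧸ K n r) (U : Set M) (F : M → G n r) : Prop :=
  IsOpen U ∧ (∀ i j, ContMDiffOn (𝓡 2) 𝓘(ℝ, ℝ) ∞ (fun x => mat (F x) i j) U) ∧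
    ∀ x ∈ U, (F x : G n r ⧸ K n r) = f x

/-- The value `F⁻¹ dF (X)` of the Maurer-Cartan form on the tangent vector `X` at `x`. -/
def maurerCartan {n r : ℕ} (F : M → G n r) (x : M) (X : TangentSpace (𝓡 2) x) :
    Matrix (Fin (n + 2)) (Fin (n + 2)) ℝ :=
  mat (F x)⁻¹ * Matrix.of fun i j => mfderiv (𝓡 2) 𝓘(ℝ, ℝ) (fun p => mat (F p) i j) x X

/-- `f` is a curved flat: it has frames around each point for which `f` is an immersion
(the `𝔭`-part of the Maurer-Cartan form is injective) and the `𝔭`-part of the Maurer-Cartan form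
takes, at each point, values in an abelian subalgebra of `𝔤 = 𝔬(n-r+1, r+1)`. -/
def IsCurvedFlat {n r : ℕ} (f : M → G n r ⧸ K n r) : Prop :=
  ∀ p : M, ∃ U F, p ∈ U ∧ IsFrame f U F ∧ ∀ x ∈ U,
    (∀ X, projP (maurerCartan F x X) = 0 → X = 0) ∧
    ∃ 𝔞 : LieSubalgebra ℝ (Matrix (Fin (n + 2)) (Fin (n + 2)) ℝ),
      𝔞 ≤ skewAdjointMatricesLieSubalgebra (gram n r) ∧ IsLieAbelian 𝔞 ∧
      ∀ X, projP (maurerCartan F x X) ∈ 𝔞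

/-- The partial derivative of a matrix valued function, entry by entry. -/
def coordDerivMat {n : ℕ} (e : OpenPartialHomeomorph M (EuclideanSpace ℝ (Fin 2))) (k : Fin 2)
    (A : M → Matrix (Fin (n + 2)) (Fin (n + 2)) ℝ) (x : M) :
    Matrix (Fin (n + 2)) (Fin (n + 2)) ℝ :=
  Matrix.of fun i j => coordDeriv e k (fun p => A p i j) x

/-- The `k`-th coefficient, in the chart `e`, of the form `α_λ = α_𝔨 + λ α_𝔭`, where
`F⁻¹ dF = α_𝔨 + α_𝔭`. -/
def loopCoeff {n r : ℕ} (F : M → G n r) (t : ℝ)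
    (e : OpenPartialHomeomorph M (EuclideanSpace ℝ (Fin 2))) (k : Fin 2) (x : M) :
    Matrix (Fin (n + 2)) (Fin (n + 2)) ℝ :=
  projK (mat (F x)⁻¹ * coordDerivMat e k (fun p => mat (F p)) x) +
    t • projP (mat (F x)⁻¹ * coordDerivMat e k (fun p => mat (F p)) x)

/-- The form `α_λ` satisfies `dα_λ + [α_λ ∧ α_λ] / 2 = 0` on `U` for all real `λ`. The equation
between 2-forms is evaluated, in each chart, on the two coordinate vector fields. -/
def IsFlatLoop [IsManifold (𝓡 2) ∞ M] {n r : ℕ} (U : Set M) (F : M → G n r) : Prop :=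
  ∀ t : ℝ, ∀ e ∈ IsManifold.maximalAtlas (𝓡 2) ∞ M, ∀ x ∈ U ∩ e.source,
    coordDerivMat e 0 (loopCoeff F t e 1) x - coordDerivMat e 1 (loopCoeff F t e 0) x +
      (loopCoeff F t e 0 x * loopCoeff F t e 1 x - loopCoeff F t e 1 x * loopCoeff F t e 0 x) = 0

end TimelikeDarboux

end

open scoped Manifold ContDiff MatrixGroups LinearAlgebra.Projectivization

noncomputable section

namespace TimelikeDarboux

local notation "𝔼" => EuclideanSpace ℝ (Fin 2)

/-! ### The inner product -/

section InnerProduct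

variable {n r : ℕ}

/-! Everything is read off from one object that needs no frame: the field `R` of reflections in the
planes `f x` (`reflField`). For a frame `F` and `ρ = refl n` one has `R = F ρ F⁻¹`, hence `dR = 2 F
(α₁ ρ) F⁻¹`. Since `α₁` anticommutes with `ρ`, `dR(X) dR(X') = -4 F α₁(X) α₁(X') F⁻¹`. So the values
of `α₁` commute at a point for one frame iff they do for every frame iff the values of `dR` commute
there (`ReflDerivCommute`, `IsFrame.commute_iff`). Each of the five conditions amounts to this
commutation at every point.

Flat loops: splitting the Maurer-Cartan equation along `𝔨 ⊕ 𝔭` shows that the curvature of `α_λ` is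
`λ² - 1` times the bracket of the `𝔭`-parts (`loop_curvature`). Curved flats: commuting matrices
span an abelian subalgebra, and injectivity of `α₁` is automatic because the metric of `y` is
nondegenerate.

Surfaces: take lifts with `⟨Y, Z⟩ = 1`. Then `dR` is `-2` times the map `motion`. If the motions
commute, then `⟨dY(A), dZ(B)⟩` is symmetric in `A`, `B`, and for null directions `X₁`, `X₂` of `Y`
the normal part of `dZ(X₁)` is a multiple of that of `dY(X₂)`, and vice versa
(`eq_smul_of_motion_comm`). Conversely, such an interchange of null directions makes the motions
commute (`motion_comm_of_eq_smul`), and it is exactly what the Darboux condition provides.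

To construct a Darboux transform from commuting motions, note that the symmetry makes the one-form
`⟨dY, Z⟩` closed, so `Y` and `Z` can be rescaled to `⟨dY, Z⟩ = 0`. Normalize `X₁`, `X₂` so that
`⟨dY(Xᵢ), dZ(Xᵢ)⟩ = δᵢ = ±1`. The dual one-forms are then closed (`closed_of_null_frame`), which
gives coordinates with `g Z_u = δ₁ Y_v` and `g Z_v = δ₂ Y_u`, where `g = ⟨Y_u, Y_v⟩`. For the
canonical lift `a Y`, with `a² g = 1/2`, the vectors `(aY)_uu` and `(aY)_vv` equal `δ₂ a g Z_uv` and
`δ₁ a g Z_uv` modulo `Y`; hence `κ₁ = δ₁ δ₂ κ₂`.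

The sign `ε = δ₁ δ₂` is the sign of the conformal factor between the metrics of `y` and `z`. It is
locally constant, hence constant on the connected surface, and symmetric in `y` and `z`, so one `ε`
serves both halves of the Darboux pair. -/

theorem ip_comm (x y : Fin (n + 2) → ℝ) : ip n r x y = ip n r y x := by
  simp only [ip]; exact Finset.sum_congr rfl fun i _ => by ring

theorem ip_add_left (x y w : Fin (n + 2) → ℝ) : ip n r (x + y) w = ip n r x w + ip n r y w := by
  simp only [ip, ← Finset.sum_add_distrib]
  exact Finset.sum_congr rfl fun i _ => by simp only [Pi.add_apply]; ring

theorem ip_smul_left (c : ℝ) (x w : Fin (n + 2) → ℝ) : ip n r (c • x) w = c * ip n r x w := by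
  simp only [ip, Finset.mul_sum]
  exact Finset.sum_congr rfl fun i _ => by simp only [Pi.smul_apply, smul_eq_mul]; ring

theorem ip_add_right (w x y : Fin (n + 2) → ℝ) : ip n r w (x + y) = ip n r w x + ip n r w y := by
  rw [ip_comm, ip_add_left, ip_comm x, ip_comm y]

theorem ip_smul_right (c : ℝ) (w x : Fin (n + 2) → ℝ) : ip n r w (c • x) = c * ip n r w x := by
  rw [ip_comm, ip_smul_left, ip_comm x]

theorem ip_zero_left (w : Fin (n + 2) → ℝ) : ip n r 0 w = 0 := by simp [ip]

theorem ip_zero_right (w : Fin (n + 2) → ℝ) : ip n r w 0 = 0 := by simp [ip]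

theorem ip_neg_left (x w : Fin (n + 2) → ℝ) : ip n r (-x) w = -ip n r x w := by
  simp [ip]

theorem ip_neg_right (w x : Fin (n + 2) → ℝ) : ip n r w (-x) = -ip n r w x := by
  simp [ip]

theorem ip_sub_left (x y w : Fin (n + 2) → ℝ) : ip n r (x - y) w = ip n r x w - ip n r y w := by
  rw [sub_eq_add_neg, ip_add_left, ip_neg_left, sub_eq_add_neg]

theorem ip_sub_right (w x y : Fin (n + 2) → ℝ) : ip n r w (x - y) = ip n r w x - ip n r w y := by
  rw [sub_eq_add_neg, ip_add_right, ip_neg_right, sub_eq_add_neg]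

/-- The inner product as a continuous bilinear map. -/
def ipL (n r : ℕ) : (Fin (n + 2) → ℝ) →L[ℝ] (Fin (n + 2) → ℝ) →L[ℝ] ℝ :=
  (LinearMap.mk₂ ℝ (ip n r) ip_add_left ip_smul_left ip_add_right
    ip_smul_right).toContinuousBilinearMap

variable {F : Type*} [NormedAddCommGroup F] [NormedSpace ℝ F] {Y Z : F → Fin (n + 2) → ℝ} {x : F}
  {s : Set F}

theorem hasFDerivAt_ip (hY : DifferentiableAt ℝ Y x) (hZ : DifferentiableAt ℝ Z x) :
    HasFDerivAt (fun p => ip n r (Y p) (Z p))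
      ((ipL n r).precompR F (Y x) (fderiv ℝ Z x) + (ipL n r).precompL F (fderiv ℝ Y x) (Z x)) x :=
  (ipL n r).hasFDerivAt_of_bilinear hY.hasFDerivAt hZ.hasFDerivAt

theorem fderiv_ip (hY : DifferentiableAt ℝ Y x) (hZ : DifferentiableAt ℝ Z x) (A : F) :
    fderiv ℝ (fun p => ip n r (Y p) (Z p)) x A =
      ip n r (fderiv ℝ Y x A) (Z x) + ip n r (Y x) (fderiv ℝ Z x A) := by
  rw [(hasFDerivAt_ip hY hZ).fderiv, add_comm]; rfl

theorem contDiffOn_ip {m : WithTop ℕ∞} (hY : ContDiffOn ℝ m Y s) (hZ : ContDiffOn ℝ m Z s) :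
    ContDiffOn ℝ m (fun p => ip n r (Y p) (Z p)) s := by
  have h : (fun p => ip n r (Y p) (Z p)) = fun p => ipL n r (Y p) (Z p) := rfl
  rw [h]
  exact ((ipL n r).contDiff.comp_contDiffOn hY).clm_apply hZ

end InnerProduct

/-! ### Lorentzian forms on a plane -/

section Plane

variable {n r : ℕ}

/-- Two null vectors with nonzero product are dual to each other up to scale: pairing with one reads
off the coefficient of the other. -/
theorem eq_smul_add_smul_of_null (y : 𝔼 →ₗ[ℝ] Fin (n + 2) → ℝ) {X₁ X₂ : 𝔼}
    (h₁ : ip n r (y X₁) (y X₁) = 0) (h₂ : ip n r (y X₂) (y X₂) = 0)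
    (h : ip n r (y X₁) (y X₂) ≠ 0) (X : 𝔼) :
    X = (ip n r (y X) (y X₂) / ip n r (y X₁) (y X₂)) • X₁ +
      (ip n r (y X) (y X₁) / ip n r (y X₁) (y X₂)) • X₂ := by
  have hli : LinearIndependent ℝ ![X₁, X₂] := by
    rw [LinearIndependent.pair_iff]
    intro a b hab
    have e1 : ip n r (y (a • X₁ + b • X₂)) (y X₁) = 0 := by rw [hab, map_zero, ip_zero_left]
    have e2 : ip n r (y (a • X₁ + b • X₂)) (y X₂) = 0 := by rw [hab, map_zero, ip_zero_left]
    simp only [map_add, map_smul, ip_add_left, ip_smul_left, h₁, h₂, mul_zero, zero_add,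
      add_zero] at e1 e2
    rw [ip_comm] at e1
    exact ⟨by simpa [h] using e2, by simpa [h] using e1⟩
  have hspan := hli.span_eq_top_of_card_eq_finrank (by simp)
  have hX : X ∈ Submodule.span ℝ (Set.range ![X₁, X₂]) := by rw [hspan]; trivial
  rw [Matrix.range_cons, Matrix.range_cons, Matrix.range_empty, Set.union_empty,
    Set.singleton_union, Submodule.mem_span_pair] at hX
  obtain ⟨a, b, rfl⟩ := hX
  simp only [map_add, map_smul, ip_add_left, ip_smul_left, h₁, h₂, mul_zero, zero_add, add_zero]
  rw [ip_comm (y X₂) (y X₁), mul_div_cancel_right₀ _ h, mul_div_cancel_right₀ _ h]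

/-- The two slopes `τ` for which `τ • B + A` is a null vector. -/
theorem null_combination {a b c s : ℝ} (hc : c ≠ 0) (hs : s ^ 2 = b ^ 2 - a * c) :
    ((-b + s) / c) ^ 2 * c + 2 * ((-b + s) / c) * b + a = 0 := by
  field_simp
  linear_combination hs

theorem ip_combination (y : 𝔼 →ₗ[ℝ] Fin (n + 2) → ℝ) (A B : 𝔼) (t t' : ℝ) :
    ip n r (y (t • B + A)) (y (t' • B + A)) = t * t' * ip n r (y B) (y B) +
      (t + t') * ip n r (y A) (y B) + ip n r (y A) (y A) := by
  simp only [map_add, map_smul, ip_add_left, ip_smul_left, ip_add_right, ip_smul_right]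
  rw [ip_comm (y B) (y A)]
  ring

/-- The null vectors in the plane spanned by a positive vector `A` and a negative vector `B`. -/
theorem null_basis (y : 𝔼 →ₗ[ℝ] Fin (n + 2) → ℝ) {A B : 𝔼} {a b c s : ℝ}
    (ha : ip n r (y A) (y A) = a) (hb : ip n r (y A) (y B) = b) (hc : ip n r (y B) (y B) = c)
    (hA : 0 < a) (hB : c < 0) (hs : s ^ 2 = b ^ 2 - a * c) :
    ip n r (y (((-b + s) / c) • B + A)) (y (((-b + s) / c) • B + A)) = 0 ∧
    ip n r (y (((-b + -s) / c) • B + A)) (y (((-b + -s) / c) • B + A)) = 0 ∧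
    0 < ip n r (y (((-b + s) / c) • B + A)) (y (((-b + -s) / c) • B + A)) := by
  have hs' : (-s) ^ 2 = b ^ 2 - a * c := by rw [neg_sq, hs]
  simp only [ip_combination, ha, hb, hc]
  refine ⟨by linear_combination null_combination hB.ne hs,
    by linear_combination null_combination hB.ne hs', ?_⟩
  have hD : 0 < b ^ 2 - a * c := by nlinarith [mul_pos hA (neg_pos.2 hB), sq_nonneg b]
  -- The two slopes have product `a / c` and sum `-2b / c`, so the pairing equals `2 (b² - ac) /
  -- (-c)`, which is positive because `c < 0 < a`.
  have : (-b + s) / c * ((-b + -s) / c) * c + ((-b + s) / c + (-b + -s) / c) * b + a =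
      2 * ((b ^ 2 - a * c) / (-c)) := by
    have := hB.ne
    rw [show (-b + s) / c * ((-b + -s) / c) = (b ^ 2 - s ^ 2) / c ^ 2 by field_simp; ring, hs]
    field_simp
    ring
  rw [this]
  have := div_pos hD (neg_pos.2 hB)
  linarith

theorem exists_null_basis (y : 𝔼 →ₗ[ℝ] Fin (n + 2) → ℝ)
    (hp : ∃ A, 0 < ip n r (y A) (y A)) (hm : ∃ B, ip n r (y B) (y B) < 0) :
    ∃ X₁ X₂, ip n r (y X₁) (y X₁) = 0 ∧ ip n r (y X₂) (y X₂) = 0 ∧ 0 < ip n r (y X₁) (y X₂) := by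
  obtain ⟨A, hA⟩ := hp
  obtain ⟨B, hB⟩ := hm
  exact ⟨_, _, null_basis y rfl rfl rfl hA hB
    (Real.sq_sqrt (by nlinarith [mul_pos hA (neg_pos.2 hB), sq_nonneg (ip n r (y A) (y B))]))⟩

/-- A tangent vector orthogonal to all tangent vectors of a Lorentzian plane vanishes. -/
theorem eq_zero_of_forall_ip_eq_zero (y : 𝔼 →ₗ[ℝ] Fin (n + 2) → ℝ)
    (hp : ∃ A, 0 < ip n r (y A) (y A)) (hm : ∃ B, ip n r (y B) (y B) < 0) {X : 𝔼}
    (hX : ∀ A, ip n r (y X) (y A) = 0) : X = 0 := by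
  obtain ⟨X₁, X₂, h₁, h₂, h⟩ := exists_null_basis y hp hm
  rw [eq_smul_add_smul_of_null y h₁ h₂ h.ne' X, hX, hX]
  simp

end Plane

/-! ### The infinitesimal motion of a Lorentzian plane -/

section Motion

variable {n r : ℕ}

/-- If the plane spanned by the isotropic vectors `Y`, `Z` moves with velocity `Y' = y`, `Z' = z`,
then the reflection in it changes by `-2` times this map. -/
def motion (n r : ℕ) (Y Z y z w : Fin (n + 2) → ℝ) : Fin (n + 2) → ℝ :=
  ip n r w z • Y + ip n r w Z • y + ip n r w y • Z + ip n r w Y • z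

/-- The reflection depends only on the two lines, so a rescaling that keeps `⟨Y, Z⟩` leaves its
derivative unchanged. Here `b` plays the derivative of the factor `a`, and the velocities are those
of `a Y` and `a⁻¹ Z`. -/
theorem motion_rescale (Y Z y z w : Fin (n + 2) → ℝ) {a : ℝ} (ha : a ≠ 0) (b : ℝ) :
    motion n r (a • Y) (a⁻¹ • Z) (a • y + b • Y) (a⁻¹ • z - (a⁻¹ ^ 2 * b) • Z) w =
      motion n r Y Z y z w := by
  ext i
  simp only [motion, ip_add_right, ip_sub_right, ip_smul_right, Pi.add_apply, Pi.smul_apply,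
    Pi.sub_apply, smul_eq_mul]
  field_simp
  ring

variable {Y Z y₁ y₂ z₁ z₂ : Fin (n + 2) → ℝ}

/-- The hypotheses that `Y`, `Z` is a null basis of a Lorentzian plane, and that `y` is normal
to it. -/
structure IsNormalTo (n r : ℕ) (Y Z y : Fin (n + 2) → ℝ) : Prop where
  left : ip n r y Y = 0
  right : ip n r y Z = 0

/-- The first two terms see only the normal part of `w` and are normal; the last two see only its
component in the plane and stay in the plane. The consequences of commutation are components of this
formula. -/
theorem motion_motion (hYZ : ip n r Y Z = 1) (hYY : ip n r Y Y = 0) (hZZ : ip n r Z Z = 0)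
    (hy₁ : IsNormalTo n r Y Z y₁) (hz₁ : IsNormalTo n r Y Z z₁)
    (hy₂ : IsNormalTo n r Y Z y₂) (hz₂ : IsNormalTo n r Y Z z₂) (w : Fin (n + 2) → ℝ) :
    motion n r Y Z y₁ z₁ (motion n r Y Z y₂ z₂ w) =
      ip n r w z₂ • y₁ + ip n r w y₂ • z₁ +
      ip n r w Z • (ip n r y₂ z₁ • Y + ip n r y₂ y₁ • Z) +
      ip n r w Y • (ip n r z₂ z₁ • Y + ip n r z₂ y₁ • Z) := by
  have hZY : ip n r Z Y = 1 := by rw [ip_comm, hYZ]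
  have e1 := hy₁.left; have e2 := hy₁.right; have e3 := hz₁.left; have e4 := hz₁.right
  rw [ip_comm] at e1 e2 e3 e4
  ext i
  simp only [motion, ip_add_left, ip_smul_left, hy₂.left, hy₂.right, hz₂.left, hz₂.right, hYZ, hYY,
    hZZ, hZY, e1, e2, e3, e4, Pi.add_apply, Pi.smul_apply, smul_eq_mul]
  ring

/-- Apply both products to `Z` and pair with `Y`: only `⟨z₂, y₁⟩` and `⟨z₁, y₂⟩` survive. -/
theorem ip_symm_of_motion_comm (hYZ : ip n r Y Z = 1) (hYY : ip n r Y Y = 0)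
    (hZZ : ip n r Z Z = 0)
    (hy₁ : IsNormalTo n r Y Z y₁) (hz₁ : IsNormalTo n r Y Z z₁)
    (hy₂ : IsNormalTo n r Y Z y₂) (hz₂ : IsNormalTo n r Y Z z₂)
    (h : ∀ w, motion n r Y Z y₁ z₁ (motion n r Y Z y₂ z₂ w) =
      motion n r Y Z y₂ z₂ (motion n r Y Z y₁ z₁ w)) :
    ip n r y₁ z₂ = ip n r y₂ z₁ := by
  have hZY : ip n r Z Y = 1 := by rw [ip_comm, hYZ]
  have e1 := hy₁.right; have e2 := hy₂.right; have e3 := hz₁.right; have e4 := hz₂.right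
  rw [ip_comm] at e1 e2 e3 e4
  have := congrArg (fun v => ip n r v Y) (h Z)
  simp only [motion_motion hYZ hYY hZZ hy₁ hz₁ hy₂ hz₂, motion_motion hYZ hYY hZZ hy₂ hz₂ hy₁ hz₁,
    ip_add_left, ip_smul_left, hYY, hZZ, hZY, e1, e2, e3, e4] at this
  rw [ip_comm y₁, ip_comm y₂]
  linarith

/-- Once the mixed products are symmetric, the parts of the two compositions inside the plane
coincide, and only the normal parts are left to compare. -/
theorem ip_smul_add_of_motion_comm (hYZ : ip n r Y Z = 1) (hYY : ip n r Y Y = 0)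
    (hZZ : ip n r Z Z = 0)
    (hy₁ : IsNormalTo n r Y Z y₁) (hz₁ : IsNormalTo n r Y Z z₁)
    (hy₂ : IsNormalTo n r Y Z y₂) (hz₂ : IsNormalTo n r Y Z z₂)
    (h : ∀ w, motion n r Y Z y₁ z₁ (motion n r Y Z y₂ z₂ w) =
      motion n r Y Z y₂ z₂ (motion n r Y Z y₁ z₁ w)) (w : Fin (n + 2) → ℝ) :
    ip n r w z₂ • y₁ + ip n r w y₂ • z₁ = ip n r w z₁ • y₂ + ip n r w y₁ • z₂ := by
  have h1 := ip_symm_of_motion_comm hYZ hYY hZZ hy₁ hz₁ hy₂ hz₂ h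
  have := h w
  rw [motion_motion hYZ hYY hZZ hy₁ hz₁ hy₂ hz₂, motion_motion hYZ hYY hZZ hy₂ hz₂ hy₁ hz₁,
    ip_comm z₂ y₁, ip_comm z₁ y₂, h1, ip_comm y₂ y₁, ip_comm z₂ z₁] at this
  exact add_right_cancel (add_right_cancel this)

/-- In null directions of `y`, commuting motions interchange the directions of `y` and `z`. -/
theorem eq_smul_of_motion_comm (hYZ : ip n r Y Z = 1) (hYY : ip n r Y Y = 0)
    (hZZ : ip n r Z Z = 0)
    (hy₁ : IsNormalTo n r Y Z y₁) (hz₁ : IsNormalTo n r Y Z z₁)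
    (hy₂ : IsNormalTo n r Y Z y₂) (hz₂ : IsNormalTo n r Y Z z₂)
    (h : ∀ w, motion n r Y Z y₁ z₁ (motion n r Y Z y₂ z₂ w) =
      motion n r Y Z y₂ z₂ (motion n r Y Z y₁ z₁ w))
    (h₁ : ip n r y₁ y₁ = 0) (h₂ : ip n r y₂ y₂ = 0) (h₁₂ : ip n r y₁ y₂ ≠ 0) :
    z₁ = (ip n r y₁ z₁ / ip n r y₁ y₂) • y₂ ∧ z₂ = (ip n r y₂ z₂ / ip n r y₁ y₂) • y₁ := by
  have hs := ip_symm_of_motion_comm hYZ hYY hZZ hy₁ hz₁ hy₂ hz₂ h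
  have hb := ip_smul_add_of_motion_comm hYZ hYY hZZ hy₁ hz₁ hy₂ hz₂ h
  have hb₁ := hb y₁
  have hb₂ := hb y₂
  rw [h₁, zero_smul, add_zero] at hb₁
  rw [h₂, zero_smul, add_zero] at hb₂
  -- Pairing the relation at `w = y₁` with `y₂` gives `⟨y₁, y₂⟩ (⟨y₁, z₂⟩ + ⟨y₂, z₁⟩) = 0`, and the
  -- two summands are equal.
  have hm : ip n r y₁ z₂ = 0 := by
    have := congrArg (ip n r y₂) hb₁
    simp only [ip_add_right, ip_smul_right, h₂, ip_comm y₂ y₁, mul_zero, ← hs] at this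
    have h3 : ip n r y₁ y₂ * ip n r y₁ z₂ = 0 := by linarith
    exact (mul_eq_zero.1 h3).resolve_left h₁₂
  rw [hm, zero_smul, zero_add] at hb₁
  rw [← hs, hm, zero_smul, zero_add, ip_comm y₂ y₁] at hb₂
  constructor
  · rw [div_eq_inv_mul, mul_smul, ← hb₁, smul_smul, inv_mul_cancel₀ h₁₂, one_smul]
  · rw [div_eq_inv_mul, mul_smul, hb₂, smul_smul, inv_mul_cancel₀ h₁₂, one_smul]

/-- Nullity of `y₁`, `y₂` kills the mixed products `⟨y₁, z₂⟩` and `⟨y₂, z₁⟩`; all remaining terms of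
the composition are symmetric under exchange of the two motions. -/
theorem motion_comm_of_eq_smul (hYZ : ip n r Y Z = 1) (hYY : ip n r Y Y = 0)
    (hZZ : ip n r Z Z = 0)
    (hy₁ : IsNormalTo n r Y Z y₁) (hy₂ : IsNormalTo n r Y Z y₂)
    (h₁ : ip n r y₁ y₁ = 0) (h₂ : ip n r y₂ y₂ = 0) (a b : ℝ)
    (hz₁ : z₁ = a • y₂) (hz₂ : z₂ = b • y₁) (w : Fin (n + 2) → ℝ) :
    motion n r Y Z y₁ z₁ (motion n r Y Z y₂ z₂ w) =
      motion n r Y Z y₂ z₂ (motion n r Y Z y₁ z₁ w) := by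
  have hn₁ : IsNormalTo n r Y Z z₁ := by
    subst hz₁; constructor <;> simp [ip_smul_left, hy₂.left, hy₂.right]
  have hn₂ : IsNormalTo n r Y Z z₂ := by
    subst hz₂; constructor <;> simp [ip_smul_left, hy₁.left, hy₁.right]
  rw [motion_motion hYZ hYY hZZ hy₁ hn₁ hy₂ hn₂, motion_motion hYZ hYY hZZ hy₂ hn₂ hy₁ hn₁]
  subst hz₁ hz₂
  ext i
  simp only [ip_smul_left, ip_smul_right, h₁, h₂, ip_comm y₂ y₁, Pi.add_apply, Pi.smul_apply,
    smul_eq_mul]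
  ring

end Motion

/-! ### Closed one-forms `⟨dP, Q⟩` -/

section Primitive

variable {n r : ℕ} {F : Type*} [NormedAddCommGroup F] [NormedSpace ℝ F]
  {P Q : F → Fin (n + 2) → ℝ} {s : Set F} {x : F}

theorem differentiableAt_of_contDiffOn {G : Type*} [NormedAddCommGroup G] [NormedSpace ℝ G]
    {f : F → G} (hf : ContDiffOn ℝ ∞ f s) (hs : IsOpen s) (hx : x ∈ s) :
    DifferentiableAt ℝ f x :=
  (hf.contDiffAt (hs.mem_nhds hx)).differentiableAt (by simp)

theorem contDiffOn_fderiv {G : Type*} [NormedAddCommGroup G] [NormedSpace ℝ G]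
    {f : F → G} (hf : ContDiffOn ℝ ∞ f s) (hs : IsOpen s) :
    ContDiffOn ℝ ∞ (fderiv ℝ f) s :=
  hf.fderiv_of_isOpen hs (by simp)

theorem contDiffOn_fderiv_apply {G : Type*} [NormedAddCommGroup G] [NormedSpace ℝ G]
    {f : F → G} (hf : ContDiffOn ℝ ∞ f s) (hs : IsOpen s) {X : F → F}
    (hX : ContDiffOn ℝ ∞ X s) :
    ContDiffOn ℝ ∞ (fun p => fderiv ℝ f p (X p)) s :=
  (contDiffOn_fderiv hf hs).clm_apply hX

theorem fderiv_fderiv_symm {G : Type*} [NormedAddCommGroup G] [NormedSpace ℝ G]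
    {f : F → G} (hf : ContDiffOn ℝ ∞ f s) (hs : IsOpen s) (hx : x ∈ s) (A B : F) :
    fderiv ℝ (fun p => fderiv ℝ f p B) x A = fderiv ℝ (fun p => fderiv ℝ f p A) x B := by
  have hd := differentiableAt_of_contDiffOn (contDiffOn_fderiv hf hs) hs hx
  have h := (hf.contDiffAt (hs.mem_nhds hx)).isSymmSndFDerivAt (by
    rw [minSmoothness_of_isRCLikeNormedField]; exact WithTop.coe_le_coe.2 le_top)
  rw [fderiv_clm_apply hd (differentiableAt_const _), fderiv_clm_apply hd (differentiableAt_const _)]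
  simpa using h A B

/-- The exterior derivative of the one-form `⟨dP, Q⟩`: the second derivatives of `P` cancel by
symmetry, leaving `dP` against `dQ`. -/
theorem fderiv_ip_fderiv_sub (hP : ContDiffOn ℝ ∞ P s) (hQ : ContDiffOn ℝ ∞ Q s) (hs : IsOpen s)
    (hx : x ∈ s) (A B : F) :
    fderiv ℝ (fun p => ip n r (fderiv ℝ P p B) (Q p)) x A -
      fderiv ℝ (fun p => ip n r (fderiv ℝ P p A) (Q p)) x B =
      ip n r (fderiv ℝ P x B) (fderiv ℝ Q x A) - ip n r (fderiv ℝ P x A) (fderiv ℝ Q x B) := by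
  have hd := fun C : F => differentiableAt_of_contDiffOn
    (contDiffOn_fderiv_apply hP hs (contDiffOn_const (c := C))) hs hx
  have hQ' := differentiableAt_of_contDiffOn hQ hs hx
  rw [fderiv_ip (hd B) hQ', fderiv_ip (hd A) hQ', fderiv_fderiv_symm hP hs hx A B]
  ring

/-- The Poincaré lemma for `⟨dP, Q⟩`. It serves twice: for the logarithm of the parallel rescaling,
and for the null coordinates. -/
theorem exists_primitive (hP : ContDiffOn ℝ ∞ P s) (hQ : ContDiffOn ℝ ∞ Q s) (hs : IsOpen s)
    (hc : Convex ℝ s)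
    (h : ∀ x ∈ s, ∀ A B, ip n r (fderiv ℝ P x B) (fderiv ℝ Q x A) =
      ip n r (fderiv ℝ P x A) (fderiv ℝ Q x B)) :
    ∃ f : F → ℝ, ContDiffOn ℝ ∞ f s ∧
      ∀ x ∈ s, ∀ A, fderiv ℝ f x A = ip n r (fderiv ℝ P x A) (Q x) := by
  let α : F → F →L[ℝ] ℝ := fun p => ((ipL n r).flip (Q p)).comp (fderiv ℝ P p)
  have hα : ContDiffOn ℝ ∞ α s :=
    ((ipL n r).flip.contDiff.comp_contDiffOn hQ).clm_comp (contDiffOn_fderiv hP hs)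
  have hαa : ∀ p A, α p A = ip n r (fderiv ℝ P p A) (Q p) := fun p A => rfl
  obtain ⟨f, hf⟩ := hc.exists_forall_hasFDerivAt_of_fderiv_symmetric hs
    (fun a ha => (differentiableAt_of_contDiffOn hα hs ha).differentiableWithinAt) (by
      intro a ha A B
      have hd := differentiableAt_of_contDiffOn hα hs ha
      have e : ∀ A B, fderiv ℝ α a A B = fderiv ℝ (fun p => α p B) a A := fun A B => by
        rw [fderiv_clm_apply hd (differentiableAt_const _)]; simp
      rw [e, e, ← sub_eq_zero]
      simp only [hαa]
      rw [fderiv_ip_fderiv_sub hP hQ hs ha, h a ha, sub_self])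
  refine ⟨f, ?_, fun x hx A => by rw [(hf x hx).fderiv, hαa]⟩
  rw [contDiffOn_infty_iff_fderiv_of_isOpen hs]
  refine ⟨fun x hx => (hf x hx).differentiableAt.differentiableWithinAt, ?_⟩
  exact hα.congr fun x hx => (hf x hx).fderiv

end Primitive

/-! ### Pairs of lifts in a chart -/

section Pair

variable {n r : ℕ}

/-- `Y`, `Z` are smooth isotropic vector fields on `s` with `⟨Y, Z⟩ = 1`. -/
structure IsNullPair (n r : ℕ) (s : Set 𝔼) (Y Z : 𝔼 → Fin (n + 2) → ℝ) : Prop where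
  smooth_left : ContDiffOn ℝ ∞ Y s
  smooth_right : ContDiffOn ℝ ∞ Z s
  isOpen : IsOpen s
  left : ∀ x ∈ s, ip n r (Y x) (Y x) = 0
  right : ∀ x ∈ s, ip n r (Z x) (Z x) = 0
  ip_eq : ∀ x ∈ s, ip n r (Y x) (Z x) = 1

/-- The motions of the plane spanned by `Y`, `Z` in any two directions commute. -/
def MotionsCommute (n r : ℕ) (s : Set 𝔼) (Y Z : 𝔼 → Fin (n + 2) → ℝ) : Prop :=
  ∀ x ∈ s, ∀ A B w,
    motion n r (Y x) (Z x) (fderiv ℝ Y x A) (fderiv ℝ Z x A)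
      (motion n r (Y x) (Z x) (fderiv ℝ Y x B) (fderiv ℝ Z x B) w) =
    motion n r (Y x) (Z x) (fderiv ℝ Y x B) (fderiv ℝ Z x B)
      (motion n r (Y x) (Z x) (fderiv ℝ Y x A) (fderiv ℝ Z x A) w)

/-- The induced normal components are the full derivatives: `⟨dY, Z⟩ = 0`. -/
def IsParallel (n r : ℕ) (s : Set 𝔼) (Y Z : 𝔼 → Fin (n + 2) → ℝ) : Prop :=
  ∀ x ∈ s, ∀ A, ip n r (fderiv ℝ Y x A) (Z x) = 0

variable {s : Set 𝔼} {Y Z : 𝔼 → Fin (n + 2) → ℝ} {x : 𝔼}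

theorem fderiv_ip_self_eq_zero {θ : 𝔼 → Fin (n + 2) → ℝ} {c : ℝ} (hθ : ContDiffOn ℝ ∞ θ s)
    (hs : IsOpen s) (h : ∀ x ∈ s, ip n r (θ x) (θ x) = c) (hx : x ∈ s) (A : 𝔼) :
    ip n r (fderiv ℝ θ x A) (θ x) = 0 := by
  have hd := differentiableAt_of_contDiffOn hθ hs hx
  have e : fderiv ℝ (fun p => ip n r (θ p) (θ p)) x A = 0 := by
    rw [(Filter.eventuallyEq_of_mem (hs.mem_nhds hx) h : _ =ᶠ[nhds x] fun _ => c).fderiv_eq]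
    simp
  rw [fderiv_ip hd hd, ip_comm (θ x)] at e
  linarith

theorem fderiv_ip_eq_neg {θ η : 𝔼 → Fin (n + 2) → ℝ} {c : ℝ} (hθ : ContDiffOn ℝ ∞ θ s)
    (hη : ContDiffOn ℝ ∞ η s)
    (hs : IsOpen s) (h : ∀ x ∈ s, ip n r (θ x) (η x) = c) (hx : x ∈ s) (A : 𝔼) :
    ip n r (fderiv ℝ η x A) (θ x) = -ip n r (fderiv ℝ θ x A) (η x) := by
  have e : fderiv ℝ (fun p => ip n r (θ p) (η p)) x A = 0 := by
    rw [(Filter.eventuallyEq_of_mem (hs.mem_nhds hx) h : _ =ᶠ[nhds x] fun _ => c).fderiv_eq]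
    simp
  rw [fderiv_ip (differentiableAt_of_contDiffOn hθ hs hx)
    (differentiableAt_of_contDiffOn hη hs hx), ip_comm (θ x)] at e
  linarith

/-- The component of `dY` orthogonal to the plane spanned by `Y` and `Z`. -/
def normalLeft (n r : ℕ) (Y Z : 𝔼 → Fin (n + 2) → ℝ) (x A : 𝔼) : Fin (n + 2) → ℝ :=
  fderiv ℝ Y x A - ip n r (fderiv ℝ Y x A) (Z x) • Y x

/-- The component of `dZ` orthogonal to the plane spanned by `Y` and `Z`. -/
def normalRight (n r : ℕ) (Y Z : 𝔼 → Fin (n + 2) → ℝ) (x A : 𝔼) : Fin (n + 2) → ℝ :=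
  fderiv ℝ Z x A + ip n r (fderiv ℝ Y x A) (Z x) • Z x

/-- The infinitesimal form of the invariance under rescaling: only normal velocities matter, so the
algebra of motions applies to `normalLeft` and `normalRight`. -/
theorem motion_sub_smul (Y Z y z w : Fin (n + 2) → ℝ) (c : ℝ) :
    motion n r Y Z (y - c • Y) (z + c • Z) w = motion n r Y Z y z w := by
  ext i
  simp only [motion, ip_add_right, ip_sub_right, ip_smul_right, Pi.add_apply, Pi.smul_apply,
    Pi.sub_apply, smul_eq_mul]
  ring

namespace IsNullPair

theorem mono {t : Set 𝔼} (h : IsNullPair n r s Y Z) (ht : IsOpen t) (hts : t ⊆ s) :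
    IsNullPair n r t Y Z :=
  ⟨h.smooth_left.mono hts, h.smooth_right.mono hts, ht, fun x hx => h.left x (hts hx),
    fun x hx => h.right x (hts hx), fun x hx => h.ip_eq x (hts hx)⟩

theorem fderiv_left (h : IsNullPair n r s Y Z) (hx : x ∈ s) (A : 𝔼) :
    ip n r (fderiv ℝ Y x A) (Y x) = 0 :=
  fderiv_ip_self_eq_zero h.smooth_left h.isOpen h.left hx A

theorem fderiv_right (h : IsNullPair n r s Y Z) (hx : x ∈ s) (A : 𝔼) :
    ip n r (fderiv ℝ Z x A) (Z x) = 0 :=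
  fderiv_ip_self_eq_zero h.smooth_right h.isOpen h.right hx A

theorem fderiv_cross (h : IsNullPair n r s Y Z) (hx : x ∈ s) (A : 𝔼) :
    ip n r (fderiv ℝ Z x A) (Y x) = -ip n r (fderiv ℝ Y x A) (Z x) :=
  fderiv_ip_eq_neg h.smooth_left h.smooth_right h.isOpen h.ip_eq hx A

theorem isNormalTo_left (h : IsNullPair n r s Y Z) (hx : x ∈ s) (A : 𝔼) :
    IsNormalTo n r (Y x) (Z x) (normalLeft n r Y Z x A) := by
  constructor
  · simp only [normalLeft, ip_sub_left, ip_smul_left, h.fderiv_left hx, h.left x hx]; ring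
  · simp only [normalLeft, ip_sub_left, ip_smul_left, h.ip_eq x hx]; ring

theorem isNormalTo_right (h : IsNullPair n r s Y Z) (hx : x ∈ s) (A : 𝔼) :
    IsNormalTo n r (Y x) (Z x) (normalRight n r Y Z x A) := by
  constructor
  · simp only [normalRight, ip_add_left, ip_smul_left, h.fderiv_cross hx, ip_comm (Z x) (Y x),
      h.ip_eq x hx]
    ring
  · simp only [normalRight, ip_add_left, ip_smul_left, h.fderiv_right hx, h.right x hx]; ring

theorem motion_normal (h : MotionsCommute n r s Y Z) (hx : x ∈ s)
    (A B : 𝔼) (w : Fin (n + 2) → ℝ) :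
    motion n r (Y x) (Z x) (normalLeft n r Y Z x A) (normalRight n r Y Z x A)
      (motion n r (Y x) (Z x) (normalLeft n r Y Z x B) (normalRight n r Y Z x B) w) =
    motion n r (Y x) (Z x) (normalLeft n r Y Z x B) (normalRight n r Y Z x B)
      (motion n r (Y x) (Z x) (normalLeft n r Y Z x A) (normalRight n r Y Z x A) w) := by
  simp only [normalLeft, normalRight, motion_sub_smul]
  exact h x hx A B w

theorem ip_normalLeft (h : IsNullPair n r s Y Z) (hx : x ∈ s) (A B : 𝔼) :
    ip n r (normalLeft n r Y Z x A) (normalLeft n r Y Z x B) =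
      ip n r (fderiv ℝ Y x A) (fderiv ℝ Y x B) := by
  simp only [normalLeft, ip_sub_left, ip_sub_right, ip_smul_left, ip_smul_right, h.left x hx,
    h.fderiv_left hx, ip_comm (Y x) (fderiv ℝ Y x _)]
  ring

theorem ip_normalRight (h : IsNullPair n r s Y Z) (hx : x ∈ s) (A B : 𝔼) :
    ip n r (normalRight n r Y Z x A) (normalRight n r Y Z x B) =
      ip n r (fderiv ℝ Z x A) (fderiv ℝ Z x B) := by
  simp only [normalRight, ip_add_left, ip_add_right, ip_smul_left, ip_smul_right, h.right x hx,
    h.fderiv_right hx, ip_comm (Z x) (fderiv ℝ Z x _)]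
  ring

/-- Passing from normal parts to full derivatives adds a multiple of `⟨dY(A), Z⟩ ⟨dY(B), Z⟩`, which
is symmetric. The result is the closedness of `⟨dY, Z⟩`. -/
theorem ip_fderiv_symm (h : IsNullPair n r s Y Z) (hc : MotionsCommute n r s Y Z) (hx : x ∈ s)
    (A B : 𝔼) :
    ip n r (fderiv ℝ Y x B) (fderiv ℝ Z x A) = ip n r (fderiv ℝ Y x A) (fderiv ℝ Z x B) := by
  have := ip_symm_of_motion_comm (h.ip_eq x hx) (h.left x hx) (h.right x hx)
    (h.isNormalTo_left hx B) (h.isNormalTo_right hx B) (h.isNormalTo_left hx A)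
    (h.isNormalTo_right hx A) (motion_normal hc hx B A)
  have e : ∀ A, ip n r (Y x) (fderiv ℝ Z x A) = -ip n r (fderiv ℝ Y x A) (Z x) := fun A => by
    rw [ip_comm, h.fderiv_cross hx]
  simp only [normalLeft, normalRight, ip_sub_left, ip_add_right, ip_smul_left, ip_smul_right,
    h.ip_eq x hx, e] at this
  linear_combination this

/-- The metrics induced by `Y` and `Z` are proportional. -/
theorem exists_metric_eq (h : IsNullPair n r s Y Z) (hc : MotionsCommute n r s Y Z) (hx : x ∈ s)
    (hp : ∃ A, 0 < ip n r (fderiv ℝ Y x A) (fderiv ℝ Y x A))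
    (hm : ∃ A, ip n r (fderiv ℝ Y x A) (fderiv ℝ Y x A) < 0) :
    ∃ k, ∀ A B, ip n r (fderiv ℝ Z x A) (fderiv ℝ Z x B) =
      k * ip n r (fderiv ℝ Y x A) (fderiv ℝ Y x B) := by
  obtain ⟨X₁, X₂, h₁, h₂, h₁₂⟩ :=
    exists_null_basis (fderiv ℝ Y x : 𝔼 →ₗ[ℝ] Fin (n + 2) → ℝ) hp hm
  simp only [ContinuousLinearMap.coe_coe] at h₁ h₂ h₁₂
  have hdec := eq_smul_add_smul_of_null (fderiv ℝ Y x : 𝔼 →ₗ[ℝ] Fin (n + 2) → ℝ) h₁ h₂ h₁₂.ne'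
  obtain ⟨a, b, e₁, e₂⟩ : ∃ a b : ℝ, normalRight n r Y Z x X₁ = a • normalLeft n r Y Z x X₂ ∧
      normalRight n r Y Z x X₂ = b • normalLeft n r Y Z x X₁ :=
    ⟨_, _, eq_smul_of_motion_comm (h.ip_eq x hx) (h.left x hx) (h.right x hx)
      (h.isNormalTo_left hx X₁) (h.isNormalTo_right hx X₁) (h.isNormalTo_left hx X₂)
      (h.isNormalTo_right hx X₂) (motion_normal hc hx X₁ X₂)
      (by rw [h.ip_normalLeft hx, h₁]) (by rw [h.ip_normalLeft hx, h₂])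
      (by rw [h.ip_normalLeft hx]; exact h₁₂.ne')⟩
  -- Since `dZ` interchanges the normal null directions with factors `a` and `b`, both metrics have
  -- the same null directions, and their off-diagonal entries have ratio `a b`.
  refine ⟨a * b, ?_⟩
  have f₁ : ip n r (fderiv ℝ Z x X₁) (fderiv ℝ Z x X₁) = 0 := by
    rw [← h.ip_normalRight hx, e₁, ip_smul_left, ip_smul_right, h.ip_normalLeft hx, h₂]; ring
  have f₂ : ip n r (fderiv ℝ Z x X₂) (fderiv ℝ Z x X₂) = 0 := by
    rw [← h.ip_normalRight hx, e₂, ip_smul_left, ip_smul_right, h.ip_normalLeft hx, h₁]; ring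
  have f₁₂ : ip n r (fderiv ℝ Z x X₁) (fderiv ℝ Z x X₂) =
      a * b * ip n r (fderiv ℝ Y x X₁) (fderiv ℝ Y x X₂) := by
    rw [← h.ip_normalRight hx, e₁, e₂, ip_smul_left, ip_smul_right, h.ip_normalLeft hx,
      ip_comm (fderiv ℝ Y x X₂)]
    ring
  intro A B
  obtain ⟨a₁, a₂, hA⟩ : ∃ a₁ a₂ : ℝ, A = a₁ • X₁ + a₂ • X₂ := ⟨_, _, hdec A⟩
  obtain ⟨b₁, b₂, hB⟩ : ∃ b₁ b₂ : ℝ, B = b₁ • X₁ + b₂ • X₂ := ⟨_, _, hdec B⟩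
  subst hA hB
  simp only [map_add, map_smul, ip_add_left, ip_add_right, ip_smul_left, ip_smul_right, h₁, h₂,
    f₁, f₂, f₁₂, ip_comm (fderiv ℝ Y x X₂) (fderiv ℝ Y x X₁),
    ip_comm (fderiv ℝ Z x X₂) (fderiv ℝ Z x X₁)]
  ring

end IsNullPair

/-- The lifts can be rescaled so that the plane they span is spanned by parallel sections. -/
theorem exists_parallel_rescaling (h : IsNullPair n r s Y Z) (hconv : Convex ℝ s)
    (hc : MotionsCommute n r s Y Z) :
    ∃ a : 𝔼 → ℝ, ContDiffOn ℝ ∞ a s ∧ (∀ x, 0 < a x) ∧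
      IsNullPair n r s (fun x => a x • Y x) (fun x => (a x)⁻¹ • Z x) ∧
      IsParallel n r s (fun x => a x • Y x) (fun x => (a x)⁻¹ • Z x) ∧
      MotionsCommute n r s (fun x => a x • Y x) (fun x => (a x)⁻¹ • Z x) ∧
      ∀ x ∈ s, ∀ A B, ip n r (fderiv ℝ (fun x => a x • Y x) x A)
        (fderiv ℝ (fun x => a x • Y x) x B) =
        a x ^ 2 * ip n r (fderiv ℝ Y x A) (fderiv ℝ Y x B) ∧
        ip n r (fderiv ℝ (fun x => (a x)⁻¹ • Z x) x A)
        (fderiv ℝ (fun x => (a x)⁻¹ • Z x) x B) =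
        (a x)⁻¹ ^ 2 * ip n r (fderiv ℝ Z x A) (fderiv ℝ Z x B) := by
  -- Because `⟨d(aY), a⁻¹ Z⟩ = da / a + ⟨dY, Z⟩`, the factor must be `a = exp (-f)` with `df = ⟨dY,
  -- Z⟩`.
  obtain ⟨f, hf, hfd⟩ := exists_primitive h.smooth_left h.smooth_right h.isOpen hconv
    (fun x hx A B => h.ip_fderiv_symm hc hx A B)
  have ha : ContDiffOn ℝ ∞ (fun x => Real.exp (-f x)) s := hf.neg.exp
  have hpos : ∀ x, 0 < Real.exp (-f x) := fun x => Real.exp_pos _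
  have hda : ∀ x ∈ s, ∀ A, fderiv ℝ (fun x => Real.exp (-f x)) x A =
      -Real.exp (-f x) * ip n r (fderiv ℝ Y x A) (Z x) := by
    intro x hx A
    have hd := differentiableAt_of_contDiffOn hf h.isOpen hx
    rw [fderiv_exp hd.fun_neg, fderiv_fun_neg]
    simp [hfd x hx]
  obtain ⟨a, hae⟩ : ∃ a : 𝔼 → ℝ, a = fun x => Real.exp (-f x) := ⟨_, rfl⟩
  have hax : ∀ x, Real.exp (-f x) = a x := fun x => by rw [hae]
  simp only [hax] at hpos hda
  rw [← hae] at ha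
  change ∀ x ∈ s, ∀ A, fderiv ℝ a x A = _ at hda
  have hainv : ContDiffOn ℝ ∞ (fun x => (a x)⁻¹) s := ha.inv fun x _ => (hpos x).ne'
  have hdY : ∀ x ∈ s, ∀ A, fderiv ℝ (fun x => a x • Y x) x A =
      a x • fderiv ℝ Y x A + (-a x * ip n r (fderiv ℝ Y x A) (Z x)) • Y x := by
    intro x hx A
    rw [fderiv_fun_smul (differentiableAt_of_contDiffOn ha h.isOpen hx)
      (differentiableAt_of_contDiffOn h.smooth_left h.isOpen hx)]
    simp [hda x hx A]
  have hdZ : ∀ x ∈ s, ∀ A, fderiv ℝ (fun x => (a x)⁻¹ • Z x) x A = (a x)⁻¹ • fderiv ℝ Z x A -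
      ((a x)⁻¹ ^ 2 * (-a x * ip n r (fderiv ℝ Y x A) (Z x))) • Z x := by
    intro x hx A
    have hd := differentiableAt_of_contDiffOn ha h.isOpen hx
    have hdi : HasFDerivAt (fun x => (a x)⁻¹) (-(a x ^ 2)⁻¹ • fderiv ℝ a x) x :=
      (hasDerivAt_inv (hpos x).ne').comp_hasFDerivAt x hd.hasFDerivAt
    rw [fderiv_fun_smul hdi.differentiableAt
      (differentiableAt_of_contDiffOn h.smooth_right h.isOpen hx), hdi.fderiv]
    simp only [_root_.add_apply, _root_.smul_apply, ContinuousLinearMap.smulRight_apply,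
      hda x hx A, sub_eq_add_neg, ← neg_smul]
    congr 2
    have := (hpos x).ne'
    rw [smul_eq_mul]
    field_simp
  refine ⟨a, ha, hpos, ⟨ha.smul h.smooth_left, hainv.smul h.smooth_right, h.isOpen, ?_, ?_, ?_⟩,
    ?_, ?_, ?_⟩
  · intro x hx
    rw [ip_smul_left, ip_smul_right, h.left x hx]; ring
  · intro x hx
    rw [ip_smul_left, ip_smul_right, h.right x hx]; ring
  · intro x hx
    rw [ip_smul_left, ip_smul_right, h.ip_eq x hx, mul_one, mul_inv_cancel₀ (hpos x).ne']
  · intro x hx A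
    simp only [hdY x hx, ip_add_left, ip_smul_left, ip_smul_right, h.ip_eq x hx]
    ring
  · intro x hx A B w
    simp only [hdY x hx, hdZ x hx, motion_rescale _ _ _ _ _ (hpos x).ne']
    exact hc x hx A B w
  · intro x hx A B
    simp only [hdY x hx, hdZ x hx, ip_add_left, ip_add_right, ip_sub_left, ip_sub_right,
      ip_smul_left, ip_smul_right, h.left x hx, h.right x hx, h.fderiv_left hx, h.fderiv_right hx,
      ip_comm (Y x) (fderiv ℝ Y x _), ip_comm (Z x) (fderiv ℝ Z x _)]
    constructor <;> ring

end Pair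

/-! ### Null coordinates of a pair of lifts -/

section NullCoordinates

variable {n r : ℕ}

variable {s : Set 𝔼} {Y Z : 𝔼 → Fin (n + 2) → ℝ} {q : 𝔼}

theorem isOpen_inter_pos {f : 𝔼 → ℝ} (hf : ContDiffOn ℝ ∞ f s) (hs : IsOpen s) :
    IsOpen {x | x ∈ s ∧ 0 < f x} :=
  hf.continuousOn.isOpen_inter_preimage hs isOpen_Ioi

theorem exists_null_frame (hY : ContDiffOn ℝ ∞ Y s) (hs : IsOpen s) (hq : q ∈ s)
    (hp : ∃ A, 0 < ip n r (fderiv ℝ Y q A) (fderiv ℝ Y q A))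
    (hm : ∃ A, ip n r (fderiv ℝ Y q A) (fderiv ℝ Y q A) < 0) :
    ∃ t ⊆ s, IsOpen t ∧ q ∈ t ∧ ∃ X₁ X₂ : 𝔼 → 𝔼, ContDiffOn ℝ ∞ X₁ t ∧ ContDiffOn ℝ ∞ X₂ t ∧
      ∀ x ∈ t, ip n r (fderiv ℝ Y x (X₁ x)) (fderiv ℝ Y x (X₁ x)) = 0 ∧
        ip n r (fderiv ℝ Y x (X₂ x)) (fderiv ℝ Y x (X₂ x)) = 0 ∧
        0 < ip n r (fderiv ℝ Y x (X₁ x)) (fderiv ℝ Y x (X₂ x)) := by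
  -- Constant vectors `A`, `B`, positive and negative at `q`, remain so nearby. The null directions
  -- `τ B + A` there are roots of a quadratic with positive discriminant, hence smooth.
  obtain ⟨A, hA⟩ := hp
  obtain ⟨B, hB⟩ := hm
  have hg : ∀ A B : 𝔼, ContDiffOn ℝ ∞ (fun x => ip n r (fderiv ℝ Y x A) (fderiv ℝ Y x B)) s :=
    fun A B => contDiffOn_ip (contDiffOn_fderiv_apply hY hs contDiffOn_const)
      (contDiffOn_fderiv_apply hY hs contDiffOn_const)
  obtain ⟨a, ha⟩ : ∃ a : 𝔼 → ℝ, a = fun x => ip n r (fderiv ℝ Y x A) (fderiv ℝ Y x A) := ⟨_, rfl⟩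
  obtain ⟨b, hb⟩ : ∃ a : 𝔼 → ℝ, a = fun x => ip n r (fderiv ℝ Y x A) (fderiv ℝ Y x B) := ⟨_, rfl⟩
  obtain ⟨c, hc⟩ : ∃ a : 𝔼 → ℝ, a = fun x => ip n r (fderiv ℝ Y x B) (fderiv ℝ Y x B) := ⟨_, rfl⟩
  have sa : ContDiffOn ℝ ∞ a s := ha ▸ hg A A
  have sb : ContDiffOn ℝ ∞ b s := hb ▸ hg A B
  have sc : ContDiffOn ℝ ∞ c s := hc ▸ hg B B
  have hts : {x | x ∈ s ∧ 0 < a x} ∩ {x | x ∈ s ∧ 0 < -c x} ⊆ s := fun x hx => hx.1.1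
  have hD : ∀ x ∈ {x | x ∈ s ∧ 0 < a x} ∩ {x | x ∈ s ∧ 0 < -c x}, 0 < b x ^ 2 - a x * c x :=
    fun x hx => by nlinarith [mul_pos hx.1.2 hx.2.2, sq_nonneg (b x)]
  have hc0 : ∀ x ∈ {x | x ∈ s ∧ 0 < a x} ∩ {x | x ∈ s ∧ 0 < -c x}, c x ≠ 0 :=
    fun x hx => (neg_pos.1 hx.2.2).ne
  have sD : ContDiffOn ℝ ∞ (fun x => Real.sqrt (b x ^ 2 - a x * c x)) _ :=
    (((sb.mono hts).pow 2).sub ((sa.mono hts).mul (sc.mono hts))).sqrt fun x hx => (hD x hx).ne'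
  refine ⟨_, hts, (isOpen_inter_pos sa hs).inter (isOpen_inter_pos sc.neg hs),
    ⟨⟨hq, by rw [ha]; exact hA⟩, hq, by rw [hc]; exact neg_pos.2 hB⟩,
    fun x => ((-b x + Real.sqrt (b x ^ 2 - a x * c x)) / c x) • B + A,
    fun x => ((-b x + -Real.sqrt (b x ^ 2 - a x * c x)) / c x) • B + A, ?_, ?_, ?_⟩
  · exact ((((sb.mono hts).neg.add sD).div (sc.mono hts) hc0).smul contDiffOn_const).add
      contDiffOn_const
  · exact ((((sb.mono hts).neg.add sD.neg).div (sc.mono hts) hc0).smul contDiffOn_const).add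
      contDiffOn_const
  · intro x hx
    exact null_basis (fderiv ℝ Y x : 𝔼 →ₗ[ℝ] Fin (n + 2) → ℝ) (by rw [ha]; rfl) (by rw [hb]; rfl)
      (by rw [hc]; rfl) hx.1.2 (neg_pos.1 hx.2.2) (Real.sq_sqrt (hD x hx).le)

/-- For parallel lifts `dY` and `dZ` are already normal to the plane, so the interchange of null
directions holds for the derivatives themselves. -/
theorem IsNullPair.eq_smul_of_isParallel (h : IsNullPair n r s Y Z) (hpar : IsParallel n r s Y Z)
    (hc : MotionsCommute n r s Y Z) (hq : q ∈ s) {A B : 𝔼}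
    (hA : ip n r (fderiv ℝ Y q A) (fderiv ℝ Y q A) = 0)
    (hB : ip n r (fderiv ℝ Y q B) (fderiv ℝ Y q B) = 0)
    (hAB : ip n r (fderiv ℝ Y q A) (fderiv ℝ Y q B) ≠ 0) :
    fderiv ℝ Z q A = (ip n r (fderiv ℝ Y q A) (fderiv ℝ Z q A) /
      ip n r (fderiv ℝ Y q A) (fderiv ℝ Y q B)) • fderiv ℝ Y q B ∧
    fderiv ℝ Z q B = (ip n r (fderiv ℝ Y q B) (fderiv ℝ Z q B) /
      ip n r (fderiv ℝ Y q A) (fderiv ℝ Y q B)) • fderiv ℝ Y q A := by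
  have h1 : ∀ A, IsNormalTo n r (Y q) (Z q) (fderiv ℝ Y q A) :=
    fun A => ⟨h.fderiv_left hq A, hpar q hq A⟩
  have h2 : ∀ A, IsNormalTo n r (Y q) (Z q) (fderiv ℝ Z q A) :=
    fun A => ⟨by rw [h.fderiv_cross hq, hpar q hq, neg_zero], h.fderiv_right hq A⟩
  exact eq_smul_of_motion_comm (h.ip_eq q hq) (h.left q hq) (h.right q hq) (h1 A) (h2 A) (h1 B)
    (h2 B) (hc q hq A B) hA hB hAB

theorem exists_sign {a : ℝ} (ha : a ≠ 0) : ∃ δ : ℝ, δ * δ = 1 ∧ 0 < δ * a := by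
  rcases ha.lt_or_gt with h | h
  · exact ⟨-1, by norm_num, by linarith⟩
  · exact ⟨1, by norm_num, by linarith⟩

theorem eq_of_sign {δ ε k : ℝ} (hδ : δ * δ = 1) (hε : ε * ε = 1) (h : 0 < δ * k)
    (h' : 0 < ε * k) : δ = ε := by
  rcases mul_self_eq_one_iff.1 hδ with rfl | rfl <;> rcases mul_self_eq_one_iff.1 hε with rfl | rfl
    <;> first | rfl | linarith

/-- A null frame in which the mixed second fundamental form is `diag(±1, ±1)`. -/
theorem exists_normalized_null_frame (h : IsNullPair n r s Y Z) (hpar : IsParallel n r s Y Z)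
    (hc : MotionsCommute n r s Y Z) (hq : q ∈ s)
    (hp : ∃ A, 0 < ip n r (fderiv ℝ Y q A) (fderiv ℝ Y q A))
    (hm : ∃ A, ip n r (fderiv ℝ Y q A) (fderiv ℝ Y q A) < 0) {ε k : ℝ} (hε : ε * ε = 1)
    (hεk : 0 < ε * k)
    (hk : ∀ A B, ip n r (fderiv ℝ Z q A) (fderiv ℝ Z q B) =
      k * ip n r (fderiv ℝ Y q A) (fderiv ℝ Y q B)) :
    ∃ t ⊆ s, IsOpen t ∧ q ∈ t ∧ ∃ X₁ X₂ : 𝔼 → 𝔼, ContDiffOn ℝ ∞ X₁ t ∧ ContDiffOn ℝ ∞ X₂ t ∧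
      ∃ δ₁ δ₂ : ℝ, δ₁ * δ₁ = 1 ∧ δ₂ * δ₂ = 1 ∧ δ₁ * δ₂ = ε ∧
      ∀ x ∈ t, ip n r (fderiv ℝ Y x (X₁ x)) (fderiv ℝ Y x (X₁ x)) = 0 ∧
        ip n r (fderiv ℝ Y x (X₂ x)) (fderiv ℝ Y x (X₂ x)) = 0 ∧
        0 < ip n r (fderiv ℝ Y x (X₁ x)) (fderiv ℝ Y x (X₂ x)) ∧
        ip n r (fderiv ℝ Y x (X₁ x)) (fderiv ℝ Z x (X₁ x)) = δ₁ ∧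
        ip n r (fderiv ℝ Y x (X₂ x)) (fderiv ℝ Z x (X₂ x)) = δ₂ := by
  obtain ⟨t, hts, ht, hqt, X₁, X₂, sX₁, sX₂, hX⟩ := exists_null_frame h.smooth_left h.isOpen hq hp hm
  obtain ⟨h₁, h₂, h₁₂⟩ := hX q hqt
  obtain ⟨e₁, e₂⟩ := h.eq_smul_of_isParallel hpar hc hq h₁ h₂ h₁₂.ne'
  obtain ⟨Q₁, hQ₁⟩ : ∃ Q : 𝔼 → ℝ, Q = fun x => ip n r (fderiv ℝ Y x (X₁ x)) (fderiv ℝ Z x (X₁ x)) :=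
    ⟨_, rfl⟩
  obtain ⟨Q₂, hQ₂⟩ : ∃ Q : 𝔼 → ℝ, Q = fun x => ip n r (fderiv ℝ Y x (X₂ x)) (fderiv ℝ Z x (X₂ x)) :=
    ⟨_, rfl⟩
  have sQ₁ : ContDiffOn ℝ ∞ Q₁ t := hQ₁ ▸ contDiffOn_ip
    (contDiffOn_fderiv_apply (h.smooth_left.mono hts) ht sX₁)
    (contDiffOn_fderiv_apply (h.smooth_right.mono hts) ht sX₁)
  have sQ₂ : ContDiffOn ℝ ∞ Q₂ t := hQ₂ ▸ contDiffOn_ip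
    (contDiffOn_fderiv_apply (h.smooth_left.mono hts) ht sX₂)
    (contDiffOn_fderiv_apply (h.smooth_right.mono hts) ht sX₂)
  -- With `g = ⟨dY(X₁), dY(X₂)⟩`, the relations `dZ(X₁) = (Q₁/g) dY(X₂)` and `dZ(X₂) = (Q₂/g)
  -- dY(X₁)` give `k g² = Q₁ Q₂`. So neither `Qᵢ` vanishes at `q`, and the product of their signs is
  -- the sign of `k`.
  have hkQ : k * ip n r (fderiv ℝ Y q (X₁ q)) (fderiv ℝ Y q (X₂ q)) ^ 2 = Q₁ q * Q₂ q := by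
    have := hk (X₁ q) (X₂ q)
    rw [e₁, e₂, ip_smul_left, ip_smul_right,
      ip_comm (fderiv ℝ Y q (X₂ q)) (fderiv ℝ Y q (X₁ q))] at this
    have hne := h₁₂.ne'
    simp only [hQ₁, hQ₂]
    rw [pow_two, ← mul_assoc, ← this]
    field_simp
  have hk0 : k ≠ 0 := by rintro rfl; simp at hεk
  have hQ0 : Q₁ q * Q₂ q ≠ 0 := hkQ ▸ mul_ne_zero hk0 (pow_ne_zero _ h₁₂.ne')
  obtain ⟨δ₁, hδ₁, hδQ₁⟩ := exists_sign (left_ne_zero_of_mul hQ0)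
  obtain ⟨δ₂, hδ₂, hδQ₂⟩ := exists_sign (right_ne_zero_of_mul hQ0)
  have hδ : δ₁ * δ₂ = ε := by
    refine eq_of_sign (k := k * ip n r (fderiv ℝ Y q (X₁ q)) (fderiv ℝ Y q (X₂ q)) ^ 2)
      (by rw [mul_mul_mul_comm, hδ₁, hδ₂, one_mul]) hε ?_ ?_
    · rw [hkQ, mul_mul_mul_comm]; exact mul_pos hδQ₁ hδQ₂
    · rw [← mul_assoc]; exact mul_pos hεk (pow_pos h₁₂ 2)
  have hts' : {x | x ∈ t ∧ 0 < δ₁ * Q₁ x} ∩ {x | x ∈ t ∧ 0 < δ₂ * Q₂ x} ⊆ t := fun x hx => hx.1.1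
  have sδ₁ : ContDiffOn ℝ ∞ (fun x => δ₁ * Q₁ x) t := contDiffOn_const.mul sQ₁
  have sδ₂ : ContDiffOn ℝ ∞ (fun x => δ₂ * Q₂ x) t := contDiffOn_const.mul sQ₂
  -- `Qᵢ` is quadratic in `Xᵢ`, and `δᵢ Qᵢ = |Qᵢ|` on the chosen neighbourhood; dividing `Xᵢ` by the
  -- square root of `|Qᵢ|` turns `Qᵢ` into its sign.
  have key : ∀ {δ Q : ℝ}, δ * δ = 1 → 0 < δ * Q →
      (Real.sqrt (δ * Q))⁻¹ * ((Real.sqrt (δ * Q))⁻¹ * Q) = δ := by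
    intro δ Q hδ hQ
    have h1 := Real.mul_self_sqrt hQ.le
    have h2 := (Real.sqrt_pos.2 hQ).ne'
    field_simp
    linear_combination (-Q) * hδ - δ * h1
  refine ⟨_, hts'.trans hts, (isOpen_inter_pos sδ₁ ht).inter (isOpen_inter_pos sδ₂ ht),
    ⟨⟨hqt, hδQ₁⟩, hqt, hδQ₂⟩, fun x => (Real.sqrt (δ₁ * Q₁ x))⁻¹ • X₁ x,
    fun x => (Real.sqrt (δ₂ * Q₂ x))⁻¹ • X₂ x, ?_, ?_, δ₁, δ₂, hδ₁, hδ₂, hδ, ?_⟩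
  · exact (((sδ₁.mono hts').sqrt fun x hx => hx.1.2.ne').inv
      fun x hx => (Real.sqrt_pos.2 hx.1.2).ne').smul (sX₁.mono hts')
  · exact (((sδ₂.mono hts').sqrt fun x hx => hx.2.2.ne').inv
      fun x hx => (Real.sqrt_pos.2 hx.2.2).ne').smul (sX₂.mono hts')
  · rintro x ⟨⟨hx, hx₁⟩, -, hx₂⟩
    obtain ⟨g₁, g₂, g₁₂⟩ := hX x hx
    simp only [map_smul, ip_smul_left, ip_smul_right, g₁, g₂, mul_zero, true_and]
    refine ⟨mul_pos (inv_pos.2 (Real.sqrt_pos.2 hx₂))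
      (mul_pos (inv_pos.2 (Real.sqrt_pos.2 hx₁)) g₁₂), ?_, ?_⟩
    · have := key hδ₁ hx₁
      simpa only [hQ₁] using this
    · have := key hδ₂ hx₂
      simpa only [hQ₂] using this

/-- If `dY = m θ + m' θ'` and `dZ = (δ m θ' + δ' m' θ) / ⟨θ, θ'⟩` for null vector fields `θ`, `θ'`,
then the one-form `m` is closed. -/
theorem closed_of_null_frame {θ θ' : 𝔼 → Fin (n + 2) → ℝ} (hs : IsOpen s)
    (hY : ContDiffOn ℝ ∞ Y s) (hZ : ContDiffOn ℝ ∞ Z s) (hθ : ContDiffOn ℝ ∞ θ s)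
    (hθ' : ContDiffOn ℝ ∞ θ' s) (h : ∀ x ∈ s, ip n r (θ x) (θ x) = 0)
    (h' : ∀ x ∈ s, ip n r (θ' x) (θ' x) = 0) (hg : ∀ x ∈ s, ip n r (θ x) (θ' x) ≠ 0)
    {δ δ' : ℝ} (hδ : δ ≠ 0)
    (hd : ∀ x ∈ s, ∀ A, ∃ m m' : ℝ, fderiv ℝ Y x A = m • θ x + m' • θ' x ∧
      ip n r (θ x) (θ' x) • fderiv ℝ Z x A = (δ * m) • θ' x + (δ' * m') • θ x)
    {x : 𝔼} (hx : x ∈ s) (A B : 𝔼) :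
    ip n r (fderiv ℝ Y x B) (fderiv ℝ (fun x => (ip n r (θ x) (θ' x))⁻¹ • θ' x) x A) =
      ip n r (fderiv ℝ Y x A) (fderiv ℝ (fun x => (ip n r (θ x) (θ' x))⁻¹ • θ' x) x B) := by
  -- `ψ` is null with `⟨θ, ψ⟩ = 1`. Hence `m = ⟨dY, ψ⟩` and also `δ m = ⟨dZ, θ⟩`, which gives two
  -- independent expressions for `dm`.
  obtain ⟨ψ, hψ⟩ : ∃ ψ : 𝔼 → Fin (n + 2) → ℝ, ψ = fun x => (ip n r (θ x) (θ' x))⁻¹ • θ' x :=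
    ⟨_, rfl⟩
  have sψ : ContDiffOn ℝ ∞ ψ s := hψ ▸ ((contDiffOn_ip hθ hθ').inv hg).smul hθ'
  have hψψ : ∀ x ∈ s, ip n r (ψ x) (ψ x) = 0 := fun x hx => by
    simp only [hψ, ip_smul_left, ip_smul_right, h' x hx, mul_zero]
  have hθψ : ∀ x ∈ s, ip n r (θ x) (ψ x) = 1 := fun x hx => by
    simp only [hψ, ip_smul_right, inv_mul_cancel₀ (hg x hx)]
  rw [← hψ]
  have hθ'ψ : ∀ x ∈ s, θ' x = ip n r (θ x) (θ' x) • ψ x := fun x hx => by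
    simp only [hψ, smul_smul, mul_inv_cancel₀ (hg x hx), one_smul]
  have hd' : ∀ A, ∃ m m' c : ℝ, fderiv ℝ Y x A = m • θ x + m' • ψ x ∧
      fderiv ℝ Z x A = (δ * m) • ψ x + c • θ x := by
    intro A
    obtain ⟨m, m', e1, e2⟩ := hd x hx A
    refine ⟨m, m' * ip n r (θ x) (θ' x), (ip n r (θ x) (θ' x))⁻¹ * (δ' * m'),
      by rw [e1, mul_smul, ← hθ'ψ x hx], ?_⟩
    rw [← inv_smul_smul₀ (hg x hx) (fderiv ℝ Z x A), e2, smul_add, smul_smul _ (δ' * m')]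
    simp only [hψ, smul_smul, mul_comm]
  have e₁ : ∀ A, ip n r (ψ x) (fderiv ℝ θ x A) = -ip n r (θ x) (fderiv ℝ ψ x A) := fun A => by
    rw [ip_comm, ip_comm (θ x), fderiv_ip_eq_neg hθ sψ hs hθψ hx, neg_neg]
  have e₂ : ∀ A, ip n r (ψ x) (fderiv ℝ ψ x A) = 0 := fun A => by
    rw [ip_comm, fderiv_ip_self_eq_zero sψ hs hψψ hx]
  have e₃ : ∀ A, ip n r (θ x) (fderiv ℝ θ x A) = 0 := fun A => by
    rw [ip_comm, fderiv_ip_self_eq_zero hθ hs h hx]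
  have alt₁ := fderiv_ip_fderiv_sub (n := n) (r := r) hY sψ hs hx A B
  have alt₂ := fderiv_ip_fderiv_sub (n := n) (r := r) hZ hθ hs hx A B
  have hform : ∀ A, (fun p => ip n r (fderiv ℝ Z p A) (θ p)) =ᶠ[nhds x]
      fun p => δ * ip n r (fderiv ℝ Y p A) (ψ p) := by
    intro A
    filter_upwards [hs.mem_nhds hx] with p hp
    obtain ⟨m, m', e1, e2⟩ := hd p hp A
    have hgp := hg p hp
    have e2' := congrArg (fun v => ip n r v (θ p)) e2
    simp only [ip_smul_left, ip_add_left, h p hp, ip_comm (θ' p) (θ p), mul_zero, add_zero] at e2'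
    rw [e1]
    simp only [hψ, ip_smul_left, ip_smul_right, ip_add_left, h' p hp]
    field_simp
    linear_combination e2'
  have hdiff := fun A : 𝔼 => differentiableAt_of_contDiffOn (contDiffOn_ip (n := n) (r := r)
    (contDiffOn_fderiv_apply hY hs (contDiffOn_const (c := A))) sψ) hs hx
  rw [(hform A).fderiv_eq, (hform B).fderiv_eq, fderiv_const_mul (hdiff B),
    fderiv_const_mul (hdiff A)] at alt₂
  simp only [_root_.smul_apply, smul_eq_mul] at alt₂
  obtain ⟨mA, mA', cA, hA, hA'⟩ := hd' A
  obtain ⟨mB, mB', cB, hB, hB'⟩ := hd' B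
  rw [hA, hB] at alt₁ ⊢
  rw [hA', hB'] at alt₂
  simp only [ip_add_left, ip_smul_left, e₁, e₂, e₃] at alt₁ alt₂ ⊢
  -- Call the bracket `S`. Then `alt₁` reads `dm = S` and `alt₂` reads `δ dm = -δ S`, the sign
  -- coming from `⟨ψ, dθ⟩ = -⟨θ, dψ⟩`; therefore `δ S = 0`.
  have hS : δ * (mB * ip n r (θ x) (fderiv ℝ ψ x A) - mA * ip n r (θ x) (fderiv ℝ ψ x B)) = 0 := by
    linear_combination (-1 / 2 : ℝ) * (δ * alt₁ - alt₂)
  linear_combination (mul_eq_zero.1 hS).resolve_left hδ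

/-- Coordinates `u`, `v`, with coordinate vector fields `X₁`, `X₂`, that are null for the metric of
`Y` and diagonalize the mixed second fundamental form. -/
theorem exists_null_coordinates (h : IsNullPair n r s Y Z) (hpar : IsParallel n r s Y Z)
    (hc : MotionsCommute n r s Y Z) (hq : q ∈ s)
    (hp : ∃ A, 0 < ip n r (fderiv ℝ Y q A) (fderiv ℝ Y q A))
    (hm : ∃ A, ip n r (fderiv ℝ Y q A) (fderiv ℝ Y q A) < 0) {ε k : ℝ} (hε : ε * ε = 1)
    (hεk : 0 < ε * k)
    (hk : ∀ A B, ip n r (fderiv ℝ Z q A) (fderiv ℝ Z q B) =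
      k * ip n r (fderiv ℝ Y q A) (fderiv ℝ Y q B)) :
    ∃ t ⊆ s, IsOpen t ∧ q ∈ t ∧ ∃ (u v : 𝔼 → ℝ) (X₁ X₂ : 𝔼 → 𝔼), ContDiffOn ℝ ∞ u t ∧
      ContDiffOn ℝ ∞ v t ∧ ∃ δ₁ δ₂ : ℝ, δ₁ * δ₁ = 1 ∧ δ₂ * δ₂ = 1 ∧ δ₁ * δ₂ = ε ∧ ∀ x ∈ t,
        (fderiv ℝ u x (X₁ x) = 1 ∧ fderiv ℝ u x (X₂ x) = 0 ∧
          fderiv ℝ v x (X₁ x) = 0 ∧ fderiv ℝ v x (X₂ x) = 1) ∧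
        ip n r (fderiv ℝ Y x (X₁ x)) (fderiv ℝ Y x (X₁ x)) = 0 ∧
        ip n r (fderiv ℝ Y x (X₂ x)) (fderiv ℝ Y x (X₂ x)) = 0 ∧
        0 < ip n r (fderiv ℝ Y x (X₁ x)) (fderiv ℝ Y x (X₂ x)) ∧
        ip n r (fderiv ℝ Y x (X₁ x)) (fderiv ℝ Y x (X₂ x)) • fderiv ℝ Z x (X₁ x) =
          δ₁ • fderiv ℝ Y x (X₂ x) ∧
        ip n r (fderiv ℝ Y x (X₁ x)) (fderiv ℝ Y x (X₂ x)) • fderiv ℝ Z x (X₂ x) =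
          δ₂ • fderiv ℝ Y x (X₁ x) := by
  obtain ⟨t, hts, ht, hqt, X₁, X₂, sX₁, sX₂, δ₁, δ₂, hδ₁, hδ₂, hδ, hX⟩ :=
    exists_normalized_null_frame h hpar hc hq hp hm hε hεk hk
  -- A ball is convex, as the Poincaré lemma requires.
  obtain ⟨ρ, hρ, hball⟩ := Metric.isOpen_iff.1 ht q hqt
  have hb := Metric.isOpen_ball (x := q) (ε := ρ)
  have hbs := hball.trans hts
  have sY := h.smooth_left.mono hbs
  have sZ := h.smooth_right.mono hbs
  have sθ₁ := contDiffOn_fderiv_apply sY hb (sX₁.mono hball)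
  have sθ₂ := contDiffOn_fderiv_apply sY hb (sX₂.mono hball)
  have hrel : ∀ x ∈ Metric.ball q ρ,
      ip n r (fderiv ℝ Y x (X₁ x)) (fderiv ℝ Y x (X₂ x)) • fderiv ℝ Z x (X₁ x) =
        δ₁ • fderiv ℝ Y x (X₂ x) ∧
      ip n r (fderiv ℝ Y x (X₁ x)) (fderiv ℝ Y x (X₂ x)) • fderiv ℝ Z x (X₂ x) =
        δ₂ • fderiv ℝ Y x (X₁ x) := by
    intro x hx
    obtain ⟨h₁, h₂, h₁₂, hQ₁, hQ₂⟩ := hX x (hball hx)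
    obtain ⟨e₁, e₂⟩ := h.eq_smul_of_isParallel hpar hc (hbs hx) h₁ h₂ h₁₂.ne'
    rw [hQ₁] at e₁
    rw [hQ₂] at e₂
    constructor
    · rw [e₁, smul_smul, mul_div_cancel₀ _ h₁₂.ne']
    · rw [e₂, smul_smul, mul_div_cancel₀ _ h₁₂.ne']
  have hdec : ∀ x ∈ Metric.ball q ρ, ∀ A, ∃ m m' : ℝ,
      fderiv ℝ Y x A = m • fderiv ℝ Y x (X₁ x) + m' • fderiv ℝ Y x (X₂ x) ∧
      ip n r (fderiv ℝ Y x (X₁ x)) (fderiv ℝ Y x (X₂ x)) • fderiv ℝ Z x A =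
        (δ₁ * m) • fderiv ℝ Y x (X₂ x) + (δ₂ * m') • fderiv ℝ Y x (X₁ x) := by
    intro x hx A
    obtain ⟨h₁, h₂, h₁₂, -, -⟩ := hX x (hball hx)
    obtain ⟨m, m', hA⟩ : ∃ m m' : ℝ, A = m • X₁ x + m' • X₂ x := ⟨_, _,
      eq_smul_add_smul_of_null (fderiv ℝ Y x : 𝔼 →ₗ[ℝ] Fin (n + 2) → ℝ) h₁ h₂ h₁₂.ne' A⟩
    obtain ⟨e₁, e₂⟩ := hrel x hx
    refine ⟨m, m', ?_, ?_⟩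
    · nth_rw 1 [hA]
      rw [map_add, map_smul, map_smul]
    · nth_rw 1 [hA]
      rw [map_add, map_smul, map_smul, smul_add, smul_comm _ m, smul_comm _ m', e₁, e₂, smul_smul,
        smul_smul, mul_comm m, mul_comm m']
  have hδ₁0 : δ₁ ≠ 0 := left_ne_zero_of_mul_eq_one hδ₁
  have hδ₂0 : δ₂ ≠ 0 := left_ne_zero_of_mul_eq_one hδ₂
  -- With `θᵢ = dY(Xᵢ)`, the form `⟨dY, θ₂ / ⟨θ₁, θ₂⟩⟩` is dual to `X₁`; exchanging the indices
  -- gives the form dual to `X₂`, whose primitive is `v`.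
  obtain ⟨u, su, hu⟩ := exists_primitive (n := n) (r := r) sY
    (((contDiffOn_ip sθ₁ sθ₂).inv fun x hx => (hX x (hball hx)).2.2.1.ne').smul sθ₂) hb
    (convex_ball q ρ) fun x hx A B => closed_of_null_frame hb sY sZ sθ₁ sθ₂
      (fun x hx => (hX x (hball hx)).1) (fun x hx => (hX x (hball hx)).2.1)
      (fun x hx => (hX x (hball hx)).2.2.1.ne') hδ₁0 hdec hx A B
  obtain ⟨v, sv, hv⟩ := exists_primitive (n := n) (r := r) sY
    (((contDiffOn_ip sθ₂ sθ₁).inv fun x hx => by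
      rw [ip_comm]; exact (hX x (hball hx)).2.2.1.ne').smul sθ₁) hb
    (convex_ball q ρ) fun x hx A B => closed_of_null_frame hb sY sZ sθ₂ sθ₁
      (fun x hx => (hX x (hball hx)).2.1) (fun x hx => (hX x (hball hx)).1)
      (fun x hx => by rw [ip_comm]; exact (hX x (hball hx)).2.2.1.ne') hδ₂0
      (fun x hx A => by
        obtain ⟨m, m', e₁, e₂⟩ := hdec x hx A
        exact ⟨m', m, e₁.trans (add_comm _ _), by
          rw [ip_comm]; exact e₂.trans (add_comm _ _)⟩) hx A B
  refine ⟨_, hbs, hb, Metric.mem_ball_self hρ, u, v, X₁, X₂, su, sv, δ₁, δ₂, hδ₁, hδ₂, hδ, ?_⟩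
  intro x hx
  obtain ⟨h₁, h₂, h₁₂, -, -⟩ := hX x (hball hx)
  refine ⟨?_, h₁, h₂, h₁₂, hrel x hx⟩
  rw [hu x hx, hu x hx, hv x hx, hv x hx]
  simp only [Pi.smul_apply', Pi.inv_apply, ip_smul_right, h₁, h₂, mul_zero,
    ip_comm (fderiv ℝ Y x (X₂ x)) (fderiv ℝ Y x (X₁ x)), inv_mul_cancel₀ h₁₂.ne', and_self]

end NullCoordinates

/-! ### Adapted coordinates and canonical lifts in a chart -/

section AdaptedCoordinates

variable {n r : ℕ}

variable {s t : Set 𝔼} {Y Z : 𝔼 → Fin (n + 2) → ℝ} {q : 𝔼}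

/-- The partial derivative of a function on the plane. -/
def pd {W : Type*} [NormedAddCommGroup W] [NormedSpace ℝ W] (k : Fin 2) (f : 𝔼 → W) (x : 𝔼) : W :=
  fderiv ℝ f x (EuclideanSpace.single k 1)

theorem eq_sum_single (A : 𝔼) :
    A = A 0 • EuclideanSpace.single 0 1 + A 1 • EuclideanSpace.single 1 1 := by
  ext i; fin_cases i <;> simp

/-- Functions with dual vector fields are the coordinates of a chart. -/
theorem exists_chart_of_dual {u v : 𝔼 → ℝ} {X₁ X₂ : 𝔼 → 𝔼} (ht : IsOpen t) (hq : q ∈ t)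
    (hu : ContDiffOn ℝ ∞ u t) (hv : ContDiffOn ℝ ∞ v t)
    (h : ∀ x ∈ t, fderiv ℝ u x (X₁ x) = 1 ∧ fderiv ℝ u x (X₂ x) = 0 ∧
          fderiv ℝ v x (X₁ x) = 0 ∧ fderiv ℝ v x (X₂ x) = 1) :
    ∃ φ : OpenPartialHomeomorph 𝔼 𝔼, q ∈ φ.source ∧ φ.source ⊆ t ∧ ContDiffOn ℝ ∞ φ φ.source ∧
      ContDiffOn ℝ ∞ φ.symm φ.target ∧ ∀ x ∈ φ.target,
        fderiv ℝ φ.symm x (EuclideanSpace.single 0 1) = X₁ (φ.symm x) ∧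
        fderiv ℝ φ.symm x (EuclideanSpace.single 1 1) = X₂ (φ.symm x) := by
  let Φ : 𝔼 → 𝔼 := fun x =>
    u x • EuclideanSpace.single 0 (1 : ℝ) + v x • EuclideanSpace.single 1 (1 : ℝ)
  have hΦ : ContDiffOn ℝ ∞ Φ t := (hu.smul contDiffOn_const).add (hv.smul contDiffOn_const)
  have hΦd : ∀ x ∈ t, ∀ A, fderiv ℝ Φ x A =
      fderiv ℝ u x A • EuclideanSpace.single 0 (1 : ℝ) +
        fderiv ℝ v x A • EuclideanSpace.single 1 (1 : ℝ) := by
    intro x hx A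
    have hu' := differentiableAt_of_contDiffOn hu ht hx
    have hv' := differentiableAt_of_contDiffOn hv ht hx
    have := ((hu'.hasFDerivAt.smul_const (EuclideanSpace.single (0 : Fin 2) (1 : ℝ))).add
      (hv'.hasFDerivAt.smul_const (EuclideanSpace.single (1 : Fin 2) (1 : ℝ)))).fderiv
    exact congrArg (fun L : 𝔼 →L[ℝ] 𝔼 => L A) this
  have hX₁ : ∀ x ∈ t, fderiv ℝ Φ x (X₁ x) = EuclideanSpace.single 0 1 := fun x hx => by
    rw [hΦd x hx, (h x hx).1, (h x hx).2.2.1]; simp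
  have hX₂ : ∀ x ∈ t, fderiv ℝ Φ x (X₂ x) = EuclideanSpace.single 1 1 := fun x hx => by
    rw [hΦd x hx, (h x hx).2.1, (h x hx).2.2.2]; simp
  -- `dΦ` carries `X₁`, `X₂` to the standard basis, so it is surjective and hence bijective. The
  -- inverse function theorem yields the chart, whose inverse carries the basis back to `X₁`, `X₂`.
  have hequiv : ∀ x ∈ t, ∃ L : 𝔼 ≃L[ℝ] 𝔼, HasFDerivAt Φ (L : 𝔼 →L[ℝ] 𝔼) x := by
    intro x hx
    have hsurj : Function.Surjective (fderiv ℝ Φ x : 𝔼 →ₗ[ℝ] 𝔼) := fun A =>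
      ⟨A 0 • X₁ x + A 1 • X₂ x, by
        simp only [ContinuousLinearMap.coe_coe, map_add, map_smul, hX₁ x hx, hX₂ x hx]
        exact (eq_sum_single A).symm⟩
    have hinj := LinearMap.injective_iff_surjective.2 hsurj
    refine ⟨(LinearEquiv.ofBijective _ ⟨hinj, hsurj⟩).toContinuousLinearEquiv, ?_⟩
    convert! (differentiableAt_of_contDiffOn hΦ ht hx).hasFDerivAt using 1
  have hat : ∀ x ∈ t, ContDiffAt ℝ ∞ Φ x := fun x hx => hΦ.contDiffAt (ht.mem_nhds hx)
  obtain ⟨L, hL⟩ := hequiv q hq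
  let φ := ((hat q hq).toOpenPartialHomeomorph Φ hL (by simp)).restrOpen t ht
  have hφ : ∀ x, φ x = Φ x := fun x => rfl
  have hsrc : φ.source ⊆ t := fun x hx => hx.2
  have hsymm : ∀ x ∈ φ.target, φ.symm x ∈ t := fun x hx => hsrc (φ.map_target hx)
  refine ⟨φ, ⟨(hat q hq).mem_toOpenPartialHomeomorph_source hL (by simp), hq⟩, hsrc,
    hΦ.mono hsrc, ?_, ?_⟩
  · intro x hx
    obtain ⟨L, hL⟩ := hequiv _ (hsymm x hx)
    exact (φ.contDiffAt_symm hx hL (hat _ (hsymm x hx))).contDiffWithinAt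
  · intro x hx
    obtain ⟨L, hL⟩ := hequiv _ (hsymm x hx)
    have h1 := hX₁ _ (hsymm x hx)
    have h2 := hX₂ _ (hsymm x hx)
    rw [hL.fderiv] at h1 h2
    rw [(φ.hasFDerivAt_symm hx hL).fderiv]
    constructor
    · rw [← h1]; exact L.symm_apply_apply _
    · rw [← h2]; exact L.symm_apply_apply _

/-- In the coordinates of the plane, `Y` is a canonical lift with `κ₁ = ε κ₂`, and `Z` spans a
Darboux transform of it. -/
structure IsAdaptedDarboux (n r : ℕ) (ε : ℝ) (s : Set 𝔼) (Y Z : 𝔼 → Fin (n + 2) → ℝ) : Prop where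
  smooth_left : ContDiffOn ℝ ∞ Y s
  smooth_right : ContDiffOn ℝ ∞ Z s
  canonical : ∀ x ∈ s, ip n r (pd 0 Y x) (pd 0 Y x) = 0 ∧ ip n r (pd 1 Y x) (pd 1 Y x) = 0 ∧
    ip n r (pd 0 Y x) (pd 1 Y x) = 1 / 2
  hopf : ∀ x ∈ s, ∃ c : ℝ, pd 0 (pd 0 Y) x = ε • pd 1 (pd 1 Y) x + c • Y x
  ip_ne : ∀ x ∈ s, ip n r (Y x) (Z x) ≠ 0
  mem_span : ∀ x ∈ s, pd 0 Z x ∈ Submodule.span ℝ {Z x, Y x, pd 1 Y x} ∧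
    pd 1 Z x ∈ Submodule.span ℝ {Z x, Y x, pd 0 Y x}

theorem contDiffOn_pd {W : Type*} [NormedAddCommGroup W] [NormedSpace ℝ W] {f : 𝔼 → W}
    (hf : ContDiffOn ℝ ∞ f s) (hs : IsOpen s) (k : Fin 2) : ContDiffOn ℝ ∞ (pd k f) s :=
  contDiffOn_fderiv_apply hf hs contDiffOn_const

theorem pd_congr {W : Type*} [NormedAddCommGroup W] [NormedSpace ℝ W] {f g : 𝔼 → W}
    (hs : IsOpen s) (h : ∀ x ∈ s, f x = g x) {x : 𝔼} (hx : x ∈ s) (k : Fin 2) :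
    pd k f x = pd k g x := by
  rw [pd, (Filter.eventuallyEq_of_mem (hs.mem_nhds hx) h).fderiv_eq, pd]

theorem pd_comm {W : Type*} [NormedAddCommGroup W] [NormedSpace ℝ W] {f : 𝔼 → W}
    (hf : ContDiffOn ℝ ∞ f s) (hs : IsOpen s) {x : 𝔼} (hx : x ∈ s) (j k : Fin 2) :
    pd j (pd k f) x = pd k (pd j f) x :=
  fderiv_fderiv_symm hf hs hx _ _

theorem pd_smul {W : Type*} [NormedAddCommGroup W] [NormedSpace ℝ W] {a : 𝔼 → ℝ} {f : 𝔼 → W}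
    (ha : ContDiffOn ℝ ∞ a s) (hf : ContDiffOn ℝ ∞ f s) (hs : IsOpen s) {x : 𝔼} (hx : x ∈ s)
    (k : Fin 2) : pd k (fun p => a p • f p) x = a x • pd k f x + pd k a x • f x := by
  rw [pd, fderiv_fun_smul (differentiableAt_of_contDiffOn ha hs hx)
    (differentiableAt_of_contDiffOn hf hs hx)]
  rfl

theorem pd_add {W : Type*} [NormedAddCommGroup W] [NormedSpace ℝ W] {f g : 𝔼 → W}
    (hf : ContDiffOn ℝ ∞ f s) (hg : ContDiffOn ℝ ∞ g s) (hs : IsOpen s) {x : 𝔼} (hx : x ∈ s)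
    (k : Fin 2) : pd k (fun p => f p + g p) x = pd k f x + pd k g x := by
  rw [pd, fderiv_fun_add (differentiableAt_of_contDiffOn hf hs hx)
    (differentiableAt_of_contDiffOn hg hs hx)]
  rfl

/-- The second derivative of the canonical lift `a Y` in a null direction of `Y` in which `Y` is
related to `Z`. -/
theorem pd_pd_smul_of_null {a g : 𝔼 → ℝ} (hs : IsOpen s) (hY : ContDiffOn ℝ ∞ Y s)
    (hZ : ContDiffOn ℝ ∞ Z s) (ha : ContDiffOn ℝ ∞ a s) (hg : ContDiffOn ℝ ∞ g s)
    (hag : ∀ x ∈ s, a x * (a x * g x) = 1 / 2) (j k : Fin 2) {δ : ℝ} (hδ : δ * δ = 1)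
    (hrel : ∀ x ∈ s, g x • pd k Z x = δ • pd j Y x) {x : 𝔼} (hx : x ∈ s) :
    pd j (pd j fun p => a p • Y p) x = (δ * (a x * g x)) • pd j (pd k Z) x +
      pd j (pd j a) x • Y x := by
  have hb : ContDiffOn ℝ ∞ (fun p => δ * (a p * g p)) s := contDiffOn_const.mul (ha.mul hg)
  -- Trading `Y_j` for `Z_k` makes the next derivative produce the mixed derivative `Z_jk`, which is
  -- common to both null directions.
  have e1 : ∀ p ∈ s, pd j (fun p => a p • Y p) p =
      (δ * (a p * g p)) • pd k Z p + pd j a p • Y p := by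
    intro p hp
    rw [pd_smul ha hY hs hp, mul_smul, mul_smul, hrel p hp, smul_comm δ, smul_smul δ, hδ, one_smul]
  have hZk := contDiffOn_pd hZ hs k
  have haj := contDiffOn_pd ha hs j
  have hag' : pd j (fun p => a p * (a p * g p)) x = 0 := by
    rw [pd_congr (g := fun _ => 1 / 2) hs hag hx, pd]; simp
  have hax : a x ≠ 0 := left_ne_zero_of_mul (by rw [hag x hx]; norm_num : a x * (a x * g x) ≠ 0)
  have h2 := pd_smul ha (ha.mul hg) hs hx j
  simp only [smul_eq_mul] at h2
  change pd j (fun p => a p * (a p * g p)) x = _ at h2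
  rw [hag'] at h2
  have h3 : pd j (fun p => δ * (a p * g p)) x = δ * pd j (fun p => a p * g p) x := by
    have := pd_smul (contDiffOn_const (c := δ)) (ha.mul hg) hs hx j
    simp only [smul_eq_mul] at this
    refine this.trans ?_
    rw [pd, pd, fderiv_const_apply]
    simp
  have hs₁ : ContDiffOn ℝ ∞ (fun p => (δ * (a p * g p)) • pd k Z p) s := hb.smul hZk
  have hs₂ : ContDiffOn ℝ ∞ (fun p => pd j a p • Y p) s := haj.smul hY
  rw [pd_congr hs e1 hx, pd_add hs₁ hs₂ hs hx, pd_smul hb hZk hs hx,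
    pd_smul haj hY hs hx, h3]
  -- As `a² g` is constant, `(a g)_j = -a_j g`, so this first-order term cancels `a_j Y_j`.
  have h4 : (δ * pd j (fun p => a p * g p) x) • pd k Z x = -(pd j a x • pd j Y x) := by
    have e2 : pd j (fun p => a p * g p) x = -(pd j a x * g x) := by
      apply mul_left_cancel₀ hax
      change 0 = a x * pd j (fun p => a p * g p) x + pd j a x * (a x * g x) at h2
      linear_combination -h2
    rw [e2, mul_neg, neg_smul, mul_comm δ, mul_assoc, mul_comm (g x), mul_smul, mul_smul,
      hrel x hx, smul_smul δ, hδ, one_smul]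
  rw [h4]
  abel

/-- The canonical lift is `a Y` with `a = (2 g)^(-1/2)`. Modulo `Y` its pure second derivatives are
`δ₂ a g Z_uv` and `δ₁ a g Z_uv`, and `δ₂ = ε δ₁`. -/
theorem isAdaptedDarboux_of_null {ε δ₁ δ₂ : ℝ} (h : IsNullPair n r s Y Z) (hδ₁ : δ₁ * δ₁ = 1)
    (hδ₂ : δ₂ * δ₂ = 1) (hδ : δ₁ * δ₂ = ε)
    (h₁ : ∀ x ∈ s, ip n r (pd 0 Y x) (pd 0 Y x) = 0)
    (h₂ : ∀ x ∈ s, ip n r (pd 1 Y x) (pd 1 Y x) = 0)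
    (h₁₂ : ∀ x ∈ s, 0 < ip n r (pd 0 Y x) (pd 1 Y x))
    (hr₁ : ∀ x ∈ s, ip n r (pd 0 Y x) (pd 1 Y x) • pd 0 Z x = δ₁ • pd 1 Y x)
    (hr₂ : ∀ x ∈ s, ip n r (pd 0 Y x) (pd 1 Y x) • pd 1 Z x = δ₂ • pd 0 Y x) :
    ∃ a : 𝔼 → ℝ, (∀ x ∈ s, a x ≠ 0) ∧ IsAdaptedDarboux n r ε s (fun x => a x • Y x) Z := by
  obtain ⟨g, hg⟩ : ∃ g : 𝔼 → ℝ, g = fun x => ip n r (pd 0 Y x) (pd 1 Y x) := ⟨_, rfl⟩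
  have hs := h.isOpen
  have sg : ContDiffOn ℝ ∞ g s := hg ▸ contDiffOn_ip (contDiffOn_pd h.smooth_left hs 0)
    (contDiffOn_pd h.smooth_left hs 1)
  have hgx : ∀ x, ip n r (pd 0 Y x) (pd 1 Y x) = g x := fun x => by rw [hg]
  simp only [hgx] at h₁₂ hr₁ hr₂
  have hpos : ∀ x ∈ s, 0 < 2 * g x := fun x hx => by linarith [h₁₂ x hx]
  obtain ⟨a, ha⟩ : ∃ a : 𝔼 → ℝ, a = fun x => (Real.sqrt (2 * g x))⁻¹ := ⟨_, rfl⟩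
  have sa : ContDiffOn ℝ ∞ a s := ha ▸ ((contDiffOn_const.mul sg).sqrt fun x hx =>
    (hpos x hx).ne').inv fun x hx => (Real.sqrt_pos.2 (hpos x hx)).ne'
  have ha0 : ∀ x ∈ s, a x ≠ 0 := fun x hx => by
    rw [ha]; exact inv_ne_zero (Real.sqrt_pos.2 (hpos x hx)).ne'
  have hag : ∀ x ∈ s, a x * (a x * g x) = 1 / 2 := fun x hx => by
    have h1 := Real.mul_self_sqrt (hpos x hx).le
    have h2 := (Real.sqrt_pos.2 (hpos x hx)).ne'
    simp only [ha]
    field_simp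
    linarith
  have hY0 : ∀ k, ∀ x ∈ s, ip n r (pd k Y x) (Y x) = 0 := fun k x hx => h.fderiv_left hx _
  refine ⟨a, ha0, sa.smul h.smooth_left, h.smooth_right, ?_, ?_, ?_, ?_⟩
  · intro x hx
    simp only [pd_smul sa h.smooth_left hs hx, ip_add_left, ip_add_right, ip_smul_left,
      ip_smul_right, h₁ x hx, h₂ x hx, hgx, h.left x hx, hY0 _ x hx, ip_comm (Y x) (pd _ Y x)]
    refine ⟨by ring, by ring, ?_⟩
    rw [← hag x hx]
    ring
  · intro x hx
    -- The terms in `Z_uv` match, leaving `(a_uu - ε a_vv) Y`; the factor `a⁻¹` rewrites this as a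
    -- multiple of `a Y`.
    refine ⟨(pd 0 (pd 0 a) x - ε * pd 1 (pd 1 a) x) * (a x)⁻¹, ?_⟩
    rw [pd_pd_smul_of_null hs h.smooth_left h.smooth_right sa sg hag 0 1 hδ₂ hr₂ hx,
      pd_pd_smul_of_null hs h.smooth_left h.smooth_right sa sg hag 1 0 hδ₁ hr₁ hx,
      pd_comm h.smooth_right hs hx 0 1, smul_smul, mul_assoc _ (a x)⁻¹,
      inv_mul_cancel₀ (ha0 x hx), mul_one, smul_add, smul_smul, smul_smul, sub_smul]
    have : ε * (δ₁ * (a x * g x)) = δ₂ * (a x * g x) := by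
      rw [← hδ]; linear_combination (δ₂ * (a x * g x)) * hδ₁
    rw [this]
    abel
  · intro x hx
    rw [ip_smul_left, h.ip_eq x hx, mul_one]
    exact ha0 x hx
  · intro x hx
    have key : ∀ (j k : Fin 2) (δ : ℝ), g x • pd j Z x = δ • pd k Y x →
        pd j Z x ∈ Submodule.span ℝ {Z x, a x • Y x, pd k (fun p => a p • Y p) x} := by
      intro j k δ hr
      rw [Submodule.mem_span_triple]
      -- Solve `(aY)_k = a Y_k + a_k Y` for `Y_k` and insert it into `Z_j = g⁻¹ δ Y_k`; the last
      -- `a⁻¹` appears because the spanning vector is `a Y`, not `Y`.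
      refine ⟨0, -((g x)⁻¹ * δ * (a x)⁻¹ * pd k a x * (a x)⁻¹), (g x)⁻¹ * δ * (a x)⁻¹, ?_⟩
      have hg0 := (h₁₂ x hx).ne'
      have ha0 := ha0 x hx
      rw [← inv_smul_smul₀ hg0 (pd j Z x), hr, pd_smul sa h.smooth_left hs hx]
      ext i
      simp only [Pi.add_apply, Pi.smul_apply, smul_eq_mul]
      field_simp
      ring
    exact ⟨key 0 1 δ₁ (hr₁ x hx), key 1 0 δ₂ (hr₂ x hx)⟩

/-- Commuting motions of a Lorentzian plane have adapted coordinates. -/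
theorem exists_adapted_coordinates (h : IsNullPair n r s Y Z)
    (hc : MotionsCommute n r s Y Z) (hq : q ∈ s)
    (hp : ∃ A, 0 < ip n r (fderiv ℝ Y q A) (fderiv ℝ Y q A))
    (hm : ∃ A, ip n r (fderiv ℝ Y q A) (fderiv ℝ Y q A) < 0) {ε k : ℝ} (hε : ε * ε = 1)
    (hεk : 0 < ε * k)
    (hk : ∀ A B, ip n r (fderiv ℝ Z q A) (fderiv ℝ Z q B) =
      k * ip n r (fderiv ℝ Y q A) (fderiv ℝ Y q B)) :
    ∃ φ : OpenPartialHomeomorph 𝔼 𝔼, q ∈ φ.source ∧ φ.source ⊆ s ∧ ContDiffOn ℝ ∞ φ φ.source ∧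
      ContDiffOn ℝ ∞ φ.symm φ.target ∧ ∃ Y' Z' : 𝔼 → Fin (n + 2) → ℝ,
        IsAdaptedDarboux n r ε φ.target Y' Z' ∧ ∀ x ∈ φ.target,
          (∃ c : ℝ, c ≠ 0 ∧ Y' x = c • Y (φ.symm x)) ∧ ∃ c : ℝ, c ≠ 0 ∧ Z' x = c • Z (φ.symm x) := by
  obtain ⟨ρ, hρ, hball⟩ := Metric.isOpen_iff.1 h.isOpen q hq
  obtain ⟨b, sb, hb0, h', hpar, hc', hmet⟩ := exists_parallel_rescaling
    (h.mono Metric.isOpen_ball hball) (convex_ball q ρ) (fun x hx => hc x (hball hx))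
  have hqb := Metric.mem_ball_self (x := q) hρ
  have hbq := hb0 q
  -- The rescaling multiplies the metric of `Y` by `b²` and that of `Z` by `b⁻²`. The ratio `k` thus
  -- becomes `k b⁻⁴`, with the same sign.
  obtain ⟨t, hts, ht, hqt, u, v, X₁, X₂, su, sv, δ₁, δ₂, hδ₁, hδ₂, hδ, hX⟩ :=
    exists_null_coordinates (k := k * (b q)⁻¹ ^ 4) h' hpar hc' hqb
      (by obtain ⟨A, hA⟩ := hp
          exact ⟨A, by rw [(hmet q hqb A A).1]; positivity⟩)
      (by obtain ⟨A, hA⟩ := hm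
          exact ⟨A, by rw [(hmet q hqb A A).1]; exact mul_neg_of_pos_of_neg (by positivity) hA⟩)
      hε (by rw [← mul_assoc]; positivity)
      (fun A B => by
        rw [(hmet q hqb A B).1, (hmet q hqb A B).2, hk]
        field_simp)
  obtain ⟨φ, hqφ, hφt, hφ, hφ', hφd⟩ := exists_chart_of_dual ht hqt su sv fun x hx => (hX x hx).1
  have hmaps : ∀ x ∈ φ.target, φ.symm x ∈ t := fun x hx => hφt (φ.map_target hx)
  have hmt : Set.MapsTo φ.symm φ.target (Metric.ball q ρ) := fun x hx => hts (hmaps x hx)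
  generalize hY₁ : (fun x => b x • Y x) = Y₁ at *
  generalize hZ₁ : (fun x => (b x)⁻¹ • Z x) = Z₁ at *
  have hpull : IsNullPair n r φ.target (Y₁ ∘ φ.symm) (Z₁ ∘ φ.symm) :=
    ⟨h'.smooth_left.comp hφ' hmt, h'.smooth_right.comp hφ' hmt, φ.open_target,
      fun x hx => h'.left _ (hmt hx), fun x hx => h'.right _ (hmt hx),
      fun x hx => h'.ip_eq _ (hmt hx)⟩
  have hchain : ∀ {W : 𝔼 → Fin (n + 2) → ℝ}, ContDiffOn ℝ ∞ W (Metric.ball q ρ) →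
      ∀ x ∈ φ.target, pd 0 (W ∘ φ.symm) x = fderiv ℝ W (φ.symm x) (X₁ (φ.symm x)) ∧
        pd 1 (W ∘ φ.symm) x = fderiv ℝ W (φ.symm x) (X₂ (φ.symm x)) := by
    intro W hW x hx
    simp only [pd]
    rw [fderiv_comp _ (differentiableAt_of_contDiffOn hW Metric.isOpen_ball (hmt hx))
      (differentiableAt_of_contDiffOn hφ' φ.open_target hx), ← (hφd x hx).1, ← (hφd x hx).2]
    exact ⟨rfl, rfl⟩
  have eY₀ := fun x hx => (hchain h'.smooth_left x hx).1
  have eY₁ := fun x hx => (hchain h'.smooth_left x hx).2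
  have eZ₀ := fun x hx => (hchain h'.smooth_right x hx).1
  have eZ₁ := fun x hx => (hchain h'.smooth_right x hx).2
  obtain ⟨a, ha0, hA⟩ := isAdaptedDarboux_of_null hpull hδ₁ hδ₂ hδ
    (fun x hx => by rw [eY₀ x hx]; exact (hX _ (hmaps x hx)).2.1)
    (fun x hx => by rw [eY₁ x hx]; exact (hX _ (hmaps x hx)).2.2.1)
    (fun x hx => by rw [eY₀ x hx, eY₁ x hx]; exact (hX _ (hmaps x hx)).2.2.2.1)
    (fun x hx => by rw [eY₀ x hx, eY₁ x hx, eZ₀ x hx]; exact (hX _ (hmaps x hx)).2.2.2.2.1)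
    (fun x hx => by rw [eY₀ x hx, eY₁ x hx, eZ₁ x hx]; exact (hX _ (hmaps x hx)).2.2.2.2.2)
  refine ⟨φ, hqφ, hφt.trans (hts.trans hball), hφ, hφ', _, _, hA, fun x hx => ⟨?_, ?_⟩⟩
  · refine ⟨a x * b (φ.symm x), mul_ne_zero (ha0 x hx) (hb0 _).ne', ?_⟩
    rw [mul_smul, ← hY₁]; rfl
  · exact ⟨(b (φ.symm x))⁻¹, inv_ne_zero (hb0 _).ne', by rw [← hZ₁]; rfl⟩

end AdaptedCoordinates

/-! ### Functions on the surface in a chart -/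

section Charts

variable {M : Type*} [TopologicalSpace M]
  {e : OpenPartialHomeomorph M (EuclideanSpace ℝ (Fin 2))}
  {W : Type*} [NormedAddCommGroup W] [NormedSpace ℝ W] {g : M → W} {U : Set M} {x : M}

/-- The part of the domain of coordinates over `U`. -/
def chartDomain (e : OpenPartialHomeomorph M (EuclideanSpace ℝ (Fin 2))) (U : Set M) : Set 𝔼 :=
  e.target ∩ e.symm ⁻¹' U

theorem isOpen_chartDomain (hU : IsOpen U) : IsOpen (chartDomain e U) :=
  e.isOpen_inter_preimage_symm hU

theorem mem_chartDomain (hx : x ∈ U) (hxe : x ∈ e.source) : e x ∈ chartDomain e U :=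
  ⟨e.map_source hxe, by rw [Set.mem_preimage, e.left_inv hxe]; exact hx⟩

theorem coordDeriv_eq_pd (k : Fin 2) : coordDeriv e k g x = pd k (g ∘ e.symm) (e x) := rfl

theorem coordDeriv_coordDeriv (hx : x ∈ e.source) (j k : Fin 2) :
    coordDeriv e j (coordDeriv e k g) x = pd j (pd k (g ∘ e.symm)) (e x) := by
  rw [coordDeriv_eq_pd]
  refine pd_congr e.open_target (fun y hy => ?_) (e.map_source hx) j
  rw [Function.comp_apply, coordDeriv_eq_pd, e.right_inv hy]

variable [ChartedSpace (EuclideanSpace ℝ (Fin 2)) M]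

theorem contDiffOn_comp_symm (he : e ∈ IsManifold.maximalAtlas (𝓡 2) ∞ M)
    (hg : ContMDiffOn (𝓡 2) 𝓘(ℝ, W) ∞ g U) : ContDiffOn ℝ ∞ (g ∘ e.symm) (chartDomain e U) := by
  rw [← contMDiffOn_iff_contDiffOn]
  exact hg.comp ((contMDiffOn_symm_of_mem_maximalAtlas he).mono Set.inter_subset_left)
    Set.inter_subset_right

theorem contMDiffOn_comp (he : e ∈ IsManifold.maximalAtlas (𝓡 2) ∞ M) {f : 𝔼 → W}
    (hf : ContDiffOn ℝ ∞ f e.target) : ContMDiffOn (𝓡 2) 𝓘(ℝ, W) ∞ (f ∘ e) e.source :=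
  hf.contMDiffOn.comp (contMDiffOn_of_mem_maximalAtlas he) fun _ hx => e.map_source hx

theorem mdifferentiableAt_chart (he : e ∈ IsManifold.maximalAtlas (𝓡 2) ∞ M) (hx : x ∈ e.source) :
    MDifferentiableAt (𝓡 2) (𝓡 2) e x :=
  (contMDiffAt_of_mem_maximalAtlas he hx).mdifferentiableAt (by simp)

theorem mfderiv_eq_fderiv_comp_symm (he : e ∈ IsManifold.maximalAtlas (𝓡 2) ∞ M)
    (hg : ContMDiffOn (𝓡 2) 𝓘(ℝ, W) ∞ g U) (hU : IsOpen U) (hx : x ∈ U) (hxe : x ∈ e.source)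
    (X : TangentSpace (𝓡 2) x) :
    (mfderiv (𝓡 2) 𝓘(ℝ, W) g x X : W) =
      fderiv ℝ (g ∘ e.symm) (e x) (mfderiv (𝓡 2) (𝓡 2) e x X : 𝔼) := by
  have hd := differentiableAt_of_contDiffOn (contDiffOn_comp_symm he hg) (isOpen_chartDomain hU)
    (mem_chartDomain hx hxe)
  have heq : g =ᶠ[nhds x] (g ∘ e.symm) ∘ e := by
    filter_upwards [e.open_source.mem_nhds hxe] with p hp
    simp [e.left_inv hp]
  rw [heq.mfderiv_eq, mfderiv_comp x hd.mdifferentiableAt (mdifferentiableAt_chart he hxe),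
    mfderiv_eq_fderiv]
  rfl

theorem mfderiv_chart_bijective (he : e ∈ IsManifold.maximalAtlas (𝓡 2) ∞ M)
    (hxe : x ∈ e.source) : Function.Bijective (mfderiv (𝓡 2) (𝓡 2) e x) := by
  have h : e.MDifferentiable (𝓡 2) (𝓡 2) :=
    ⟨(contMDiffOn_of_mem_maximalAtlas he).mdifferentiableOn (by simp),
      (contMDiffOn_symm_of_mem_maximalAtlas he).mdifferentiableOn (by simp)⟩
  exact h.mfderiv_bijective hxe

theorem exists_mfderiv_chart_eq (he : e ∈ IsManifold.maximalAtlas (𝓡 2) ∞ M)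
    (hxe : x ∈ e.source) (A : 𝔼) : ∃ X : TangentSpace (𝓡 2) x,
      (mfderiv (𝓡 2) (𝓡 2) e x X : 𝔼) = A :=
  (mfderiv_chart_bijective he hxe).2 A

theorem inducedMetric_eq {n r : ℕ} {Y : M → Fin (n + 2) → ℝ}
    (he : e ∈ IsManifold.maximalAtlas (𝓡 2) ∞ M)
    (hY : ContMDiffOn (𝓡 2) 𝓘(ℝ, Fin (n + 2) → ℝ) ∞ Y U) (hU : IsOpen U) (hx : x ∈ U)
    (hxe : x ∈ e.source) (X X' : TangentSpace (𝓡 2) x) :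
    inducedMetric n r Y x X X' =
      ip n r (fderiv ℝ (Y ∘ e.symm) (e x) (mfderiv (𝓡 2) (𝓡 2) e x X : 𝔼))
        (fderiv ℝ (Y ∘ e.symm) (e x) (mfderiv (𝓡 2) (𝓡 2) e x X' : 𝔼)) := by
  rw [inducedMetric, ← mfderiv_eq_fderiv_comp_symm he hY hU hx hxe,
    ← mfderiv_eq_fderiv_comp_symm he hY hU hx hxe]

end Charts

/-! ### Hopf differentials of a canonical lift -/

section Hopf

variable {n r : ℕ} {s : Set 𝔼} {Y : 𝔼 → Fin (n + 2) → ℝ} {x : 𝔼}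

theorem ip_pd_eq_neg {P Q : 𝔼 → Fin (n + 2) → ℝ} {c : ℝ} (hs : IsOpen s)
    (hP : ContDiffOn ℝ ∞ P s) (hQ : ContDiffOn ℝ ∞ Q s) (h : ∀ x ∈ s, ip n r (P x) (Q x) = c)
    (hx : x ∈ s) (k : Fin 2) : ip n r (pd k P x) (Q x) = -ip n r (P x) (pd k Q x) := by
  have := fderiv_ip_eq_neg hP hQ hs h hx (EuclideanSpace.single k 1)
  rw [ip_comm _ (P x)] at this
  rw [pd, pd, this, neg_neg]

/-- Differentiating the relations of a canonical lift shows that `Y_uu` and `Y_vv` are orthogonal to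
`Y`, `Y_u`, `Y_v`. Since `⟨Y, Y_uv⟩ = -1/2`, adding a multiple of `Y` makes them orthogonal to
`Y_uv` as well. -/
theorem exists_hopf {ε : ℝ} (hs : IsOpen s) (hY : ContDiffOn ℝ ∞ Y s)
    (hnull : ∀ x ∈ s, ip n r (Y x) (Y x) = 0)
    (hcan : ∀ x ∈ s, ip n r (pd 0 Y x) (pd 0 Y x) = 0 ∧ ip n r (pd 1 Y x) (pd 1 Y x) = 0 ∧
      ip n r (pd 0 Y x) (pd 1 Y x) = 1 / 2)
    (hx : x ∈ s) (hopf : ∃ c : ℝ, pd 0 (pd 0 Y) x = ε • pd 1 (pd 1 Y) x + c • Y x) :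
    ∃ κ₁ κ₂ : Fin (n + 2) → ℝ, κ₁ = ε • κ₂ ∧
      (∀ w ∈ Submodule.span ℝ {Y x, pd 0 Y x, pd 1 Y x, pd 1 (pd 0 Y) x}, ip n r κ₁ w = 0) ∧
      (∀ w ∈ Submodule.span ℝ {Y x, pd 0 Y x, pd 1 Y x, pd 1 (pd 0 Y) x}, ip n r κ₂ w = 0) ∧
      (∃ s₁ : ℝ, pd 0 (pd 0 Y) x = -(s₁ / 2) • Y x + κ₁) ∧
      ∃ s₂ : ℝ, pd 1 (pd 1 Y) x = -(s₂ / 2) • Y x + κ₂ := by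
  have h0 := contDiffOn_pd hY hs 0
  have h1 := contDiffOn_pd hY hs 1
  have hYk : ∀ k, ∀ x ∈ s, ip n r (pd k Y x) (Y x) = 0 := fun k x hx => by
    have := ip_pd_eq_neg hs hY hY hnull hx k
    rw [ip_comm (Y x)] at this
    linarith
  have hYk' : ∀ k, ∀ x ∈ s, ip n r (Y x) (pd k Y x) = 0 := fun k x hx => by
    rw [ip_comm, hYk k x hx]
  have hself : ∀ j k, (∀ x ∈ s, ip n r (pd k Y x) (pd k Y x) = 0) →
      ip n r (pd j (pd k Y) x) (pd k Y x) = 0 := fun j k h => by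
    have := ip_pd_eq_neg hs (contDiffOn_pd hY hs k) (contDiffOn_pd hY hs k) h hx j
    rw [ip_comm (pd k Y x)] at this
    linarith
  have hn0 : ∀ x ∈ s, ip n r (pd 0 Y x) (pd 0 Y x) = 0 := fun x hx => (hcan x hx).1
  have hn1 : ∀ x ∈ s, ip n r (pd 1 Y x) (pd 1 Y x) = 0 := fun x hx => (hcan x hx).2.1
  have hn01 : ∀ x ∈ s, ip n r (pd 0 Y x) (pd 1 Y x) = 1 / 2 := fun x hx => (hcan x hx).2.2
  have a1 : ip n r (pd 0 (pd 0 Y) x) (Y x) = 0 := by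
    rw [ip_pd_eq_neg hs h0 hY (hYk 0) hx, hn0 x hx, neg_zero]
  have a2 : ip n r (pd 0 (pd 0 Y) x) (pd 0 Y x) = 0 := hself 0 0 hn0
  have a3 : ip n r (pd 0 (pd 0 Y) x) (pd 1 Y x) = 0 := by
    rw [ip_pd_eq_neg hs h0 h1 hn01 hx, pd_comm hY hs hx 0 1, ip_comm, hself 1 0 hn0, neg_zero]
  have b1 : ip n r (pd 1 (pd 1 Y) x) (Y x) = 0 := by
    rw [ip_pd_eq_neg hs h1 hY (hYk 1) hx, hn1 x hx, neg_zero]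
  have b2 : ip n r (pd 1 (pd 1 Y) x) (pd 0 Y x) = 0 := by
    rw [ip_pd_eq_neg hs h1 h0 (fun x hx => by rw [ip_comm, hn01 x hx]) hx, pd_comm hY hs hx 1 0,
      ip_comm, hself 0 1 hn1, neg_zero]
  have b3 : ip n r (pd 1 (pd 1 Y) x) (pd 1 Y x) = 0 := hself 1 1 hn1
  have c1 : ip n r (Y x) (pd 1 (pd 0 Y) x) = -(1 / 2) := by
    rw [ip_comm, ip_pd_eq_neg hs h0 hY (hYk 0) hx, hn01 x hx]
  obtain ⟨c, hc⟩ := hopf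
  -- The factor `4` is forced by `⟨Y_uu + (s₁/2) Y, Y_uv⟩ = 0` and `⟨Y, Y_uv⟩ = -1/2`.
  obtain ⟨s₁, hs₁⟩ : ∃ s₁ : ℝ, s₁ = 4 * ip n r (pd 0 (pd 0 Y) x) (pd 1 (pd 0 Y) x) := ⟨_, rfl⟩
  obtain ⟨s₂, hs₂⟩ : ∃ s₂ : ℝ, s₂ = 4 * ip n r (pd 1 (pd 1 Y) x) (pd 1 (pd 0 Y) x) := ⟨_, rfl⟩
  have hspan : ∀ κ : Fin (n + 2) → ℝ, ip n r κ (Y x) = 0 → ip n r κ (pd 0 Y x) = 0 →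
      ip n r κ (pd 1 Y x) = 0 → ip n r κ (pd 1 (pd 0 Y) x) = 0 →
      ∀ w ∈ Submodule.span ℝ {Y x, pd 0 Y x, pd 1 Y x, pd 1 (pd 0 Y) x}, ip n r κ w = 0 := by
    intro κ k1 k2 k3 k4 w hw
    induction hw using Submodule.span_induction with
    | mem w hw =>
      simp only [Set.mem_insert_iff, Set.mem_singleton_iff] at hw
      rcases hw with rfl | rfl | rfl | rfl <;> assumption
    | zero => exact ip_zero_right _
    | add u v _ _ hu hv => rw [ip_add_right, hu, hv, add_zero]
    | smul a u _ hu => rw [ip_smul_right, hu, mul_zero]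
  refine ⟨pd 0 (pd 0 Y) x + (s₁ / 2) • Y x, pd 1 (pd 1 Y) x + (s₂ / 2) • Y x, ?_,
    hspan _ ?_ ?_ ?_ ?_, hspan _ ?_ ?_ ?_ ?_, ⟨s₁, ?_⟩, ⟨s₂, ?_⟩⟩
  -- Pairing with `Y_uv` determines `c`, so the relation known modulo `Y` becomes the exact relation
  -- `κ₁ = ε κ₂`.
  · have hcs : c = ε * (s₂ / 2) - s₁ / 2 := by
      have := congrArg (fun v => ip n r v (pd 1 (pd 0 Y) x)) hc
      simp only [ip_add_left, ip_smul_left, c1] at this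
      linear_combination 2 * this - (1 / 2) * ε * hs₂ + (1 / 2) * hs₁
    rw [hc, hcs, smul_add, smul_smul, sub_smul]
    abel
  · simp [ip_add_left, ip_smul_left, a1, hnull x hx]
  · simp [ip_add_left, ip_smul_left, a2, hYk' 0 x hx]
  · simp [ip_add_left, ip_smul_left, a3, hYk' 1 x hx]
  · rw [ip_add_left, ip_smul_left, c1, hs₁]; ring
  · simp [ip_add_left, ip_smul_left, b1, hnull x hx]
  · simp [ip_add_left, ip_smul_left, b2, hYk' 0 x hx]
  · simp [ip_add_left, ip_smul_left, b3, hYk' 1 x hx]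
  · rw [ip_add_left, ip_smul_left, c1, hs₂]; ring
  · rw [neg_smul]; abel
  · rw [neg_smul]; abel

end Hopf

/-! ### Adapted charts of the surface -/

section Adapted

variable {M : Type*} [TopologicalSpace M] [ChartedSpace (EuclideanSpace ℝ (Fin 2)) M]
  {e₀ : OpenPartialHomeomorph M (EuclideanSpace ℝ (Fin 2))}
  {n r : ℕ} {y z : M → Q n r} {U : Set M} {Y Z : M → Fin (n + 2) → ℝ} {p : M}

theorem IsLift.ip_self (h : IsLift y U Y) {x : M} (hx : x ∈ U) : ip n r (Y x) (Y x) = 0 :=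
  (y x).2 (Y x) (by rw [(h.2 x hx).2]; exact Submodule.mem_span_singleton_self _)

/-- Transports `exists_adapted_coordinates` to the surface: the adapted chart is `e₀` followed by
`φ`. Only the sign of the conformal factor `k` is prescribed. -/
theorem exists_adapted_chart [IsManifold (𝓡 2) ∞ M]
    (he : e₀ ∈ IsManifold.maximalAtlas (𝓡 2) ∞ M) (hU : IsOpen U)
    (hY : IsLift y U Y) (hZ : IsLift z U Z) (hYZ : ∀ x ∈ U, ip n r (Y x) (Z x) = 1)
    (hc : MotionsCommute n r (chartDomain e₀ U) (Y ∘ e₀.symm) (Z ∘ e₀.symm))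
    (hp : p ∈ U) (hpe : p ∈ e₀.source)
    (hpos : ∃ X, 0 < inducedMetric n r Y p X X) (hneg : ∃ X, inducedMetric n r Y p X X < 0)
    {ε : ℤˣ} {k : ℝ} (hεk : 0 < ((ε : ℤ) : ℝ) * k)
    (hk : ∀ X X', inducedMetric n r Z p X X' = k * inducedMetric n r Y p X X') :
    ∃ e Y', p ∈ e.source ∧ IsAdapted ε y e Y' ∧ ∃ Z', IsLift z e.source Z' ∧
      ∀ x ∈ e.source, ip n r (Y' x) (Z' x) ≠ 0 ∧
        coordDeriv e 0 Z' x ∈ Submodule.span ℝ {Z' x, Y' x, coordDeriv e 1 Y' x} ∧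
        coordDeriv e 1 Z' x ∈ Submodule.span ℝ {Z' x, Y' x, coordDeriv e 0 Y' x} := by
  have hpair : IsNullPair n r (chartDomain e₀ U) (Y ∘ e₀.symm) (Z ∘ e₀.symm) :=
    ⟨contDiffOn_comp_symm he hY.1, contDiffOn_comp_symm he hZ.1, isOpen_chartDomain hU,
      fun x hx => hY.ip_self hx.2, fun x hx => hZ.ip_self hx.2, fun x hx => hYZ _ hx.2⟩
  have hq := mem_chartDomain hp hpe
  have hε : ((ε : ℤ) : ℝ) * ((ε : ℤ) : ℝ) = 1 := by
    rcases Int.units_eq_one_or ε with rfl | rfl <;> norm_num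
  obtain ⟨φ, hqφ, hφs, hφ, hφ', Y', Z', hA, hYZ'⟩ := exists_adapted_coordinates hpair hc hq
    (by obtain ⟨X, hX⟩ := hpos
        rw [inducedMetric_eq he hY.1 hU hp hpe] at hX
        exact ⟨_, hX⟩)
    (by obtain ⟨X, hX⟩ := hneg
        rw [inducedMetric_eq he hY.1 hU hp hpe] at hX
        exact ⟨_, hX⟩) hε hεk
    (by intro A B
        obtain ⟨X, rfl⟩ := exists_mfderiv_chart_eq he hpe A
        obtain ⟨X', rfl⟩ := exists_mfderiv_chart_eq he hpe B
        rw [← inducedMetric_eq he hY.1 hU hp hpe, ← inducedMetric_eq he hZ.1 hU hp hpe, hk])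
  obtain ⟨e, hedef⟩ : ∃ e, e = e₀.trans φ := ⟨_, rfl⟩
  have hsrc : ∀ x ∈ e.source, x ∈ e₀.source ∧ e₀ x ∈ φ.source := fun x hx => by
    rw [hedef, OpenPartialHomeomorph.trans_source] at hx; exact hx
  have htgt : e.target = φ.target := by
    rw [hedef, OpenPartialHomeomorph.trans_target]
    exact Set.inter_eq_left.2 fun x hx => (hφs (φ.map_target hx)).1
  have hex : ∀ x, e x = φ (e₀ x) := fun x => by rw [hedef]; rfl
  have hemax : e ∈ IsManifold.maximalAtlas (𝓡 2) ∞ M := by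
    rw [IsManifold.mem_maximalAtlas_iff_contMDiffOn] at he ⊢
    constructor
    · rw [hedef]
      exact hφ.contMDiffOn.comp (he.1.mono fun x hx => hx.1) fun x hx => hx.2
    · rw [htgt, hedef]
      exact he.2.comp hφ'.contMDiffOn fun x hx => (hφs (φ.map_target hx)).1
  have hxU : ∀ x ∈ e.source, x ∈ U := fun x hx => by
    have := (hφs (hsrc x hx).2).2
    rwa [Set.mem_preimage, e₀.left_inv (hsrc x hx).1] at this
  have hval : ∀ x ∈ e.source, e x ∈ φ.target ∧ e₀.symm (φ.symm (e x)) = x := fun x hx =>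
    ⟨htgt ▸ e.map_source hx, by
      rw [hex, φ.left_inv (hsrc x hx).2, e₀.left_inv (hsrc x hx).1]⟩
  have hlift : ∀ {w : M → Q n r} {P : M → Fin (n + 2) → ℝ} {P' : 𝔼 → Fin (n + 2) → ℝ},
      IsLift w U P → ContDiffOn ℝ ∞ P' φ.target →
      (∀ x ∈ φ.target, ∃ c : ℝ, c ≠ 0 ∧ P' x = c • (P ∘ e₀.symm) (φ.symm x)) →
      IsLift w e.source (P' ∘ e) := by
    intro w P P' hP hP' hPP'
    refine ⟨contMDiffOn_comp hemax (htgt ▸ hP'), fun x hx => ?_⟩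
    obtain ⟨h1, h2⟩ := hval x hx
    obtain ⟨c, hc, hcP⟩ := hPP' _ h1
    have hcP' : (P' ∘ e) x = c • P x := by
      rw [Function.comp_apply, hcP, Function.comp_apply, h2]
    obtain ⟨h3, h4⟩ := hP.2 x (hxU x hx)
    rw [hcP', h4]
    exact ⟨smul_ne_zero hc h3, (Submodule.span_singleton_smul_eq (IsUnit.mk0 c hc) _).symm⟩
  have hY' : IsLift y e.source (Y' ∘ e) := hlift hY hA.smooth_left fun x hx => (hYZ' x hx).1
  have hZ' : IsLift z e.source (Z' ∘ e) := hlift hZ hA.smooth_right fun x hx => (hYZ' x hx).2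
  have hcomp : ∀ (P : 𝔼 → Fin (n + 2) → ℝ), ∀ x ∈ φ.target, ((P ∘ e) ∘ e.symm) x = P x :=
    fun P x hx => by rw [Function.comp_apply, Function.comp_apply, e.right_inv (htgt ▸ hx)]
  have hd : ∀ (P : 𝔼 → Fin (n + 2) → ℝ) (k : Fin 2), ∀ x ∈ φ.target,
      pd k ((P ∘ e) ∘ e.symm) x = pd k P x := fun P k x hx =>
    pd_congr φ.open_target (hcomp P) hx k
  have hd1 : ∀ (P : 𝔼 → Fin (n + 2) → ℝ) (k : Fin 2), ∀ x ∈ e.source,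
      coordDeriv e k (P ∘ e) x = pd k P (e x) := fun P k x hx => hd P k _ (hval x hx).1
  have hd2 : ∀ (P : 𝔼 → Fin (n + 2) → ℝ) (j k : Fin 2), ∀ x ∈ e.source,
      coordDeriv e j (coordDeriv e k (P ∘ e)) x = pd j (pd k P) (e x) := fun P j k x hx => by
    rw [coordDeriv_coordDeriv hx]
    exact pd_congr φ.open_target (hd P k) (hval x hx).1 j
  have hnull : ∀ x ∈ φ.target, ip n r (Y' x) (Y' x) = 0 := fun x hx => by
    obtain ⟨c, -, hc⟩ := (hYZ' x hx).1
    rw [hc, ip_smul_left, ip_smul_right, hpair.left _ (hφs (φ.map_target hx)), mul_zero, mul_zero]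
  refine ⟨e, Y' ∘ e, ?_, ⟨⟨hemax, hY', ?_⟩, ?_⟩, Z' ∘ e, hZ', ?_⟩
  · rw [hedef, OpenPartialHomeomorph.trans_source]; exact ⟨hpe, hqφ⟩
  · intro x hx
    rw [hd1 Y' 0 x hx, hd1 Y' 1 x hx]
    exact hA.canonical _ (hval x hx).1
  · intro x hx
    have hx' := (hval x hx).1
    obtain ⟨κ₁, κ₂, h1, h2, h3, h4, h5⟩ :=
      exists_hopf φ.open_target hA.smooth_left hnull hA.canonical hx' (hA.hopf _ hx')
    refine ⟨κ₁, κ₂, ⟨?_, ?_, ?_, ?_⟩, ?_⟩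
    · rw [conformalTangent, hd1 Y' 0 x hx, hd1 Y' 1 x hx, hd2 Y' 1 0 x hx]; exact h2
    · rw [conformalTangent, hd1 Y' 0 x hx, hd1 Y' 1 x hx, hd2 Y' 1 0 x hx]; exact h3
    · rw [hd2 Y' 0 0 x hx]; exact h4
    · rw [hd2 Y' 1 1 x hx]; exact h5
    · rw [h1, Units.smul_def, Int.cast_smul_eq_zsmul]
  · intro x hx
    rw [hd1 Y' 0 x hx, hd1 Y' 1 x hx, hd1 Z' 0 x hx, hd1 Z' 1 x hx]
    exact ⟨hA.ip_ne _ (hval x hx).1, hA.mem_span _ (hval x hx).1⟩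

end Adapted

/-! ### Calculus of matrix valued functions -/

section MatrixCalculus

variable {m : ℕ} {F : Type*} [NormedAddCommGroup F] [NormedSpace ℝ F]
  {A B : F → Matrix (Fin m) (Fin m) ℝ} {s : Set F} {q : F}

/-- The entries of a matrix valued function are smooth. -/
def SmoothMat (s : Set F) (A : F → Matrix (Fin m) (Fin m) ℝ) : Prop :=
  ∀ i j, ContDiffOn ℝ ∞ (fun x => A x i j) s

/-- The directional derivative of a matrix valued function. -/
def matDeriv (A : F → Matrix (Fin m) (Fin m) ℝ) (q v : F) : Matrix (Fin m) (Fin m) ℝ :=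
  Matrix.of fun i j => fderiv ℝ (fun x => A x i j) q v

theorem SmoothMat.const (C : Matrix (Fin m) (Fin m) ℝ) : SmoothMat s (fun _ => C) :=
  fun _ _ => contDiffOn_const

theorem SmoothMat.mul (hA : SmoothMat s A) (hB : SmoothMat s B) :
    SmoothMat s (fun x => A x * B x) := fun i j => by
  simp only [Matrix.mul_apply]
  exact ContDiffOn.sum fun k _ => (hA i k).mul (hB k j)

theorem SmoothMat.matDeriv (hA : SmoothMat s A) (hs : IsOpen s) (v : F) :
    SmoothMat s (fun x => matDeriv A x v) := fun i j =>
  contDiffOn_fderiv_apply (hA i j) hs contDiffOn_const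

theorem SmoothMat.congr (hA : SmoothMat s A) (h : ∀ x ∈ s, B x = A x) : SmoothMat s B :=
  fun i j => (hA i j).congr fun x hx => by rw [h x hx]

theorem matDeriv_congr (hs : IsOpen s) (h : ∀ x ∈ s, A x = B x) (hq : q ∈ s) (v : F) :
    matDeriv A q v = matDeriv B q v := by
  ext i j
  simp only [matDeriv, Matrix.of_apply]
  rw [(Filter.eventuallyEq_of_mem (hs.mem_nhds hq) fun x hx => by rw [h x hx] :
    (fun x => A x i j) =ᶠ[nhds q] fun x => B x i j).fderiv_eq]

theorem matDeriv_const (C : Matrix (Fin m) (Fin m) ℝ) (q v : F) :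
    matDeriv (fun _ => C) q v = 0 := by
  ext i j; simp [matDeriv]

theorem matDeriv_mul (hA : SmoothMat s A) (hB : SmoothMat s B) (hs : IsOpen s) (hq : q ∈ s)
    (v : F) : matDeriv (fun x => A x * B x) q v =
      matDeriv A q v * B q + A q * matDeriv B q v := by
  ext i j
  have hA' := fun k => differentiableAt_of_contDiffOn (hA i k) hs hq
  have hB' := fun k => differentiableAt_of_contDiffOn (hB k j) hs hq
  simp only [matDeriv, Matrix.of_apply, Matrix.mul_apply, Matrix.add_apply]
  rw [fderiv_fun_sum fun k _ => (hA' k).fun_mul (hB' k), ← Finset.sum_add_distrib]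
  simp only [_root_.sum_apply]
  refine Finset.sum_congr rfl fun k _ => ?_
  rw [fderiv_fun_mul (hA' k) (hB' k)]
  simp only [_root_.add_apply, _root_.smul_apply, smul_eq_mul]
  ring

theorem matDeriv_symm (hA : SmoothMat s A) (hs : IsOpen s) (hq : q ∈ s) (u v : F) :
    matDeriv (fun x => matDeriv A x u) q v = matDeriv (fun x => matDeriv A x v) q u := by
  ext i j
  exact fderiv_fderiv_symm (hA i j) hs hq v u

theorem matDeriv_mul_const (hA : SmoothMat s A) (hs : IsOpen s) (hq : q ∈ s)
    (C D : Matrix (Fin m) (Fin m) ℝ) (v : F) :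
    matDeriv (fun x => C * A x * D) q v = C * matDeriv A q v * D := by
  rw [matDeriv_mul ((SmoothMat.const C).mul hA) (SmoothMat.const D) hs hq, matDeriv_const,
    matDeriv_mul (SmoothMat.const C) hA hs hq, matDeriv_const]
  simp

theorem matDeriv_inv (hA : SmoothMat s A) (hB : SmoothMat s B) (hs : IsOpen s) (hq : q ∈ s)
    (hAB : ∀ x ∈ s, B x * A x = 1) (v : F) :
    matDeriv B q v = -(B q * matDeriv A q v * B q) := by
  have h := matDeriv_mul hB hA hs hq v
  rw [matDeriv_congr hs hAB hq, matDeriv_const] at h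
  have hAB' : A q * B q = 1 := mul_eq_one_comm.1 (hAB q hq)
  have h2 : (matDeriv B q v * A q + B q * matDeriv A q v) * B q = 0 := by rw [← h, zero_mul]
  rw [add_mul, mul_assoc, hAB', mul_one] at h2
  exact eq_neg_of_add_eq_zero_left h2

theorem fderiv_mulVec (hA : SmoothMat s A) (hs : IsOpen s) (hq : q ∈ s) (v : F) (w : Fin m → ℝ) :
    fderiv ℝ (fun x => (A x).mulVec w) q v = (matDeriv A q v).mulVec w := by
  have hd := fun i j => differentiableAt_of_contDiffOn (hA i j) hs hq
  have hd' : ∀ i, DifferentiableAt ℝ (fun x => (A x).mulVec w i) q := fun i => by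
    simp only [Matrix.mulVec, dotProduct]
    exact DifferentiableAt.fun_sum fun j _ => (hd i j).mul_const _
  ext i
  rw [fderiv_pi hd', ContinuousLinearMap.pi_apply]
  simp only [Matrix.mulVec, dotProduct, matDeriv, Matrix.of_apply]
  rw [fderiv_fun_sum fun j _ => (hd i j).mul_const _]
  simp only [_root_.sum_apply]
  refine Finset.sum_congr rfl fun j _ => ?_
  rw [fderiv_mul_const (hd i j)]
  simp [mul_comm]

/-- The Maurer-Cartan equation. -/
theorem maurerCartan_equation (hA : SmoothMat s A) (hB : SmoothMat s B) (hs : IsOpen s)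
    (hq : q ∈ s) (hAB : ∀ x ∈ s, B x * A x = 1) (u v : F) :
    matDeriv (fun x => B x * matDeriv A x v) q u - matDeriv (fun x => B x * matDeriv A x u) q v +
      ((B q * matDeriv A q u) * (B q * matDeriv A q v) -
        (B q * matDeriv A q v) * (B q * matDeriv A q u)) = 0 := by
  rw [matDeriv_mul hB (hA.matDeriv hs v) hs hq, matDeriv_mul hB (hA.matDeriv hs u) hs hq,
    matDeriv_inv hA hB hs hq hAB, matDeriv_inv hA hB hs hq hAB, matDeriv_symm hA hs hq v u]
  noncomm_ring

end MatrixCalculus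

/-! ### The involution -/

section Involution

variable {n : ℕ} {A B : Matrix (Fin (n + 2)) (Fin (n + 2)) ℝ}

theorem projP_mul_refl (A : Matrix (Fin (n + 2)) (Fin (n + 2)) ℝ) :
    projP A * refl n = -(refl n * projP A) := by
  have h := refl_mul_refl n
  simp only [projP, smul_mul_assoc, mul_smul_comm, sub_mul, mul_sub, ← smul_neg, neg_sub]
  rw [mul_assoc _ (refl n) (refl n), h, mul_one, mul_assoc (refl n) A, ← mul_assoc (refl n) (refl n),
    h, one_mul]

theorem two_smul_projP_mul_refl (A : Matrix (Fin (n + 2)) (Fin (n + 2)) ℝ) :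
    (2 : ℝ) • (projP A * refl n) = A * refl n - refl n * A := by
  have h := refl_mul_refl n
  rw [projP, smul_mul_assoc, smul_smul, sub_mul, mul_assoc _ (refl n) (refl n), h, mul_one]
  norm_num

theorem projP_add (A B : Matrix (Fin (n + 2)) (Fin (n + 2)) ℝ) :
    projP (A + B) = projP A + projP B := by
  simp only [projP, mul_add, add_mul, ← smul_add]
  congr 1
  abel

theorem projP_smul (c : ℝ) (A : Matrix (Fin (n + 2)) (Fin (n + 2)) ℝ) :
    projP (c • A) = c • projP A := by
  simp only [projP, mul_smul_comm, smul_mul_assoc, ← smul_sub]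
  rw [smul_comm]

variable {F : Type*} [NormedAddCommGroup F] [NormedSpace ℝ F]
  {a b : F → Matrix (Fin (n + 2)) (Fin (n + 2)) ℝ} {s : Set F} {q : F}

theorem matDeriv_loop (ha : SmoothMat s a) (hs : IsOpen s) (hq : q ∈ s) (t : ℝ) (v : F) :
    matDeriv (fun x => projK (a x) + t • projP (a x)) q v =
      projK (matDeriv a q v) + t • projP (matDeriv a q v) := by
  ext i j
  have h1 := differentiableAt_of_contDiffOn (ha i j) hs hq
  have hc := (SmoothMat.const (s := s) (refl n)).mul ha |>.mul (SmoothMat.const (refl n))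
  have h2 := differentiableAt_of_contDiffOn (hc i j) hs hq
  have h3 := congrFun (congrFun (matDeriv_mul_const ha hs hq (refl n) (refl n) v) i) j
  simp only [matDeriv, Matrix.of_apply, projK, projP, Matrix.add_apply, Matrix.smul_apply,
    Matrix.sub_apply, smul_eq_mul] at h3 ⊢
  rw [fderiv_fun_add ((h1.fun_add h2).const_mul _) (((h1.fun_sub h2).const_mul _).const_mul _),
    fderiv_const_mul (h1.fun_add h2), fderiv_const_mul ((h1.fun_sub h2).const_mul _),
    fderiv_const_mul (h1.fun_sub h2), fderiv_fun_add h1 h2, fderiv_fun_sub h1 h2]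
  simp only [_root_.add_apply, _root_.smul_apply, _root_.sub_apply, smul_eq_mul, h3]

theorem refl_conj_bracket (A B : Matrix (Fin (n + 2)) (Fin (n + 2)) ℝ) :
    refl n * (A * B - B * A) * refl n =
      (refl n * A * refl n) * (refl n * B * refl n) -
        (refl n * B * refl n) * (refl n * A * refl n) := by
  have h := refl_mul_refl n
  have e : ∀ A B : Matrix (Fin (n + 2)) (Fin (n + 2)) ℝ, refl n * (A * B) * refl n =
      (refl n * A * refl n) * (refl n * B * refl n) := fun A B => by
    rw [show (refl n * A * refl n) * (refl n * B * refl n) =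
      refl n * A * (refl n * refl n) * B * refl n by noncomm_ring, h]
    noncomm_ring
  rw [← e, ← e]
  noncomm_ring

/-- The grading of a symmetric pair: `[𝔨, 𝔨]` and `[𝔭, 𝔭]` lie in `𝔨`, whereas `[𝔨, 𝔭]` lies in `𝔭`,
which is the content of `projP_bracket`. -/
theorem projK_bracket (A B : Matrix (Fin (n + 2)) (Fin (n + 2)) ℝ) :
    projK (A * B - B * A) = (projK A * projK B - projK B * projK A) +
      (projP A * projP B - projP B * projP A) := by
  simp only [projK, projP, refl_conj_bracket]
  generalize refl n * A * refl n = A'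
  generalize refl n * B * refl n = B'
  simp only [smul_mul_assoc, mul_smul_comm, ← smul_sub, ← smul_add, smul_smul]
  rw [show (A + A') * (B + B') - (B + B') * (A + A') + ((A - A') * (B - B') -
    (B - B') * (A - A')) = (2 : ℝ) • (A * B - B * A + (A' * B' - B' * A')) by
      rw [two_smul]; noncomm_ring, smul_smul]
  norm_num

theorem projP_bracket (A B : Matrix (Fin (n + 2)) (Fin (n + 2)) ℝ) :
    projP (A * B - B * A) = (projK A * projP B - projP B * projK A) +
      (projP A * projK B - projK B * projP A) := by
  simp only [projK, projP, refl_conj_bracket]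
  generalize refl n * A * refl n = A'
  generalize refl n * B * refl n = B'
  simp only [smul_mul_assoc, mul_smul_comm, ← smul_sub, ← smul_add, smul_smul]
  rw [show (A + A') * (B - B') - (B - B') * (A + A') + ((A - A') * (B + B') -
    (B + B') * (A - A')) = (2 : ℝ) • (A * B - B * A - (A' * B' - B' * A')) by
      rw [two_smul]; noncomm_ring, smul_smul]
  norm_num

/-- The curvature of the loop is governed by the bracket of the `𝔭`-parts. -/
theorem loop_curvature {A B dA dB : Matrix (Fin (n + 2)) (Fin (n + 2)) ℝ}
    (h : dB - dA + (A * B - B * A) = 0) (t : ℝ) :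
    (projK dB + t • projP dB) - (projK dA + t • projP dA) +
      ((projK A + t • projP A) * (projK B + t • projP B) -
        (projK B + t • projP B) * (projK A + t • projP A)) =
      (t ^ 2 - 1) • (projP A * projP B - projP B * projP A) := by
  have hd : dB - dA = -(A * B - B * A) := eq_neg_of_add_eq_zero_left h
  have hP : projP dB - projP dA = -projP (A * B - B * A) := by
    rw [sub_eq_add_neg, ← neg_one_smul ℝ (projP dA), ← projP_smul, ← projP_add,
      neg_one_smul, ← sub_eq_add_neg, hd, ← neg_one_smul ℝ, projP_smul, neg_one_smul]
  have hK : projK dB - projK dA = -projK (A * B - B * A) := by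
    have e : ∀ C : Matrix (Fin (n + 2)) (Fin (n + 2)) ℝ, projK C = C - projP C := fun C => by
      rw [projK, projP]; module
    rw [e, e, e, sub_sub_sub_comm, hP, hd]
    abel
  have e : (projK dB + t • projP dB) - (projK dA + t • projP dA) =
      (projK dB - projK dA) + t • (projP dB - projP dA) := by module
  -- The `𝔭`-component is the original equation times `t` and cancels. In the `𝔨`-component only the
  -- bracket of the `𝔭`-parts acquires `t²`, which leaves `t² - 1`.
  rw [e, hK, hP, projK_bracket, projP_bracket]
  simp only [add_mul, mul_add, smul_mul_assoc, mul_smul_comm]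
  module

end Involution

/-! ### The reflection in a Lorentzian plane -/

section Group

variable {n r : ℕ}

theorem mat_mul_mat_inv (A : G n r) : mat A * mat A⁻¹ = 1 := by
  change mat (A * A⁻¹) = 1
  rw [mul_inv_cancel]; simp [mat]

theorem mat_inv_mul_mat (A : G n r) : mat A⁻¹ * mat A = 1 :=
  mul_eq_one_comm.1 (mat_mul_mat_inv A)

theorem mat_mul (A B : G n r) : mat (A * B) = mat A * mat B := rfl

theorem ip_eq_dotProduct (x y : Fin (n + 2) → ℝ) : ip n r x y = x ⬝ᵥ (gram n r).mulVec y := by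
  simp only [ip, gram, dotProduct, Matrix.mulVec_diagonal]
  exact Finset.sum_congr rfl fun i _ => by ring

theorem transpose_mul_gram_mul (A : G n r) : (mat A).transpose * gram n r * mat A = gram n r :=
  A.2

theorem ip_mulVec (A : G n r) (x y : Fin (n + 2) → ℝ) :
    ip n r ((mat A).mulVec x) ((mat A).mulVec y) = ip n r x y := by
  rw [ip_eq_dotProduct, ip_eq_dotProduct]
  conv_rhs => rw [← transpose_mul_gram_mul A]
  rw [← Matrix.mulVec_mulVec, ← Matrix.mulVec_mulVec, Matrix.dotProduct_mulVec x,
    Matrix.vecMul_transpose]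

theorem gram_mul_gram (n r : ℕ) : gram n r * gram n r = 1 := by
  rw [gram, Matrix.diagonal_mul_diagonal, ← Matrix.diagonal_one]
  congr 1
  funext i
  rw [sgn]
  split_ifs <;> norm_num

theorem mat_inv_eq (A : G n r) : mat A⁻¹ = gram n r * (mat A).transpose * gram n r := by
  have h : gram n r * (mat A).transpose * gram n r * mat A = 1 := by
    rw [mul_assoc, mul_assoc, ← mul_assoc _ (gram n r), transpose_mul_gram_mul, gram_mul_gram]
  calc mat A⁻¹ = (gram n r * (mat A).transpose * gram n r * mat A) * mat A⁻¹ := by rw [h, one_mul]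
    _ = _ := by rw [mul_assoc _ (mat A), mat_mul_mat_inv, mul_one]

/-- The reflection in the plane of the coset of `A`. -/
def planeRefl (A : G n r) : Matrix (Fin (n + 2)) (Fin (n + 2)) ℝ := mat A * refl n * mat A⁻¹

/-- `A⁻¹ B` lies in `K` iff it commutes with `refl n`, that is, iff the two conjugates of `refl n`
agree. The quotient thus embeds into matrices, where smoothness and derivatives can be computed. -/
theorem mk_eq_mk_iff (A B : G n r) :
    (A : G n r ⧸ K n r) = B ↔ planeRefl A = planeRefl B := by
  rw [QuotientGroup.eq]
  change refl n * (mat A⁻¹ * mat B) * refl n = mat A⁻¹ * mat B ↔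
    mat A * refl n * mat A⁻¹ = mat B * refl n * mat B⁻¹
  have h := refl_mul_refl n
  have hA := mat_mul_mat_inv A
  have hA' := mat_inv_mul_mat A
  have hB := mat_mul_mat_inv B
  have hB' := mat_inv_mul_mat B
  constructor
  · intro hk
    calc mat A * refl n * mat A⁻¹ = mat A * (refl n * (mat A⁻¹ * mat B)) * mat B⁻¹ := by
          simp only [mul_assoc, hB, mul_one]
      _ = mat A * (refl n * (mat A⁻¹ * mat B) * (refl n * refl n)) * mat B⁻¹ := by rw [h, mul_one]
      _ = mat A * (refl n * (mat A⁻¹ * mat B) * refl n * refl n) * mat B⁻¹ := by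
          rw [mul_assoc (refl n * _)]
      _ = (mat A * mat A⁻¹) * mat B * refl n * mat B⁻¹ := by rw [hk]; simp only [mul_assoc]
      _ = _ := by rw [hA, one_mul]
  · intro hk
    calc refl n * (mat A⁻¹ * mat B) * refl n
        = (mat A⁻¹ * mat A) * refl n * (mat A⁻¹ * mat B) * refl n := by rw [hA', one_mul]
      _ = mat A⁻¹ * (mat A * refl n * mat A⁻¹) * mat B * refl n := by simp only [mul_assoc]
      _ = mat A⁻¹ * mat B * refl n * (mat B⁻¹ * mat B) * refl n := by
          rw [hk]; simp only [mul_assoc]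
      _ = mat A⁻¹ * mat B := by rw [hB', mul_one, mul_assoc, h, mul_one]

theorem single_mem_basePlane {i : Fin (n + 2)} (hi : i = 0 ∨ i = Fin.last (n + 1)) :
    Pi.single i 1 ∈ basePlane n := by
  change (refl n).mulVec (Pi.single i 1) = -Pi.single i 1
  ext j
  rw [refl, Matrix.mulVec_diagonal]
  by_cases hj : j = i
  · subst hj; simp [hi]
  · simp [hj]

theorem ip_single (x : Fin (n + 2) → ℝ) (i : Fin (n + 2)) :
    ip n r x (Pi.single i 1) = sgn n r i * x i := by
  rw [ip, Finset.sum_eq_single i]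
  · simp
  · intro j _ hj; simp [hj]
  · simp

theorem sgn_ne_zero (i : Fin (n + 2)) : sgn n r i ≠ 0 := by
  rw [sgn]; split_ifs <;> norm_num

variable {A : G n r} {Y Z : Fin (n + 2) → ℝ}

/-- Otherwise the plane would be totally isotropic, yet it contains the image of the first basis
vector, whose square is `1` because `r ≤ n`. -/
theorem ip_ne_zero_of_plane_eq (hrn : r ≤ n)
    (hA : (basePlane n).map (Matrix.mulVecLin (mat A)) = Submodule.span ℝ {Y, Z})
    (hY : ip n r Y Y = 0) (hZ : ip n r Z Z = 0) : ip n r Y Z ≠ 0 := by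
  intro h
  have hmem : (mat A).mulVec (Pi.single 0 1) ∈ Submodule.span ℝ {Y, Z} := by
    rw [← hA]; exact ⟨_, single_mem_basePlane (Or.inl rfl), rfl⟩
  obtain ⟨a, b, hab⟩ := Submodule.mem_span_pair.1 hmem
  have h1 := ip_mulVec A (Pi.single 0 1) (Pi.single 0 1)
  rw [← hab, ip_single] at h1
  simp [ip_add_left, ip_add_right, ip_smul_left, ip_smul_right, hY, hZ, h, ip_comm Z Y, sgn, hrn]
    at h1

theorem planeRefl_mulVec
    (hA : (basePlane n).map (Matrix.mulVecLin (mat A)) = Submodule.span ℝ {Y, Z})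
    (hY : ip n r Y Y = 0) (hZ : ip n r Z Z = 0) (hYZ : ip n r Y Z = 1) (w : Fin (n + 2) → ℝ) :
    (planeRefl A).mulVec w = w - (2 : ℝ) • (ip n r w Z • Y + ip n r w Y • Z) := by
  have hneg : ∀ v ∈ Submodule.span ℝ {Y, Z}, (planeRefl A).mulVec v = -v := by
    intro v hv
    rw [← hA] at hv
    obtain ⟨b, hb, rfl⟩ := hv
    have hb' : (refl n).mulVec b = -b := hb
    rw [Matrix.mulVecLin_apply, Matrix.mulVec_mulVec, planeRefl, mul_assoc, mat_inv_mul_mat,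
      mul_one, ← Matrix.mulVec_mulVec, hb', Matrix.mulVec_neg]
  -- If `v` is orthogonal to the plane, then `A⁻¹ v` is orthogonal to the base plane: its first and
  -- last coordinates vanish and `refl n` fixes it.
  have hpos : ∀ v, ip n r v Y = 0 → ip n r v Z = 0 → (planeRefl A).mulVec v = v := by
    intro v hvY hvZ
    have hcoord : ∀ i, (i = 0 ∨ i = Fin.last (n + 1)) → (mat A⁻¹).mulVec v i = 0 := by
      intro i hi
      have hmem : (mat A).mulVec (Pi.single i 1) ∈ Submodule.span ℝ {Y, Z} := by
        rw [← hA]; exact ⟨_, single_mem_basePlane hi, rfl⟩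
      obtain ⟨a, b, hab⟩ := Submodule.mem_span_pair.1 hmem
      have h1 := ip_mulVec A ((mat A⁻¹).mulVec v) (Pi.single i 1)
      rw [Matrix.mulVec_mulVec, mat_mul_mat_inv, Matrix.one_mulVec, ← hab, ip_single, ip_add_right,
        ip_smul_right, ip_smul_right, hvY, hvZ, mul_zero, mul_zero, add_zero] at h1
      exact (mul_eq_zero.1 h1.symm).resolve_left (sgn_ne_zero i)
    have hfix : (refl n).mulVec ((mat A⁻¹).mulVec v) = (mat A⁻¹).mulVec v := by
      ext i
      rw [refl, Matrix.mulVec_diagonal]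
      split_ifs with hi
      · rw [hcoord i hi, mul_zero]
      · rw [one_mul]
    rw [planeRefl, mul_assoc, ← Matrix.mulVec_mulVec, ← Matrix.mulVec_mulVec, hfix,
      Matrix.mulVec_mulVec, mat_mul_mat_inv, Matrix.one_mulVec]
  have hZY : ip n r Z Y = 1 := by rw [ip_comm, hYZ]
  have hv : ip n r w Z • Y + ip n r w Y • Z ∈ Submodule.span ℝ {Y, Z} :=
    Submodule.mem_span_pair.2 ⟨_, _, rfl⟩
  generalize hvd : ip n r w Z • Y + ip n r w Y • Z = v at hv
  have h1 := hpos (w - v)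
    (by rw [← hvd]; simp [ip_sub_left, ip_add_left, ip_smul_left, hY, hZY])
    (by rw [← hvd]; simp [ip_sub_left, ip_add_left, ip_smul_left, hZ, hYZ])
  rw [Matrix.mulVec_sub, hneg v hv, sub_neg_eq_add] at h1
  rw [two_smul, ← sub_sub]
  exact eq_sub_of_add_eq h1

end Group

/-! ### Reflections in vectors -/

section VectorReflection

variable {n r : ℕ}

/-- The reflection in the hyperplane orthogonal to `a`. -/
def vecRefl (n r : ℕ) (a : Fin (n + 2) → ℝ) : Matrix (Fin (n + 2)) (Fin (n + 2)) ℝ :=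
  1 - (2 / ip n r a a) • Matrix.vecMulVec a fun j => sgn n r j * a j

theorem vecRefl_mulVec (a w : Fin (n + 2) → ℝ) :
    (vecRefl n r a).mulVec w = w - (2 * ip n r w a / ip n r a a) • a := by
  ext i
  have : (fun j => sgn n r j * a j) ⬝ᵥ w = ip n r w a := by
    simp only [dotProduct, ip]
    exact Finset.sum_congr rfl fun j _ => by ring
  rw [vecRefl, Matrix.sub_mulVec, Matrix.one_mulVec, Matrix.smul_mulVec, Matrix.vecMulVec_mulVec,
    this]
  simp only [Pi.sub_apply, Pi.smul_apply, smul_eq_mul, MulOpposite.smul_eq_mul_unop,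
    MulOpposite.unop_op]
  ring

theorem ip_vecRefl_mulVec (a x y : Fin (n + 2) → ℝ) :
    ip n r ((vecRefl n r a).mulVec x) ((vecRefl n r a).mulVec y) = ip n r x y := by
  simp only [vecRefl_mulVec, ip_sub_left, ip_sub_right, ip_smul_left, ip_smul_right, ip_comm a y]
  -- For isotropic `a` the convention `2 / 0 = 0` makes the reflection the identity, so `vecReflG`
  -- is defined for every `a`.
  by_cases h : ip n r a a = 0
  · simp [h]
  · field_simp
    ring

theorem vecRefl_mul_self (a : Fin (n + 2) → ℝ) : vecRefl n r a * vecRefl n r a = 1 := by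
  refine Matrix.ext_of_mulVec_single fun i => ?_
  rw [← Matrix.mulVec_mulVec, Matrix.one_mulVec]
  generalize (Pi.single i 1 : Fin (n + 2) → ℝ) = w
  simp only [vecRefl_mulVec, ip_sub_left, ip_smul_left]
  by_cases h : ip n r a a = 0
  · simp [h]
  · rw [sub_sub, ← add_smul, sub_eq_self]
    convert zero_smul ℝ a using 2
    field_simp
    ring

/-- The reflection in the hyperplane orthogonal to `a`, as an isometry. -/
def vecReflG (n r : ℕ) (a : Fin (n + 2) → ℝ) : G n r :=
  ⟨⟨vecRefl n r a, vecRefl n r a, vecRefl_mul_self a, vecRefl_mul_self a⟩, by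
    change (vecRefl n r a).transpose * gram n r * vecRefl n r a = gram n r
    refine Matrix.ext_of_mulVec_single fun i => ?_
    refine dotProduct_eq _ _ fun w => ?_
    rw [dotProduct_comm, dotProduct_comm _ w, ← ip_eq_dotProduct, ← ip_vecRefl_mulVec a,
      ip_eq_dotProduct, ← Matrix.mulVec_mulVec, ← Matrix.mulVec_mulVec, Matrix.dotProduct_mulVec w,
      Matrix.vecMul_transpose]⟩

theorem mat_vecReflG (a : Fin (n + 2) → ℝ) : mat (vecReflG n r a) = vecRefl n r a := rfl

/-- Reflecting along `a + b` instead of `a - b` keeps the formula regular at `a = b` when `a` is not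
isotropic. The price is a sign, which does not affect planes. -/
theorem vecRefl_add_mulVec {a b : Fin (n + 2) → ℝ} (hab : ip n r a a = ip n r b b)
    (h : ip n r (a + b) (a + b) ≠ 0) : (vecRefl n r (a + b)).mulVec b = -a := by
  have h1 : 2 * ip n r b (a + b) = ip n r (a + b) (a + b) := by
    simp only [ip_add_left, ip_add_right, hab, ip_comm b a]; ring
  rw [vecRefl_mulVec, h1, div_self h, one_smul]
  abel

theorem vecRefl_mulVec_of_ip_eq_zero {a w : Fin (n + 2) → ℝ} (h : ip n r w a = 0) :
    (vecRefl n r a).mulVec w = w := by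
  rw [vecRefl_mulVec, h, mul_zero, zero_div, zero_smul, sub_zero]

theorem smoothMat_vecRefl {F : Type*} [NormedAddCommGroup F] [NormedSpace ℝ F] {s : Set F}
    {a : F → Fin (n + 2) → ℝ} (ha : ContDiffOn ℝ ∞ a s) (h : ∀ x ∈ s, ip n r (a x) (a x) ≠ 0) :
    SmoothMat s (fun x => vecRefl n r (a x)) := by
  intro i j
  have hi := fun i => contDiffOn_pi.1 ha i
  simp only [vecRefl, Matrix.sub_apply, Matrix.smul_apply, Matrix.vecMulVec_apply, smul_eq_mul]
  exact contDiffOn_const.sub ((contDiffOn_const.div (contDiffOn_ip ha ha) h).mul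
    ((hi i).mul (contDiffOn_const.mul (hi j))))

/-- The composition of two reflections moving the null pair `Y₀`, `Z₀` to `-Y`, `-Z`. -/
def planeMotion (n r : ℕ) (Y₀ Z₀ Y Z : Fin (n + 2) → ℝ) : G n r :=
  vecReflG n r (Y - Z + (vecRefl n r (Y + Z + (Y₀ + Z₀))).mulVec (Y₀ - Z₀)) *
    vecReflG n r (Y + Z + (Y₀ + Z₀))

/-- The first reflection sends `Y₀ + Z₀` to `-(Y + Z)`. The second sends the image of `Y₀ - Z₀` to
`-(Y - Z)` and leaves `Y + Z` in place. The squares are `2` and `-2` on both sides, as reflections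
require. -/
theorem planeMotion_mulVec {Y₀ Z₀ Y Z : Fin (n + 2) → ℝ} (hY₀ : ip n r Y₀ Y₀ = 0)
    (hZ₀ : ip n r Z₀ Z₀ = 0) (hYZ₀ : ip n r Y₀ Z₀ = 1) (hY : ip n r Y Y = 0)
    (hZ : ip n r Z Z = 0) (hYZ : ip n r Y Z = 1)
    (h₁ : ip n r (Y + Z + (Y₀ + Z₀)) (Y + Z + (Y₀ + Z₀)) ≠ 0)
    (h₂ : ip n r (Y - Z + (vecRefl n r (Y + Z + (Y₀ + Z₀))).mulVec (Y₀ - Z₀))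
      (Y - Z + (vecRefl n r (Y + Z + (Y₀ + Z₀))).mulVec (Y₀ - Z₀)) ≠ 0) :
    (mat (planeMotion n r Y₀ Z₀ Y Z)).mulVec Y₀ = -Y ∧
      (mat (planeMotion n r Y₀ Z₀ Y Z)).mulVec Z₀ = -Z := by
  have hZY : ip n r Z Y = 1 := by rw [ip_comm, hYZ]
  have hZY₀ : ip n r Z₀ Y₀ = 1 := by rw [ip_comm, hYZ₀]
  have e₁ : (vecRefl n r (Y + Z + (Y₀ + Z₀))).mulVec (Y₀ + Z₀) = -(Y + Z) :=
    vecRefl_add_mulVec (by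
      simp only [ip_add_left, ip_add_right, hY, hZ, hYZ, hZY, hY₀, hZ₀, hYZ₀, hZY₀]) h₁
  have e₂ := vecRefl_add_mulVec (a := Y - Z)
    (b := (vecRefl n r (Y + Z + (Y₀ + Z₀))).mulVec (Y₀ - Z₀)) (by
      rw [ip_vecRefl_mulVec]
      simp only [ip_sub_left, ip_sub_right, hY, hZ, hYZ, hZY, hY₀, hZ₀, hYZ₀, hZY₀]) h₂
  -- `Y + Z` is, up to sign, the first reflection of `Y₀ + Z₀`, which is orthogonal to `Y₀ - Z₀`; it
  -- is also orthogonal to `Y - Z`.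
  have e₃ := vecRefl_mulVec_of_ip_eq_zero (n := n) (r := r)
    (a := Y - Z + (vecRefl n r (Y + Z + (Y₀ + Z₀))).mulVec (Y₀ - Z₀)) (w := Y + Z) (by
      have : Y + Z = -(vecRefl n r (Y + Z + (Y₀ + Z₀))).mulVec (Y₀ + Z₀) := by rw [e₁, neg_neg]
      rw [ip_add_right]
      nth_rw 2 [this]
      rw [ip_neg_left, ip_vecRefl_mulVec]
      simp only [ip_sub_right, ip_add_left, hY, hZ, hYZ, hZY, hY₀, hZ₀, hYZ₀, hZY₀]
      ring)
  rw [planeMotion, mat_mul, mat_vecReflG, mat_vecReflG]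
  generalize vecRefl n r (Y + Z + (Y₀ + Z₀)) = S at *
  generalize vecRefl n r (Y - Z + S.mulVec (Y₀ - Z₀)) = T at *
  have f₁ : (T * S).mulVec (Y₀ + Z₀) = -(Y + Z) := by
    rw [← Matrix.mulVec_mulVec, e₁, Matrix.mulVec_neg, e₃]
  have f₂ : (T * S).mulVec (Y₀ - Z₀) = -(Y - Z) := by
    rw [← Matrix.mulVec_mulVec, e₂]
  rw [Matrix.mulVec_add] at f₁
  rw [Matrix.mulVec_sub] at f₂
  constructor
  · have : (2 : ℝ) • (T * S).mulVec Y₀ = (2 : ℝ) • -Y := by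
      rw [two_smul, two_smul]
      linear_combination f₁ + f₂
    exact smul_right_injective _ two_ne_zero this
  · have : (2 : ℝ) • (T * S).mulVec Z₀ = (2 : ℝ) • -Z := by
      rw [two_smul, two_smul]
      linear_combination f₁ - f₂
    exact smul_right_injective _ two_ne_zero this

end VectorReflection

/-! ### The derivative of the reflection in a moving plane -/

section MovingPlane

variable {n r : ℕ} {s : Set 𝔼} {Y Z : 𝔼 → Fin (n + 2) → ℝ} {q : 𝔼}
  {R : 𝔼 → Matrix (Fin (n + 2)) (Fin (n + 2)) ℝ}

theorem motion_smul (Y Z y z w : Fin (n + 2) → ℝ) (c : ℝ) :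
    motion n r Y Z y z (c • w) = c • motion n r Y Z y z w := by
  simp only [motion, ip_smul_left, mul_smul, smul_add]

theorem IsNullPair.contDiffOn_reflection (h : IsNullPair n r s Y Z) (w : Fin (n + 2) → ℝ) :
    ContDiffOn ℝ ∞ (fun x => w - (2 : ℝ) • (ip n r w (Z x) • Y x + ip n r w (Y x) • Z x)) s :=
  contDiffOn_const.sub (((contDiffOn_ip contDiffOn_const h.smooth_right).smul h.smooth_left).add
    ((contDiffOn_ip contDiffOn_const h.smooth_left).smul h.smooth_right) |>.const_smul 2)

theorem IsNullPair.smoothMat (h : IsNullPair n r s Y Z)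
    (hR : ∀ x ∈ s, ∀ w, (R x).mulVec w =
      w - (2 : ℝ) • (ip n r w (Z x) • Y x + ip n r w (Y x) • Z x)) : SmoothMat s R := by
  intro i j
  refine (contDiffOn_pi.1 (h.contDiffOn_reflection (Pi.single j 1)) i).congr fun x hx => ?_
  rw [← hR x hx, Matrix.mulVec_single_one]
  rfl

theorem IsNullPair.matDeriv_mulVec (h : IsNullPair n r s Y Z)
    (hR : ∀ x ∈ s, ∀ w, (R x).mulVec w =
      w - (2 : ℝ) • (ip n r w (Z x) • Y x + ip n r w (Y x) • Z x)) (hq : q ∈ s) (A : 𝔼)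
    (w : Fin (n + 2) → ℝ) : (matDeriv R q A).mulVec w =
      (-2 : ℝ) • motion n r (Y q) (Z q) (fderiv ℝ Y q A) (fderiv ℝ Z q A) w := by
  have hY := differentiableAt_of_contDiffOn h.smooth_left h.isOpen hq
  have hZ := differentiableAt_of_contDiffOn h.smooth_right h.isOpen hq
  have hwY := differentiableAt_of_contDiffOn
    (contDiffOn_ip (n := n) (r := r) (contDiffOn_const (c := w)) h.smooth_left) h.isOpen hq
  have hwZ := differentiableAt_of_contDiffOn
    (contDiffOn_ip (n := n) (r := r) (contDiffOn_const (c := w)) h.smooth_right) h.isOpen hq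
  rw [← fderiv_mulVec (h.smoothMat hR) h.isOpen hq,
    (Filter.eventuallyEq_of_mem (h.isOpen.mem_nhds hq) fun x hx => hR x hx w :
      (fun x => (R x).mulVec w) =ᶠ[nhds q] _).fderiv_eq,
    fderiv_const_sub, fderiv_fun_const_smul ((hwZ.fun_smul hY).fun_add (hwY.fun_smul hZ)),
    fderiv_fun_add (hwZ.fun_smul hY) (hwY.fun_smul hZ), fderiv_fun_smul hwZ hY,
    fderiv_fun_smul hwY hZ]
  simp only [_root_.neg_apply, _root_.smul_apply, _root_.add_apply,
    ContinuousLinearMap.smulRight_apply, fderiv_ip (differentiableAt_const w) hY,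
    fderiv_ip (differentiableAt_const w) hZ, fderiv_fun_const, motion]
  simp only [Pi.zero_apply, _root_.zero_apply, ip_zero_left, zero_add]
  module

theorem IsNullPair.matDeriv_comm_iff (h : IsNullPair n r s Y Z)
    (hR : ∀ x ∈ s, ∀ w, (R x).mulVec w =
      w - (2 : ℝ) • (ip n r w (Z x) • Y x + ip n r w (Y x) • Z x)) (hq : q ∈ s) (A B : 𝔼) :
    matDeriv R q A * matDeriv R q B = matDeriv R q B * matDeriv R q A ↔
      ∀ w, motion n r (Y q) (Z q) (fderiv ℝ Y q A) (fderiv ℝ Z q A)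
        (motion n r (Y q) (Z q) (fderiv ℝ Y q B) (fderiv ℝ Z q B) w) =
      motion n r (Y q) (Z q) (fderiv ℝ Y q B) (fderiv ℝ Z q B)
        (motion n r (Y q) (Z q) (fderiv ℝ Y q A) (fderiv ℝ Z q A) w) := by
  have key : ∀ A B w, (matDeriv R q A * matDeriv R q B).mulVec w =
      (4 : ℝ) • motion n r (Y q) (Z q) (fderiv ℝ Y q A) (fderiv ℝ Z q A)
        (motion n r (Y q) (Z q) (fderiv ℝ Y q B) (fderiv ℝ Z q B) w) := fun A B w => by
    rw [← Matrix.mulVec_mulVec, h.matDeriv_mulVec hR hq, h.matDeriv_mulVec hR hq, motion_smul,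
      smul_smul]
    norm_num
  constructor
  · intro hc w
    have := key A B w
    rw [hc, key B A w] at this
    exact (smul_right_injective _ (four_ne_zero (α := ℝ)) this).symm
  · intro hm
    refine Matrix.ext_of_mulVec_single fun i => ?_
    rw [key, key, hm]

/-- An infinitesimal motion of a plane vanishes only if the normal velocity of `Y` does. -/
theorem IsNullPair.fderiv_eq_zero (h : IsNullPair n r s Y Z)
    (hR : ∀ x ∈ s, ∀ w, (R x).mulVec w =
      w - (2 : ℝ) • (ip n r w (Z x) • Y x + ip n r w (Y x) • Z x)) (hq : q ∈ s) {A : 𝔼}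
    (hA : matDeriv R q A = 0) (hp : ∃ A, 0 < ip n r (fderiv ℝ Y q A) (fderiv ℝ Y q A))
    (hm : ∃ A, ip n r (fderiv ℝ Y q A) (fderiv ℝ Y q A) < 0) : A = 0 := by
  refine eq_zero_of_forall_ip_eq_zero (fderiv ℝ Y q : 𝔼 →ₗ[ℝ] Fin (n + 2) → ℝ) hp hm fun B => ?_
  -- The motion sends `Y` to `dY(A)` plus a multiple of `Y`, and `Y` is orthogonal to every `dY(B)`.
  have h1 := h.matDeriv_mulVec hR hq A (Y q)
  rw [hA, Matrix.zero_mulVec] at h1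
  have h2 := congrArg (fun v => ip n r v (fderiv ℝ Y q B)) h1
  have h3 := fun A => (ip_comm (Y q) _).trans (h.fderiv_left hq A)
  simp only [ip_zero_left, ip_smul_left, motion, ip_add_left, h3, h.left q hq, h.ip_eq q hq] at h2
  rw [ContinuousLinearMap.coe_coe]
  linarith

end MovingPlane

/-! ### Lifts of the same surface -/

section Lifts

variable {n r : ℕ}

/-- Near `q` write `P' = c P`, where `c` is a quotient of coordinates and hence differentiable at
`q`. The terms with `dc` vanish because `⟨P, P⟩ = ⟨dP, P⟩ = 0`, so the metric changes by the square
`c²`. -/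
theorem exists_ip_fderiv_eq {s : Set 𝔼} {P P' : 𝔼 → Fin (n + 2) → ℝ} {q : 𝔼} (hs : IsOpen s)
    (hP : ContDiffOn ℝ ∞ P s) (hP' : ContDiffOn ℝ ∞ P' s) (hq : q ∈ s)
    (hnull : ∀ x ∈ s, ip n r (P x) (P x) = 0) (hne : P q ≠ 0) (hne' : P' q ≠ 0)
    (h : ∀ x ∈ s, ∃ c : ℝ, P' x = c • P x) :
    ∃ c : ℝ, c ≠ 0 ∧ ∀ A B, ip n r (fderiv ℝ P' q A) (fderiv ℝ P' q B) =
      c ^ 2 * ip n r (fderiv ℝ P q A) (fderiv ℝ P q B) := by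
  obtain ⟨i, hi : P q i ≠ 0⟩ := Function.ne_iff.1 hne
  have hPi := contDiffOn_pi.1 hP i
  have hd : DifferentiableAt ℝ (fun x => P' x i / P x i) q := by
    simp only [div_eq_mul_inv]
    exact (differentiableAt_of_contDiffOn (contDiffOn_pi.1 hP' i) hs hq).fun_mul
      ((differentiableAt_of_contDiffOn hPi hs hq).fun_inv hi)
  have hev : ∀ᶠ x in nhds q, P' x = (P' x i / P x i) • P x := by
    filter_upwards [hs.mem_nhds hq,
      (differentiableAt_of_contDiffOn hPi hs hq).continuousAt.eventually_ne hi] with x hx hxi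
    obtain ⟨c, hc⟩ := h x hx
    have : P' x i / P x i = c := by
      rw [hc, Pi.smul_apply, smul_eq_mul, mul_div_assoc, div_self hxi, mul_one]
    rw [this, hc]
  have hfd : ∀ A, fderiv ℝ P' q A = (P' q i / P q i) • fderiv ℝ P q A +
      fderiv ℝ (fun x => P' x i / P x i) q A • P q := fun A => by
    rw [Filter.EventuallyEq.fderiv_eq hev,
      fderiv_fun_smul hd (differentiableAt_of_contDiffOn hP hs hq)]
    rfl
  refine ⟨P' q i / P q i, fun h0 => hne' ?_, fun A B => ?_⟩
  · rw [hev.self_of_nhds, h0, zero_smul]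
  · have h1 := fderiv_ip_self_eq_zero hP hs hnull hq
    have h2 := fun A => (ip_comm (P q) _).trans (h1 A)
    simp only [hfd, ip_add_left, ip_add_right, ip_smul_left, ip_smul_right, h1, h2, hnull q hq]
    ring

variable {M : Type*} [TopologicalSpace M] [ChartedSpace (EuclideanSpace ℝ (Fin 2)) M]
  {y z : M → Q n r} {U U' : Set M} {Y Y' Z : M → Fin (n + 2) → ℝ} {x : M}

theorem IsLift.mono (h : IsLift y U Y) (hU : U' ⊆ U) : IsLift y U' Y :=
  ⟨h.1.mono hU, fun x hx => h.2 x (hU hx)⟩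

theorem exists_inducedMetric_eq [IsManifold (𝓡 2) ∞ M] (hU : IsOpen U) (hU' : IsOpen U')
    (hY : IsLift y U Y) (hY' : IsLift y U' Y') (hx : x ∈ U) (hx' : x ∈ U') :
    ∃ c : ℝ, c ≠ 0 ∧ ∀ X X', inducedMetric n r Y' x X X' = c ^ 2 * inducedMetric n r Y x X X' := by
  have he := IsManifold.chart_mem_maximalAtlas (I := 𝓡 2) (n := ∞) x
  have hxe := mem_chart_source (EuclideanSpace ℝ (Fin 2)) x
  generalize chartAt (EuclideanSpace ℝ (Fin 2)) x = e at he hxe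
  have hV := hU.inter hU'
  have hxV : x ∈ U ∩ U' := ⟨hx, hx'⟩
  have hYV := hY.mono (U' := U ∩ U') Set.inter_subset_left
  have hYV' := hY'.mono (U' := U ∩ U') Set.inter_subset_right
  have hval : ∀ P : M → Fin (n + 2) → ℝ, (P ∘ e.symm) (e x) = P x := fun P => by
    rw [Function.comp_apply, e.left_inv hxe]
  obtain ⟨c, hc, h⟩ := exists_ip_fderiv_eq (n := n) (r := r) (isOpen_chartDomain (e := e) hV)
    (contDiffOn_comp_symm he hYV.1) (contDiffOn_comp_symm he hYV'.1) (mem_chartDomain hxV hxe)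
    (fun p hp => hYV.ip_self hp.2) (by rw [hval]; exact (hYV.2 x hxV).1)
    (by rw [hval]; exact (hYV'.2 x hxV).1) (fun p hp => by
      have h1 := (hYV.2 _ hp.2).2
      rw [(hYV'.2 _ hp.2).2] at h1
      have h2 : Y' (e.symm p) ∈ Submodule.span ℝ {Y (e.symm p)} := by
        rw [← h1]; exact Submodule.mem_span_singleton_self _
      obtain ⟨c, hc⟩ := Submodule.mem_span_singleton.1 h2
      exact ⟨c, hc.symm⟩)
  refine ⟨c, hc, fun X X' => ?_⟩
  rw [inducedMetric_eq he hYV.1 hV hxV hxe, inducedMetric_eq he hYV'.1 hV hxV hxe]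
  exact h _ _

theorem contMDiffOn_comp_prodMk {W : Type*} [NormedAddCommGroup W] [NormedSpace ℝ W]
    {g : (Fin (n + 2) → ℝ) × (Fin (n + 2) → ℝ) → W}
    {O : Set ((Fin (n + 2) → ℝ) × (Fin (n + 2) → ℝ))} (hg : ContDiffOn ℝ ∞ g O)
    (hY : ContMDiffOn (𝓡 2) 𝓘(ℝ, Fin (n + 2) → ℝ) ∞ Y U)
    (hZ : ContMDiffOn (𝓡 2) 𝓘(ℝ, Fin (n + 2) → ℝ) ∞ Z U) (h : ∀ x ∈ U, (Y x, Z x) ∈ O) :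
    ContMDiffOn (𝓡 2) 𝓘(ℝ, W) ∞ (fun x => g (Y x, Z x)) U :=
  hg.contMDiffOn.comp (hY.prodMk_space hZ) h

theorem isOpen_inter_prodMk {O : Set ((Fin (n + 2) → ℝ) × (Fin (n + 2) → ℝ))} (hO : IsOpen O)
    (hU : IsOpen U) (hY : ContMDiffOn (𝓡 2) 𝓘(ℝ, Fin (n + 2) → ℝ) ∞ Y U)
    (hZ : ContMDiffOn (𝓡 2) 𝓘(ℝ, Fin (n + 2) → ℝ) ∞ Z U) :
    IsOpen (U ∩ {x | (Y x, Z x) ∈ O}) :=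
  (hY.continuousOn.prodMk hZ.continuousOn).isOpen_inter_preimage hU hO

theorem IsLift.smul (h : IsLift y U Y) {c : M → ℝ}
    (hc : ContMDiffOn (𝓡 2) 𝓘(ℝ, ℝ) ∞ c U) (hc0 : ∀ x ∈ U, c x ≠ 0) :
    IsLift y U fun x => c x • Y x := by
  refine ⟨hc.smul h.1, fun x hx => ?_⟩
  obtain ⟨h1, h2⟩ := h.2 x hx
  rw [h2]
  exact ⟨smul_ne_zero (hc0 x hx) h1,
    (Submodule.span_singleton_smul_eq (IsUnit.mk0 _ (hc0 x hx)) _).symm⟩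

/-- The metric induced by `Y` at `x` is Lorentzian. -/
def IsLorentzAt (n r : ℕ) (Y : M → Fin (n + 2) → ℝ) (x : M) : Prop :=
  (∃ X, 0 < inducedMetric n r Y x X X) ∧ ∃ X, inducedMetric n r Y x X X < 0

theorem IsLorentzAt.of_isLift [IsManifold (𝓡 2) ∞ M] (hL : IsLorentzAt n r Y x) (hU : IsOpen U)
    (hU' : IsOpen U') (hY : IsLift y U Y) (hY' : IsLift y U' Y') (hx : x ∈ U) (hx' : x ∈ U') :
    IsLorentzAt n r Y' x := by
  obtain ⟨c, hc, h⟩ := exists_inducedMetric_eq hU hU' hY hY' hx hx'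
  obtain ⟨⟨X₁, hX₁⟩, X₂, hX₂⟩ := hL
  refine ⟨⟨X₁, ?_⟩, X₂, ?_⟩ <;> rw [h]
  · positivity
  · exact mul_neg_of_pos_of_neg (by positivity) hX₂

/-- `Y`, `Z` are lifts of `y`, `z` over the open set `U` with `⟨Y, Z⟩ = 1`. -/
structure IsUnitPair (y z : M → Q n r) (U : Set M) (Y Z : M → Fin (n + 2) → ℝ) : Prop where
  isOpen : IsOpen U
  left : IsLift y U Y
  right : IsLift z U Z
  ip_eq : ∀ x ∈ U, ip n r (Y x) (Z x) = 1

theorem IsUnitPair.symm (h : IsUnitPair y z U Y Z) : IsUnitPair z y U Z Y :=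
  ⟨h.isOpen, h.right, h.left, fun x hx => by rw [ip_comm, h.ip_eq x hx]⟩

theorem IsUnitPair.isNullPair (h : IsUnitPair y z U Y Z)
    {e : OpenPartialHomeomorph M (EuclideanSpace ℝ (Fin 2))}
    (he : e ∈ IsManifold.maximalAtlas (𝓡 2) ∞ M) :
    IsNullPair n r (chartDomain e U) (Y ∘ e.symm) (Z ∘ e.symm) :=
  ⟨contDiffOn_comp_symm he h.left.1, contDiffOn_comp_symm he h.right.1,
    isOpen_chartDomain h.isOpen, fun _ hx => h.left.ip_self hx.2, fun _ hx => h.right.ip_self hx.2,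
    fun _ hx => h.ip_eq _ hx.2⟩

theorem isUnitPair_of_ip_ne_zero (hU : IsOpen U) (hY : IsLift y U Y) (hZ : IsLift z U Z)
    (h : ∀ x ∈ U, ip n r (Y x) (Z x) ≠ 0) :
    IsUnitPair y z U Y (fun x => (ip n r (Y x) (Z x))⁻¹ • Z x) := by
  refine ⟨hU, hY, hZ.smul ?_ fun x hx => inv_ne_zero (h x hx), fun x hx => ?_⟩
  · exact contMDiffOn_comp_prodMk (O := {p | ip n r p.1 p.2 ≠ 0})
      (g := fun p => (ip n r p.1 p.2)⁻¹)
      ((contDiffOn_ip contDiffOn_fst contDiffOn_snd).inv fun p hp => hp) hY.1 hZ.1 h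
  · rw [ip_smul_right, inv_mul_cancel₀ (h x hx)]

variable {f : M → G n r ⧸ K n r}

theorem IsWedge.plane_eq (hf : IsWedge f y z) (hY : IsLift y U Y) (hZ : IsLift z U Z)
    (hx : x ∈ U) : plane (f x) = Submodule.span ℝ {Y x, Z x} := by
  rw [hf x, (hY.2 x hx).2, (hZ.2 x hx).2, Submodule.span_insert]

theorem IsWedge.map_basePlane_eq (hf : IsWedge f y z) (hY : IsLift y U Y) (hZ : IsLift z U Z)
    (hx : x ∈ U) {A : G n r} (hA : (A : G n r ⧸ K n r) = f x) :
    (basePlane n).map (Matrix.mulVecLin (mat A)) = Submodule.span ℝ {Y x, Z x} := by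
  rw [← hf.plane_eq hY hZ hx, ← hA]
  rfl

theorem exists_isUnitPair [IsManifold (𝓡 2) ∞ M] (hrn : r ≤ n) (hf : IsWedge f y z)
    (hy : IsTimelikeImmersion y) (hz : IsTimelikeImmersion z) (p : M) :
    ∃ U Y Z, p ∈ U ∧ IsUnitPair y z U Y Z ∧
      ∀ x ∈ U, IsLorentzAt n r Y x ∧ IsLorentzAt n r Z x := by
  obtain ⟨U₁, hU₁, hp₁, Y, hY, hLY⟩ := hy p
  obtain ⟨U₂, hU₂, hp₂, Z, hZ, hLZ⟩ := hz p
  have hYV := hY.mono (U' := U₁ ∩ U₂) Set.inter_subset_left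
  have hZV := hZ.mono (U' := U₁ ∩ U₂) Set.inter_subset_right
  have hpair := isUnitPair_of_ip_ne_zero (hU₁.inter hU₂) hYV hZV fun x hx => by
    obtain ⟨A, hA⟩ := QuotientGroup.mk_surjective (f x)
    exact ip_ne_zero_of_plane_eq hrn (hf.map_basePlane_eq hYV hZV hx hA) (hYV.ip_self hx)
      (hZV.ip_self hx)
  exact ⟨U₁ ∩ U₂, Y, _, ⟨hp₁, hp₂⟩, hpair, fun x hx => ⟨hLY x hx.1,
    IsLorentzAt.of_isLift (hLZ x hx.2) hU₂ hpair.isOpen hZ hpair.right hx.2 hx⟩⟩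

end Lifts

/-! ### The reflection field of a map into the symmetric space -/

section ReflectionField

variable {M : Type*} {n r : ℕ} {f : M → G n r ⧸ K n r} {y z : M → Q n r} {U : Set M}
  {Y Z : M → Fin (n + 2) → ℝ}
  {x : M}

/-- The reflection in the plane `f x`. -/
def reflField (f : M → G n r ⧸ K n r) (x : M) : Matrix (Fin (n + 2)) (Fin (n + 2)) ℝ :=
  planeRefl (f x).out

theorem reflField_eq {A : G n r} (hA : (A : G n r ⧸ K n r) = f x) :
    reflField f x = planeRefl A :=
  (mk_eq_mk_iff _ _).1 (by rw [QuotientGroup.out_eq', hA])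

variable [TopologicalSpace M] [ChartedSpace (EuclideanSpace ℝ (Fin 2)) M]
  {e : OpenPartialHomeomorph M (EuclideanSpace ℝ (Fin 2))}

theorem IsWedge.reflField_mulVec (hf : IsWedge f y z) (h : IsUnitPair y z U Y Z) (hx : x ∈ U)
    (w : Fin (n + 2) → ℝ) : (reflField f x).mulVec w =
      w - (2 : ℝ) • (ip n r w (Z x) • Y x + ip n r w (Y x) • Z x) :=
  planeRefl_mulVec (hf.map_basePlane_eq h.left h.right hx (QuotientGroup.out_eq' _))
    (h.left.ip_self hx) (h.right.ip_self hx) (h.ip_eq x hx) w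

theorem IsWedge.contMDiffOn_reflField (hf : IsWedge f y z) (h : IsUnitPair y z U Y Z)
    (i j : Fin (n + 2)) : ContMDiffOn (𝓡 2) 𝓘(ℝ, ℝ) ∞ (fun p => reflField f p i j) U := by
  have hg : ContDiffOn ℝ ∞ (fun p : (Fin (n + 2) → ℝ) × (Fin (n + 2) → ℝ) =>
      (Pi.single j 1 - (2 : ℝ) • (ip n r (Pi.single j 1) p.2 • p.1 +
        ip n r (Pi.single j 1) p.1 • p.2) : Fin (n + 2) → ℝ) i) Set.univ :=
    contDiffOn_pi.1 (contDiffOn_const.sub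
      (((contDiffOn_ip contDiffOn_const contDiffOn_snd).smul contDiffOn_fst).add
        ((contDiffOn_ip contDiffOn_const contDiffOn_fst).smul contDiffOn_snd) |>.const_smul 2)) i
  refine (contMDiffOn_comp_prodMk hg h.left.1 h.right.1 fun _ _ => Set.mem_univ _).congr
    fun p hp => ?_
  rw [← hf.reflField_mulVec h hp, Matrix.mulVec_single_one]
  rfl

/-- The entries of the reflection field are smooth. -/
def HasSmoothRefl (f : M → G n r ⧸ K n r) : Prop :=
  ∀ i j, ContMDiffOn (𝓡 2) 𝓘(ℝ, ℝ) ∞ (fun p => reflField f p i j) Set.univ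

theorem hasSmoothRefl [IsManifold (𝓡 2) ∞ M] (hrn : r ≤ n) (hf : IsWedge f y z)
    (hy : IsTimelikeImmersion y) (hz : IsTimelikeImmersion z) : HasSmoothRefl f := by
  intro i j p _
  obtain ⟨U, Y, Z, hp, h, -⟩ := exists_isUnitPair hrn hf hy hz p
  exact ((hf.contMDiffOn_reflField h i j).contMDiffAt (h.isOpen.mem_nhds hp)).contMDiffWithinAt

/-- The derivative of the reflection field. -/
def reflDeriv (f : M → G n r ⧸ K n r) (x : M) (X : TangentSpace (𝓡 2) x) :
    Matrix (Fin (n + 2)) (Fin (n + 2)) ℝ :=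
  Matrix.of fun i j => mfderiv (𝓡 2) 𝓘(ℝ, ℝ) (fun p => reflField f p i j) x X

theorem HasSmoothRefl.reflDeriv_eq (hR : HasSmoothRefl f)
    (he : e ∈ IsManifold.maximalAtlas (𝓡 2) ∞ M) (hxe : x ∈ e.source)
    (X : TangentSpace (𝓡 2) x) : reflDeriv f x X =
      matDeriv (fun q => reflField f (e.symm q)) (e x) (mfderiv (𝓡 2) (𝓡 2) e x X : 𝔼) := by
  ext i j
  exact mfderiv_eq_fderiv_comp_symm he (hR i j) isOpen_univ (Set.mem_univ x) hxe X

/-- The derivatives of the reflection field commute at `x`. -/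
def ReflDerivCommute (f : M → G n r ⧸ K n r) (x : M) : Prop :=
  ∀ X X', reflDeriv f x X * reflDeriv f x X' = reflDeriv f x X' * reflDeriv f x X

theorem matDeriv_comm_of_coord {m : ℕ} {R : 𝔼 → Matrix (Fin m) (Fin m) ℝ} {q : 𝔼}
    (h : matDeriv R q (EuclideanSpace.single 0 1) * matDeriv R q (EuclideanSpace.single 1 1) =
      matDeriv R q (EuclideanSpace.single 1 1) * matDeriv R q (EuclideanSpace.single 0 1))
    (A B : 𝔼) : matDeriv R q A * matDeriv R q B = matDeriv R q B * matDeriv R q A := by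
  have key : ∀ A : 𝔼, matDeriv R q A = A 0 • matDeriv R q (EuclideanSpace.single 0 1) +
      A 1 • matDeriv R q (EuclideanSpace.single 1 1) := fun A => by
    ext i j
    simp only [matDeriv, Matrix.of_apply, Matrix.add_apply, Matrix.smul_apply]
    rw [← map_smul, ← map_smul, ← map_add, ← eq_sum_single]
  rw [key A, key B]
  simp only [add_mul, mul_add, smul_mul_assoc, mul_smul_comm, h]
  module

theorem HasSmoothRefl.commute_iff_coord (hR : HasSmoothRefl f)
    (he : e ∈ IsManifold.maximalAtlas (𝓡 2) ∞ M) (hxe : x ∈ e.source) :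
    ReflDerivCommute f x ↔
      matDeriv (fun q => reflField f (e.symm q)) (e x) (EuclideanSpace.single 0 1) *
        matDeriv (fun q => reflField f (e.symm q)) (e x) (EuclideanSpace.single 1 1) =
      matDeriv (fun q => reflField f (e.symm q)) (e x) (EuclideanSpace.single 1 1) *
        matDeriv (fun q => reflField f (e.symm q)) (e x) (EuclideanSpace.single 0 1) := by
  constructor
  · intro h
    obtain ⟨X, hX⟩ := exists_mfderiv_chart_eq he hxe (EuclideanSpace.single 0 1)
    obtain ⟨X', hX'⟩ := exists_mfderiv_chart_eq he hxe (EuclideanSpace.single 1 1)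
    have := h X X'
    rwa [hR.reflDeriv_eq he hxe, hR.reflDeriv_eq he hxe, hX, hX'] at this
  · intro h X X'
    rw [hR.reflDeriv_eq he hxe, hR.reflDeriv_eq he hxe]
    exact matDeriv_comm_of_coord h _ _

theorem IsWedge.motionsCommute (hf : IsWedge f y z) (hR : HasSmoothRefl f)
    (hc : ∀ x, ReflDerivCommute f x) (h : IsUnitPair y z U Y Z)
    (he : e ∈ IsManifold.maximalAtlas (𝓡 2) ∞ M) :
    MotionsCommute n r (chartDomain e U) (Y ∘ e.symm) (Z ∘ e.symm) := by
  intro q hq A B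
  refine ((h.isNullPair he).matDeriv_comm_iff (R := fun q => reflField f (e.symm q))
    (fun p hp => hf.reflField_mulVec h hp.2) hq A B).1 ?_
  have := (hR.commute_iff_coord he (e.map_target hq.1)).1 (hc (e.symm q))
  rw [e.right_inv hq.1] at this
  exact matDeriv_comm_of_coord this A B

end ReflectionField

/-! ### Frames -/

section Frames

theorem SmoothMat.transpose {m : ℕ} {F : Type*} [NormedAddCommGroup F] [NormedSpace ℝ F]
    {A : F → Matrix (Fin m) (Fin m) ℝ} {s : Set F} (hA : SmoothMat s A) :
    SmoothMat s fun x => (A x).transpose := fun i j => hA j i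

/-- With `a = A⁻¹ dA` and `ρ = refl n`, `d(A ρ A⁻¹) = A [a, ρ] A⁻¹`; the commutator with `ρ` sees
only the `𝔭`-part of `a`. -/
theorem matDeriv_conj {n : ℕ} {F : Type*} [NormedAddCommGroup F] [NormedSpace ℝ F]
    {A B : F → Matrix (Fin (n + 2)) (Fin (n + 2)) ℝ} {s : Set F} {q : F}
    (hA : SmoothMat s A) (hB : SmoothMat s B) (hs : IsOpen s)
    (hq : q ∈ s) (hAB : ∀ x ∈ s, B x * A x = 1) (v : F) :
    matDeriv (fun x => A x * refl n * B x) q v =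
      (2 : ℝ) • (A q * (projP (B q * matDeriv A q v) * refl n) * B q) := by
  have hAB' : A q * B q = 1 := mul_eq_one_comm.1 (hAB q hq)
  rw [matDeriv_mul (hA.mul (SmoothMat.const _)) hB hs hq, matDeriv_mul hA (SmoothMat.const _) hs hq,
    matDeriv_const, matDeriv_inv hA hB hs hq hAB, ← smul_mul_assoc, ← mul_smul_comm,
    two_smul_projP_mul_refl, mul_sub, sub_mul, ← mul_assoc (A q), ← mul_assoc (A q), hAB', one_mul]
  simp only [mul_zero, add_zero, mul_neg, mul_assoc]
  abel

/-- The commutator of the derivatives of a conjugate of the reflection. -/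
theorem conj_comm_iff {n : ℕ} {A B : Matrix (Fin (n + 2)) (Fin (n + 2)) ℝ} (hAB : B * A = 1)
    (a b : Matrix (Fin (n + 2)) (Fin (n + 2)) ℝ) :
    ((2 : ℝ) • (A * (projP a * refl n) * B)) * ((2 : ℝ) • (A * (projP b * refl n) * B)) =
      ((2 : ℝ) • (A * (projP b * refl n) * B)) * ((2 : ℝ) • (A * (projP a * refl n) * B)) ↔
    projP a * projP b = projP b * projP a := by
  have hAB' : A * B = 1 := mul_eq_one_comm.1 hAB
  -- Moving `refl n` past the second `𝔭`-part changes the sign and cancels the other `refl n`; hence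
  -- `-4`.
  have key : ∀ a b : Matrix (Fin (n + 2)) (Fin (n + 2)) ℝ,
      ((2 : ℝ) • (A * (projP a * refl n) * B)) * ((2 : ℝ) • (A * (projP b * refl n) * B)) =
        (-4 : ℝ) • (A * (projP a * projP b) * B) := fun a b => by
    calc _ = (4 : ℝ) • (A * (projP a * refl n) * (B * A) * (projP b * refl n) * B) := by
          rw [smul_mul_assoc, mul_smul_comm, smul_smul]
          norm_num [mul_assoc]
      _ = (4 : ℝ) • (A * (projP a * (refl n * (projP b * refl n))) * B) := by
          rw [hAB, mul_one]; simp only [mul_assoc]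
      _ = _ := by
          rw [projP_mul_refl, mul_neg, ← mul_assoc (refl n), refl_mul_refl, one_mul, mul_neg,
            mul_neg, neg_mul, smul_neg, neg_smul]
  rw [key, key]
  constructor
  · intro h
    have h1 := smul_right_injective _ (show (-4 : ℝ) ≠ 0 by norm_num) h
    calc projP a * projP b = (B * A) * (projP a * projP b) * (B * A) := by rw [hAB]; simp
      _ = B * (A * (projP a * projP b) * B) * A := by simp only [mul_assoc]
      _ = (B * A) * (projP b * projP a) * (B * A) := by
          rw [show A * (projP a * projP b) * B = A * (projP b * projP a) * B from h1]
          simp only [mul_assoc]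
      _ = _ := by rw [hAB]; simp
  · intro h
    rw [h]

variable {M : Type*} [TopologicalSpace M] [ChartedSpace (EuclideanSpace ℝ (Fin 2)) M]
  {n r : ℕ} {f : M → G n r ⧸ K n r} {F : M → G n r} {U : Set M}
  {x : M} {e : OpenPartialHomeomorph M (EuclideanSpace ℝ (Fin 2))}

theorem IsFrame.smoothMat (hF : IsFrame f U F) (he : e ∈ IsManifold.maximalAtlas (𝓡 2) ∞ M) :
    SmoothMat (chartDomain e U) fun q => mat (F (e.symm q)) :=
  fun i j => contDiffOn_comp_symm he (hF.2.1 i j)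

theorem IsFrame.smoothMat_inv (hF : IsFrame f U F)
    (he : e ∈ IsManifold.maximalAtlas (𝓡 2) ∞ M) :
    SmoothMat (chartDomain e U) fun q => mat (F (e.symm q))⁻¹ :=
  ((SmoothMat.const (gram n r)).mul (hF.smoothMat he).transpose).mul
    (SmoothMat.const (gram n r)) |>.congr fun _ _ => mat_inv_eq _

theorem IsFrame.matDeriv_reflField (hF : IsFrame f U F)
    (he : e ∈ IsManifold.maximalAtlas (𝓡 2) ∞ M) (hx : x ∈ U) (hxe : x ∈ e.source) (v : 𝔼) :
    matDeriv (fun q => reflField f (e.symm q)) (e x) v =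
      (2 : ℝ) • (mat (F x) * (projP (mat (F x)⁻¹ *
        matDeriv (fun q => mat (F (e.symm q))) (e x) v) * refl n) * mat (F x)⁻¹) := by
  have hs := isOpen_chartDomain (e := e) hF.1
  have hq := mem_chartDomain hx hxe
  rw [matDeriv_congr hs (fun q hq => reflField_eq (hF.2.2 _ hq.2)) hq]
  have := matDeriv_conj (hF.smoothMat he) (hF.smoothMat_inv he) hs hq
    (fun q _ => mat_inv_mul_mat _) v
  rw [e.left_inv hxe] at this
  exact this

theorem IsFrame.maurerCartan_eq (hF : IsFrame f U F)
    (he : e ∈ IsManifold.maximalAtlas (𝓡 2) ∞ M) (hx : x ∈ U) (hxe : x ∈ e.source)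
    (X : TangentSpace (𝓡 2) x) : maurerCartan F x X = mat (F x)⁻¹ *
      matDeriv (fun q => mat (F (e.symm q))) (e x) (mfderiv (𝓡 2) (𝓡 2) e x X : 𝔼) := by
  rw [maurerCartan]
  congr 1
  ext i j
  exact mfderiv_eq_fderiv_comp_symm he (hF.2.1 i j) hF.1 hx hxe X

theorem IsFrame.reflDeriv_eq [IsManifold (𝓡 2) ∞ M] (hF : IsFrame f U F)
    (hR : HasSmoothRefl f) (hx : x ∈ U)
    (X : TangentSpace (𝓡 2) x) : reflDeriv f x X =
      (2 : ℝ) • (mat (F x) * (projP (maurerCartan F x X) * refl n) * mat (F x)⁻¹) := by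
  have he := IsManifold.chart_mem_maximalAtlas (I := 𝓡 2) (n := ∞) x
  have hxe := mem_chart_source (EuclideanSpace ℝ (Fin 2)) x
  rw [hR.reflDeriv_eq he hxe, hF.maurerCartan_eq he hx hxe]
  exact hF.matDeriv_reflField he hx hxe _

theorem IsFrame.commute_iff [IsManifold (𝓡 2) ∞ M] (hF : IsFrame f U F)
    (hR : HasSmoothRefl f) (hx : x ∈ U) :
    ReflDerivCommute f x ↔ ∀ X X', projP (maurerCartan F x X) * projP (maurerCartan F x X') =
      projP (maurerCartan F x X') * projP (maurerCartan F x X) := by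
  simp only [ReflDerivCommute, hF.reflDeriv_eq hR hx, conj_comm_iff (mat_inv_mul_mat (F x))]

theorem IsFrame.loop_eq (hF : IsFrame f U F) (he : e ∈ IsManifold.maximalAtlas (𝓡 2) ∞ M)
    (hx : x ∈ U) (hxe : x ∈ e.source) (t : ℝ) {p₀ p₁ : Matrix (Fin (n + 2)) (Fin (n + 2)) ℝ}
    (hp₀ : p₀ = projP (mat (F x)⁻¹ * coordDerivMat e 0 (fun p => mat (F p)) x))
    (hp₁ : p₁ = projP (mat (F x)⁻¹ * coordDerivMat e 1 (fun p => mat (F p)) x)) :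
    coordDerivMat e 0 (loopCoeff F t e 1) x - coordDerivMat e 1 (loopCoeff F t e 0) x +
      (loopCoeff F t e 0 x * loopCoeff F t e 1 x - loopCoeff F t e 1 x * loopCoeff F t e 0 x) =
    (t ^ 2 - 1) • (p₀ * p₁ - p₁ * p₀) := by
  have hs := isOpen_chartDomain (e := e) hF.1
  have hq := mem_chartDomain hx hxe
  have ha := fun k : Fin 2 => (hF.smoothMat_inv he).mul
    ((hF.smoothMat he).matDeriv hs (EuclideanSpace.single k 1))
  have hd : ∀ j k : Fin 2, coordDerivMat e j (loopCoeff F t e k) x =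
      projK (matDeriv (fun q => mat (F (e.symm q))⁻¹ * matDeriv (fun q => mat (F (e.symm q))) q
        (EuclideanSpace.single k 1)) (e x) (EuclideanSpace.single j 1)) +
      t • projP (matDeriv (fun q => mat (F (e.symm q))⁻¹ * matDeriv (fun q => mat (F (e.symm q))) q
        (EuclideanSpace.single k 1)) (e x) (EuclideanSpace.single j 1)) := fun j k => by
    rw [← matDeriv_loop (ha k) hs hq]
    change matDeriv (fun q => loopCoeff F t e k (e.symm q)) _ _ = _
    refine matDeriv_congr hs (fun q hq => ?_) hq _
    have : coordDerivMat e k (fun p => mat (F p)) (e.symm q) =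
        matDeriv (fun q => mat (F (e.symm q))) (e (e.symm q)) (EuclideanSpace.single k 1) := rfl
    rw [loopCoeff, this, e.right_inv hq.1]
  have hmc := maurerCartan_equation (hF.smoothMat he) (hF.smoothMat_inv he) hs hq
    (fun q _ => mat_inv_mul_mat _) (EuclideanSpace.single 0 1) (EuclideanSpace.single 1 1)
  have := loop_curvature hmc t
  rw [e.left_inv hxe] at this
  rw [hd, hd, hp₀, hp₁]
  exact this

theorem IsFrame.commute_iff_coord (hF : IsFrame f U F) (hR : HasSmoothRefl f)
    (he : e ∈ IsManifold.maximalAtlas (𝓡 2) ∞ M) (hx : x ∈ U) (hxe : x ∈ e.source)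
    {p₀ p₁ : Matrix (Fin (n + 2)) (Fin (n + 2)) ℝ}
    (hp₀ : p₀ = projP (mat (F x)⁻¹ * coordDerivMat e 0 (fun p => mat (F p)) x))
    (hp₁ : p₁ = projP (mat (F x)⁻¹ * coordDerivMat e 1 (fun p => mat (F p)) x)) :
    ReflDerivCommute f x ↔ p₀ * p₁ = p₁ * p₀ := by
  rw [hR.commute_iff_coord he hxe, hF.matDeriv_reflField he hx hxe,
    hF.matDeriv_reflField he hx hxe, conj_comm_iff (mat_inv_mul_mat (F x)), hp₀, hp₁]
  rfl

theorem IsFrame.isFlatLoop_iff [IsManifold (𝓡 2) ∞ M] (hF : IsFrame f U F) (hR : HasSmoothRefl f) :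
    IsFlatLoop U F ↔ ∀ x ∈ U, ReflDerivCommute f x := by
  constructor
  · intro h x hx
    have he := IsManifold.chart_mem_maximalAtlas (I := 𝓡 2) (n := ∞) x
    have hxe := mem_chart_source (EuclideanSpace ℝ (Fin 2)) x
    -- The value `λ = 0` suffices, since `λ² - 1` is then nonzero.
    have h0 := h 0 _ he x ⟨hx, hxe⟩
    rw [hF.loop_eq he hx hxe 0 rfl rfl] at h0
    rw [hF.commute_iff_coord hR he hx hxe rfl rfl]
    refine sub_eq_zero.1 ((smul_eq_zero.1 h0).resolve_left (by norm_num))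
  · intro h t e he x hx
    rw [hF.loop_eq he hx.1 hx.2 t rfl rfl,
      (hF.commute_iff_coord hR he hx.1 hx.2 rfl rfl).1 (h x hx.1), sub_self, smul_zero]

end Frames

/-! ### Existence of frames -/

section FrameExistence

variable {n r : ℕ} {M : Type*} [TopologicalSpace M]
  [ChartedSpace (EuclideanSpace ℝ (Fin 2)) M] {f : M → G n r ⧸ K n r} {y z : M → Q n r}
  {U : Set M} {Y Z : M → Fin (n + 2) → ℝ} {p : M}

/-- The motion of a null pair into nearby null pairs depends smoothly on the latter. -/
theorem exists_smoothMat_planeMotion {Y₀ Z₀ : Fin (n + 2) → ℝ} (hY₀ : ip n r Y₀ Y₀ = 0)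
    (hZ₀ : ip n r Z₀ Z₀ = 0) (hYZ₀ : ip n r Y₀ Z₀ = 1) :
    ∃ O : Set ((Fin (n + 2) → ℝ) × (Fin (n + 2) → ℝ)), IsOpen O ∧ (Y₀, Z₀) ∈ O ∧
      SmoothMat O (fun q => mat (planeMotion n r Y₀ Z₀ q.1 q.2)) ∧
      ∀ q ∈ O, ip n r q.1 q.1 = 0 → ip n r q.2 q.2 = 0 → ip n r q.1 q.2 = 1 →
        (mat (planeMotion n r Y₀ Z₀ q.1 q.2)).mulVec Y₀ = -q.1 ∧
        (mat (planeMotion n r Y₀ Z₀ q.1 q.2)).mulVec Z₀ = -q.2 := by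
  have ha : ContDiff ℝ ∞ fun q : (Fin (n + 2) → ℝ) × (Fin (n + 2) → ℝ) =>
      q.1 + q.2 + (Y₀ + Z₀) := (contDiff_fst.add contDiff_snd).add contDiff_const
  obtain ⟨a, had⟩ : ∃ a, a = fun q : (Fin (n + 2) → ℝ) × (Fin (n + 2) → ℝ) =>
      q.1 + q.2 + (Y₀ + Z₀) := ⟨_, rfl⟩
  obtain ⟨b, hbd⟩ : ∃ b, b = fun q : (Fin (n + 2) → ℝ) × (Fin (n + 2) → ℝ) =>
      q.1 - q.2 + (vecRefl n r (a q)).mulVec (Y₀ - Z₀) := ⟨_, rfl⟩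
  rw [← had] at ha
  have haa := contDiffOn_ip (n := n) (r := r) ha.contDiffOn ha.contDiffOn (s := Set.univ)
  have hO₁ : IsOpen {q | ip n r (a q) (a q) ≠ 0} := by
    simpa using haa.continuousOn.isOpen_inter_preimage isOpen_univ isOpen_ne (t := {x : ℝ | x ≠ 0})
  have hb : ContDiffOn ℝ ∞ b {q | ip n r (a q) (a q) ≠ 0} := by
    rw [hbd]
    simp only [vecRefl_mulVec]
    exact (contDiff_fst.sub contDiff_snd).contDiffOn.add (contDiffOn_const.sub
      (((contDiffOn_const.mul (contDiffOn_ip contDiffOn_const ha.contDiffOn)).div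
        (haa.mono (Set.subset_univ _)) fun q hq => hq).smul ha.contDiffOn))
  have hO : IsOpen ({q | ip n r (a q) (a q) ≠ 0} ∩ {q | ip n r (b q) (b q) ≠ 0}) :=
    (contDiffOn_ip hb hb).continuousOn.isOpen_inter_preimage hO₁ isOpen_ne
  have hZY₀ : ip n r Z₀ Y₀ = 1 := by rw [ip_comm, hYZ₀]
  -- At the base pair the two reflecting vectors are `2 (Y₀ + Z₀)` and `2 (Y₀ - Z₀)`, with squares
  -- `8` and `-8`; being non-isotropic is an open condition.
  refine ⟨_, hO, ⟨?_, ?_⟩, ?_, ?_⟩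
  · simp only [Set.mem_ofPred_eq, had, ip_add_left, ip_add_right, hY₀, hZ₀, hYZ₀, hZY₀]
    norm_num
  · have : b (Y₀, Z₀) = (2 : ℝ) • (Y₀ - Z₀) := by
      rw [hbd]
      simp only [had]
      rw [vecRefl_mulVec_of_ip_eq_zero, two_smul]
      simp [ip_sub_left, ip_add_right, hY₀, hZ₀, hYZ₀, hZY₀]
    simp only [Set.mem_ofPred_eq, this, ip_smul_left, ip_smul_right, ip_sub_left, ip_sub_right, hY₀,
      hZ₀, hYZ₀, hZY₀]
    norm_num
  · have h1 := smoothMat_vecRefl (n := n) (r := r) (hb.mono Set.inter_subset_left)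
      fun q (hq : q ∈ {q | ip n r (a q) (a q) ≠ 0} ∩ {q | ip n r (b q) (b q) ≠ 0}) => hq.2
    have h2 := smoothMat_vecRefl (n := n) (r := r) ha.contDiffOn
      fun q (hq : q ∈ {q | ip n r (a q) (a q) ≠ 0} ∩ {q | ip n r (b q) (b q) ≠ 0}) => hq.1
    refine (h1.mul h2).congr fun q _ => ?_
    rw [hbd, had]
    rfl
  · intro q hq h1 h2 h3
    refine planeMotion_mulVec hY₀ hZ₀ hYZ₀ h1 h2 h3 ?_ ?_
    · have := hq.1
      rwa [Set.mem_ofPred_eq, had] at this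
    · have := hq.2
      rwa [Set.mem_ofPred_eq, hbd, had] at this

/-- Move one representative over `p` by the plane motions from `Y p`, `Z p` to nearby pairs. They
end at `-Y`, `-Z`, which have the same reflection and hence the same coset. -/
theorem IsWedge.exists_isFrame (hf : IsWedge f y z) (h : IsUnitPair y z U Y Z) (hp : p ∈ U) :
    ∃ V F, p ∈ V ∧ IsFrame f V F := by
  obtain ⟨O, hO, hpO, hsm, hmv⟩ := exists_smoothMat_planeMotion (h.left.ip_self hp)
    (h.right.ip_self hp) (h.ip_eq p hp)
  have hC : SmoothMat O fun q => mat (planeMotion n r (Y p) (Z p) q.1 q.2) * mat (f p).out :=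
    hsm.mul (SmoothMat.const _)
  refine ⟨U ∩ {x | (Y x, Z x) ∈ O}, fun x => planeMotion n r (Y p) (Z p) (Y x) (Z x) * (f p).out,
    ⟨hp, hpO⟩, isOpen_inter_prodMk hO h.isOpen h.left.1 h.right.1, fun i j => ?_, ?_⟩
  · exact contMDiffOn_comp_prodMk (hC i j) (h.left.1.mono Set.inter_subset_left)
      (h.right.1.mono Set.inter_subset_left) fun x hx => hx.2
  · intro x hx
    have hx0 := h.left.ip_self hx.1
    have hx1 := h.right.ip_self hx.1
    have hx2 := h.ip_eq x hx.1
    obtain ⟨m₁, m₂⟩ := hmv _ hx.2 hx0 hx1 hx2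
    have hplane : (basePlane n).map (Matrix.mulVecLin
        (mat (planeMotion n r (Y p) (Z p) (Y x) (Z x) * (f p).out))) =
        Submodule.span ℝ {-Y x, -Z x} := by
      rw [mat_mul, Matrix.mulVecLin_mul, Submodule.map_comp,
        hf.map_basePlane_eq h.left h.right hp (QuotientGroup.out_eq' _), Submodule.map_span,
        Set.image_pair, Matrix.mulVecLin_apply, Matrix.mulVecLin_apply, m₁, m₂]
    rw [← QuotientGroup.out_eq' (f x), mk_eq_mk_iff]
    refine Matrix.ext_of_mulVec_single fun i => ?_
    rw [planeRefl_mulVec hplane (by rw [ip_neg_left, ip_neg_right, hx0]; simp)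
        (by rw [ip_neg_left, ip_neg_right, hx1]; simp)
        (by rw [ip_neg_left, ip_neg_right, hx2]; simp),
      planeRefl_mulVec (hf.map_basePlane_eq h.left h.right hx.1 (QuotientGroup.out_eq' _)) hx0 hx1
        hx2]
    simp only [ip_neg_right, neg_smul, smul_neg, neg_neg]

end FrameExistence

/-! ### Curved flats -/

section CurvedFlat

attribute [local instance] LieRing.ofAssociativeRing

variable {n r : ℕ}

/-- `refl n` is symmetric and commutes with the Gram matrix, so conjugation by it preserves
skew-adjointness. -/
theorem projP_mem_skewAdjoint {a : Matrix (Fin (n + 2)) (Fin (n + 2)) ℝ}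
    (ha : a.transpose * gram n r + gram n r * a = 0) :
    projP a ∈ skewAdjointMatricesLieSubalgebra (gram n r) := by
  rw [mem_skewAdjointMatricesLieSubalgebra, mem_skewAdjointMatricesSubmodule]
  have hc : refl n * gram n r = gram n r * refl n := by
    rw [refl, gram, Matrix.diagonal_mul_diagonal, Matrix.diagonal_mul_diagonal]
    simp only [mul_comm]
  have ht : (refl n).transpose = refl n := Matrix.diagonal_transpose _
  have ha' : a.transpose * gram n r = -(gram n r * a) := eq_neg_of_add_eq_zero_left ha
  change (projP a).transpose * gram n r = gram n r * -projP a
  rw [projP, Matrix.transpose_smul, Matrix.transpose_sub, Matrix.transpose_mul,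
    Matrix.transpose_mul, ht, smul_mul_assoc, sub_mul, ha', mul_neg, mul_smul_comm, ← smul_neg,
    mul_sub]
  congr 1
  rw [show refl n * (a.transpose * refl n) * gram n r = refl n * (a.transpose * gram n r) * refl n
    by simp only [mul_assoc, hc], ha', mul_neg, neg_mul, ← mul_assoc (refl n), hc]
  simp only [mul_assoc]
  abel

/-- A set of commuting skew adjoint matrices lies in an abelian subalgebra. -/
theorem exists_abelian_of_commute {S : Set (Matrix (Fin (n + 2)) (Fin (n + 2)) ℝ)}
    (hS : ∀ a ∈ S, ∀ b ∈ S, a * b = b * a)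
    (hskew : ∀ a ∈ S, a ∈ skewAdjointMatricesLieSubalgebra (gram n r)) :
    ∃ 𝔞 : LieSubalgebra ℝ (Matrix (Fin (n + 2)) (Fin (n + 2)) ℝ),
      𝔞 ≤ skewAdjointMatricesLieSubalgebra (gram n r) ∧ IsLieAbelian 𝔞 ∧ ∀ a ∈ S, a ∈ 𝔞 := by
  have h1 : ∀ a ∈ S, ∀ b ∈ Submodule.span ℝ S, a * b = b * a := by
    intro a ha b hb
    induction hb using Submodule.span_induction with
    | mem b hb => exact hS a ha b hb
    | zero => simp
    | add b c _ _ hb hc => rw [mul_add, add_mul, hb, hc]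
    | smul c b _ hb => rw [mul_smul_comm, smul_mul_assoc, hb]
  have h2 : ∀ a ∈ Submodule.span ℝ S, ∀ b ∈ Submodule.span ℝ S, a * b = b * a := by
    intro a ha b hb
    induction ha using Submodule.span_induction with
    | mem a ha => exact h1 a ha b hb
    | zero => simp
    | add a c _ _ ha hc => rw [mul_add, add_mul, ha, hc]
    | smul c a _ ha => rw [mul_smul_comm, smul_mul_assoc, ha]
  have h3 : ∀ a ∈ Submodule.span ℝ S, ∀ b ∈ Submodule.span ℝ S, ⁅a, b⁆ = 0 := fun a ha b hb => by
    rw [Ring.lie_def, h2 a ha b hb, sub_self]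
  refine ⟨{ Submodule.span ℝ S with
    lie_mem' := fun {a b} ha hb => ?_ }, ?_, ⟨fun a b => ?_⟩, fun a ha => Submodule.subset_span ha⟩
  · rw [h3 a ha b hb]
    exact (Submodule.span ℝ S).zero_mem
  · exact fun a ha => (Submodule.span_le (p := (skewAdjointMatricesLieSubalgebra
      (gram n r)).toSubmodule)).2 hskew ha
  · exact Subtype.ext (h3 a.1 a.2 b.1 b.2)

variable {M : Type*} [TopologicalSpace M] [ChartedSpace (EuclideanSpace ℝ (Fin 2)) M]
  [IsManifold (𝓡 2) ∞ M] {f : M → G n r ⧸ K n r} {y z : M → Q n r} {F : M → G n r} {U : Set M}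
  {x : M}

/-- Differentiate `Fᵀ * gram n r * F = gram n r`. -/
theorem IsFrame.maurerCartan_skew (hF : IsFrame f U F) (hx : x ∈ U) (X : TangentSpace (𝓡 2) x) :
    (maurerCartan F x X).transpose * gram n r + gram n r * maurerCartan F x X = 0 := by
  have he := IsManifold.chart_mem_maximalAtlas (I := 𝓡 2) (n := ∞) x
  have hxe := mem_chart_source (EuclideanSpace ℝ (Fin 2)) x
  rw [hF.maurerCartan_eq he hx hxe]
  generalize chartAt (EuclideanSpace ℝ (Fin 2)) x = e at he hxe
  have hs := isOpen_chartDomain (e := e) hF.1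
  have hq := mem_chartDomain hx hxe
  have hA := hF.smoothMat he
  have h1 := fun v => matDeriv_congr hs
    (fun q (_ : q ∈ chartDomain e U) => transpose_mul_gram_mul (F (e.symm q))) hq v
  have h2 : ∀ v : 𝔼, (matDeriv (fun q => mat (F (e.symm q))) (e x) v).transpose * gram n r *
      mat (F x) + (mat (F x)).transpose * gram n r *
        matDeriv (fun q => mat (F (e.symm q))) (e x) v = 0 := fun v => by
    have := h1 v
    rw [matDeriv_const, matDeriv_mul (hA.transpose.mul (SmoothMat.const _)) hA hs hq,
      matDeriv_mul hA.transpose (SmoothMat.const _) hs hq, matDeriv_const, mul_zero, add_zero,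
      e.left_inv hxe] at this
    exact this
  have h3 : ∀ D : Matrix (Fin (n + 2)) (Fin (n + 2)) ℝ, (mat (F x)⁻¹ * D).transpose * gram n r +
      gram n r * (mat (F x)⁻¹ * D) =
      D.transpose * gram n r * mat (F x) + (mat (F x)).transpose * gram n r * D := fun D => by
    have hg : (gram n r).transpose = gram n r := Matrix.diagonal_transpose _
    have hgg := gram_mul_gram n r
    rw [mat_inv_eq, Matrix.transpose_mul, Matrix.transpose_mul, Matrix.transpose_mul, hg,
      Matrix.transpose_transpose]
    congr 1
    · simp only [mul_assoc, hgg, mul_one]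
    · rw [← mul_assoc, ← mul_assoc, ← mul_assoc, hgg, one_mul]
  rw [h3]
  exact h2 _

theorem IsCurvedFlat.reflDerivCommute (h : IsCurvedFlat f) (hR : HasSmoothRefl f) (x : M) :
    ReflDerivCommute f x := by
  obtain ⟨U, F, hxU, hF, hU⟩ := h x
  obtain ⟨-, 𝔞, -, h𝔞, hmem⟩ := hU x hxU
  rw [hF.commute_iff hR hxU]
  intro X X'
  have := congrArg Subtype.val (h𝔞.trivial ⟨_, hmem X⟩ ⟨_, hmem X'⟩)
  rw [LieSubalgebra.coe_bracket, Ring.lie_def] at this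
  exact sub_eq_zero.1 this

theorem IsWedge.isCurvedFlat (hf : IsWedge f y z) (hrn : r ≤ n) (hy : IsTimelikeImmersion y)
    (hz : IsTimelikeImmersion z) (hR : HasSmoothRefl f) (hc : ∀ x, ReflDerivCommute f x) :
    IsCurvedFlat f := by
  intro p
  obtain ⟨U, Y, Z, hp, hpair, -⟩ := exists_isUnitPair hrn hf hy hz p
  obtain ⟨V, F, hpV, hF⟩ := hf.exists_isFrame hpair hp
  refine ⟨V, F, hpV, hF, fun x hx => ⟨fun X hX => ?_, ?_⟩⟩
  -- If `α₁(X) = 0`, the reflection has zero derivative along `X`, and the nondegenerate metric of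
  -- `y` forces `X = 0`.
  · obtain ⟨U, Y, Z, hxU, hpair, hL⟩ := exists_isUnitPair hrn hf hy hz x
    have he := IsManifold.chart_mem_maximalAtlas (I := 𝓡 2) (n := ∞) x
    have hxe := mem_chart_source (EuclideanSpace ℝ (Fin 2)) x
    generalize chartAt (EuclideanSpace ℝ (Fin 2)) x = e at he hxe
    have h0 := hF.reflDeriv_eq hR hx X
    rw [hX, zero_mul, mul_zero, zero_mul, smul_zero, hR.reflDeriv_eq he hxe] at h0
    obtain ⟨⟨X₁, hX₁⟩, X₂, hX₂⟩ := (hL x hxU).1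
    rw [inducedMetric_eq he hpair.left.1 hpair.isOpen hxU hxe] at hX₁ hX₂
    have h1 := (hpair.isNullPair he).fderiv_eq_zero (fun q hq => hf.reflField_mulVec hpair hq.2)
      (mem_chartDomain hxU hxe) h0 ⟨_, hX₁⟩ ⟨_, hX₂⟩
    exact (mfderiv_chart_bijective he hxe).1 (h1.trans (map_zero (mfderiv (𝓡 2) (𝓡 2) e x)).symm)
  · obtain ⟨𝔞, h1, h2, h3⟩ := exists_abelian_of_commute (n := n) (r := r)
      (S := Set.range fun X => projP (maurerCartan F x X))
      (by
        rintro _ ⟨X, rfl⟩ _ ⟨X', rfl⟩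
        exact (hF.commute_iff hR hx).1 (hc x) X X')
      (by
        rintro _ ⟨X, rfl⟩
        exact projP_mem_skewAdjoint (hF.maurerCartan_skew hx X))
    exact ⟨𝔞, h1, h2, fun X => h3 _ ⟨X, rfl⟩⟩

end CurvedFlat

/-! ### From Darboux transforms to commuting motions -/

section OfDarboux

variable {n r : ℕ}

/-- After splitting off normal parts, possible multiples of `Y` and `Z` remain; pairing with `Z` and
`Y` shows that they vanish. -/
theorem IsNullPair.exists_normalRight_eq_smul {s : Set 𝔼} {Y Z : 𝔼 → Fin (n + 2) → ℝ} {q : 𝔼}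
    (h : IsNullPair n r s Y Z) (hq : q ∈ s) {A B : 𝔼}
    (hmem : ∃ a b c : ℝ, fderiv ℝ Z q A = a • Z q + b • Y q + c • fderiv ℝ Y q B) :
    ∃ c : ℝ, normalRight n r Y Z q A = c • normalLeft n r Y Z q B := by
  obtain ⟨a, b, c, hZ⟩ := hmem
  have hZY : ip n r (Z q) (Y q) = 1 := by rw [ip_comm, h.ip_eq q hq]
  obtain ⟨α, β, hv⟩ : ∃ α β : ℝ, normalRight n r Y Z q A =
      α • Z q + β • Y q + c • normalLeft n r Y Z q B := by
    refine ⟨a + ip n r (fderiv ℝ Y q A) (Z q), b + c * ip n r (fderiv ℝ Y q B) (Z q), ?_⟩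
    rw [normalRight, normalLeft, hZ]
    module
  have hA := h.isNormalTo_right hq A
  have hB := h.isNormalTo_left hq B
  have h1 := hA.left
  have h2 := hA.right
  simp only [hv, ip_add_left, ip_smul_left, h.left q hq, h.right q hq, hZY, h.ip_eq q hq, hB.left,
    hB.right] at h1 h2
  refine ⟨c, ?_⟩
  rw [hv, show α = 0 by linarith, show β = 0 by linarith, zero_smul, zero_smul, zero_add, zero_add]

theorem IsNullPair.motion_comm_of_null {s : Set 𝔼} {Y Z : 𝔼 → Fin (n + 2) → ℝ} {q : 𝔼}
    (h : IsNullPair n r s Y Z) (hq : q ∈ s) {A B : 𝔼}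
    (hA : ip n r (fderiv ℝ Y q A) (fderiv ℝ Y q A) = 0)
    (hB : ip n r (fderiv ℝ Y q B) (fderiv ℝ Y q B) = 0)
    (hZA : ∃ a b c : ℝ, fderiv ℝ Z q A = a • Z q + b • Y q + c • fderiv ℝ Y q B)
    (hZB : ∃ a b c : ℝ, fderiv ℝ Z q B = a • Z q + b • Y q + c • fderiv ℝ Y q A)
    (w : Fin (n + 2) → ℝ) :
    motion n r (Y q) (Z q) (fderiv ℝ Y q A) (fderiv ℝ Z q A)
      (motion n r (Y q) (Z q) (fderiv ℝ Y q B) (fderiv ℝ Z q B) w) =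
    motion n r (Y q) (Z q) (fderiv ℝ Y q B) (fderiv ℝ Z q B)
      (motion n r (Y q) (Z q) (fderiv ℝ Y q A) (fderiv ℝ Z q A) w) := by
  obtain ⟨a, ha⟩ := h.exists_normalRight_eq_smul hq hZA
  obtain ⟨b, hb⟩ := h.exists_normalRight_eq_smul hq hZB
  have := motion_comm_of_eq_smul (h.ip_eq q hq) (h.left q hq) (h.right q hq)
    (h.isNormalTo_left hq A) (h.isNormalTo_left hq B) (by rw [h.ip_normalLeft hq, hA])
    (by rw [h.ip_normalLeft hq, hB]) a b ha hb w
  simpa only [normalLeft, normalRight, motion_sub_smul] using this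

/-- A Darboux lift only has `⟨Y, Z⟩ ≠ 0`; the span condition has to survive its normalization to
`⟨Y, Z⟩ = 1`. -/
theorem exists_fderiv_smul_eq {s : Set 𝔼} {g : 𝔼 → ℝ} {P Q : 𝔼 → Fin (n + 2) → ℝ} {q A : 𝔼}
    (hs : IsOpen s) (hg : ContDiffOn ℝ ∞ g s) (hQ : ContDiffOn ℝ ∞ Q s) (hq : q ∈ s)
    (hg0 : g q ≠ 0) {v : Fin (n + 2) → ℝ}
    (h : fderiv ℝ Q q A ∈ Submodule.span ℝ {Q q, P q, v}) :
    ∃ a b c : ℝ, fderiv ℝ (fun x => g x • Q x) q A = a • (g q • Q q) + b • P q + c • v := by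
  obtain ⟨a, b, c, habc⟩ := Submodule.mem_span_triple.1 h
  refine ⟨a + fderiv ℝ g q A / g q, g q * b, g q * c, ?_⟩
  rw [fderiv_fun_smul (differentiableAt_of_contDiffOn hg hs hq)
    (differentiableAt_of_contDiffOn hQ hs hq)]
  simp only [_root_.add_apply, _root_.smul_apply, ContinuousLinearMap.smulRight_apply, ← habc]
  ext i
  simp only [Pi.add_apply, Pi.smul_apply, smul_eq_mul]
  field_simp
  ring

variable {M : Type*} [TopologicalSpace M] [ChartedSpace (EuclideanSpace ℝ (Fin 2)) M]
  {f : M → G n r ⧸ K n r} {y z : M → Q n r}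

theorem IsWedge.reflDerivCommute_of_null {U : Set M} {Y Z : M → Fin (n + 2) → ℝ} {x : M}
    {e : OpenPartialHomeomorph M (EuclideanSpace ℝ (Fin 2))} (hf : IsWedge f y z)
    (hR : HasSmoothRefl f) (h : IsUnitPair y z U Y Z)
    (he : e ∈ IsManifold.maximalAtlas (𝓡 2) ∞ M) (hx : x ∈ U) (hxe : x ∈ e.source)
    (h0 : ip n r (coordDeriv e 0 Y x) (coordDeriv e 0 Y x) = 0)
    (h1 : ip n r (coordDeriv e 1 Y x) (coordDeriv e 1 Y x) = 0)
    (h2 : ∃ a b c : ℝ, coordDeriv e 0 Z x = a • Z x + b • Y x + c • coordDeriv e 1 Y x)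
    (h3 : ∃ a b c : ℝ, coordDeriv e 1 Z x = a • Z x + b • Y x + c • coordDeriv e 0 Y x) :
    ReflDerivCommute f x := by
  have hnull := h.isNullPair he
  have hq := mem_chartDomain hx hxe
  have hYe : (Y ∘ e.symm) (e x) = Y x := by rw [Function.comp_apply, e.left_inv hxe]
  have hZe : (Z ∘ e.symm) (e x) = Z x := by rw [Function.comp_apply, e.left_inv hxe]
  rw [hR.commute_iff_coord he hxe]
  rw [← hYe, ← hZe] at h2 h3
  exact (hnull.matDeriv_comm_iff (R := fun q => reflField f (e.symm q))
    (fun p hp => hf.reflField_mulVec h hp.2) hq _ _).2 (hnull.motion_comm_of_null hq h0 h1 h2 h3)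

/-- The coordinates of a canonical lift are null, and the span conditions say that `dZ` interchanges
the two null directions modulo the plane, so the two coordinate motions commute. -/
theorem IsDarbouxTransform.reflDerivCommute [IsManifold (𝓡 2) ∞ M] {ε : ℤˣ}
    (h : IsDarbouxTransform ε y z) (hf : IsWedge f y z) (hR : HasSmoothRefl f) (x : M) : ReflDerivCommute f x := by
  obtain ⟨-, -, hloc⟩ := h
  obtain ⟨e, Y, hxe, ⟨⟨he, hY, hcan⟩, -⟩, Z, hZ, hD⟩ := hloc x
  have hpair := isUnitPair_of_ip_ne_zero e.open_source hY hZ fun p hp => (hD p hp).1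
  obtain ⟨h0, h1, -⟩ := hcan x hxe
  obtain ⟨hne, h2, h3⟩ := hD x hxe
  have hs := isOpen_chartDomain (e := e) e.open_source
  have hZs := contDiffOn_comp_symm he hZ.1
  have hg : ContDiffOn ℝ ∞ (fun q => (ip n r ((Y ∘ e.symm) q) ((Z ∘ e.symm) q))⁻¹)
      (chartDomain e e.source) :=
    (contDiffOn_ip (contDiffOn_comp_symm he hY.1) hZs).inv fun q hq => (hD _ hq.2).1
  have hYe : Y (e.symm (e x)) = Y x := by rw [e.left_inv hxe]
  have hZe : Z (e.symm (e x)) = Z x := by rw [e.left_inv hxe]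
  have key : ∀ (k : Fin 2) (v : Fin (n + 2) → ℝ),
      coordDeriv e k Z x ∈ Submodule.span ℝ {Z x, Y x, v} → ∃ a b c : ℝ,
        coordDeriv e k (fun x => (ip n r (Y x) (Z x))⁻¹ • Z x) x =
          a • ((ip n r (Y x) (Z x))⁻¹ • Z x) + b • Y x + c • v := fun k v hv => by
    have := exists_fderiv_smul_eq (P := Y ∘ e.symm) (A := EuclideanSpace.single k 1) (v := v) hs hg
      hZs (mem_chartDomain hxe hxe)
      (by simp only [Function.comp_apply, hYe, hZe]; exact inv_ne_zero hne)
      (by simp only [Function.comp_apply, hYe, hZe]; exact hv)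
    simp only [Function.comp_apply, hYe, hZe] at this
    exact this
  exact hf.reflDerivCommute_of_null hR hpair he hxe hxe h0 h1 (key 0 _ h2) (key 1 _ h3)

end OfDarboux

/-! ### From commuting motions to Darboux pairs -/

section ToDarboux

variable {n r : ℕ} {M : Type*} [TopologicalSpace M]
  [ChartedSpace (EuclideanSpace ℝ (Fin 2)) M]
  {f : M → G n r ⧸ K n r} {y z : M → Q n r} {U : Set M} {Y Z : M → Fin (n + 2) → ℝ} {x p : M}

theorem IsWedge.symm {M : Type*} {f : M → G n r ⧸ K n r} {y z : M → Q n r} (hf : IsWedge f y z) :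
    IsWedge f z y := fun x => by rw [hf x, sup_comm]

/-- The points at which the metrics of `y` and `z` are positive, respectively `ε`-positive,
in a common direction. -/
def signSet (ε : ℤˣ) (y z : M → Q n r) : Set M :=
  {p | ∃ U Y Z, p ∈ U ∧ IsUnitPair y z U Y Z ∧ ∃ X, 0 < inducedMetric n r Y p X X ∧
    0 < ((ε : ℤ) : ℝ) * inducedMetric n r Z p X X}

variable [IsManifold (𝓡 2) ∞ M]

theorem IsWedge.exists_inducedMetric_eq (hf : IsWedge f y z) (hR : HasSmoothRefl f)
    (hc : ∀ x, ReflDerivCommute f x) (h : IsUnitPair y z U Y Z) (hx : x ∈ U)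
    (hL : IsLorentzAt n r Y x) :
    ∃ k, ∀ X X', inducedMetric n r Z x X X' = k * inducedMetric n r Y x X X' := by
  have he := IsManifold.chart_mem_maximalAtlas (I := 𝓡 2) (n := ∞) x
  have hxe := mem_chart_source (EuclideanSpace ℝ (Fin 2)) x
  generalize chartAt (EuclideanSpace ℝ (Fin 2)) x = e at he hxe
  obtain ⟨⟨X₁, hX₁⟩, X₂, hX₂⟩ := hL
  rw [inducedMetric_eq he h.left.1 h.isOpen hx hxe] at hX₁ hX₂
  obtain ⟨k, hk⟩ := (h.isNullPair he).exists_metric_eq (hf.motionsCommute hR hc h he)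
    (mem_chartDomain hx hxe) ⟨_, hX₁⟩ ⟨_, hX₂⟩
  refine ⟨k, fun X X' => ?_⟩
  rw [inducedMetric_eq he h.left.1 h.isOpen hx hxe, inducedMetric_eq he h.right.1 h.isOpen hx hxe]
  exact hk _ _

/-- Other lifts change each metric by a positive square, so the sign of the conformal factor does
not depend on them. -/
theorem mul_pos_of_mem_signSet {ε : ℤˣ} (hp : p ∈ signSet ε y z) (h : IsUnitPair y z U Y Z)
    (hpU : p ∈ U) {k : ℝ}
    (hk : ∀ X X', inducedMetric n r Z p X X' = k * inducedMetric n r Y p X X') :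
    0 < ((ε : ℤ) : ℝ) * k := by
  obtain ⟨U', Y', Z', hpU', h', X, h1, h2⟩ := hp
  obtain ⟨c, hc, hY⟩ := exists_inducedMetric_eq h.isOpen h'.isOpen h.left h'.left hpU hpU'
  obtain ⟨d, hd, hZ⟩ := exists_inducedMetric_eq h.isOpen h'.isOpen h.right h'.right hpU hpU'
  rw [hY] at h1
  rw [hZ, hk] at h2
  have h3 : 0 < inducedMetric n r Y p X X := pos_of_mul_pos_right h1 (sq_nonneg c)
  have h4 : 0 < (((ε : ℤ) : ℝ) * k) * (d ^ 2 * inducedMetric n r Y p X X) := by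
    convert h2 using 1; ring
  exact pos_of_mul_pos_left h4 (by positivity)

theorem isOpen_signSet (ε : ℤˣ) (y z : M → Q n r) : IsOpen (signSet ε y z) := by
  refine isOpen_iff_mem_nhds.2 fun p hp => ?_
  obtain ⟨U, Y, Z, hpU, h, X, h1, h2⟩ := hp
  have he := IsManifold.chart_mem_maximalAtlas (I := 𝓡 2) (n := ∞) p
  have hpe := mem_chart_source (EuclideanSpace ℝ (Fin 2)) p
  generalize chartAt (EuclideanSpace ℝ (Fin 2)) p = e at he hpe
  have hnull := h.isNullPair he
  rw [inducedMetric_eq he h.left.1 h.isOpen hpU hpe] at h1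
  rw [inducedMetric_eq he h.right.1 h.isOpen hpU hpe] at h2
  -- The direction is extended to nearby points as a constant vector `A` in the chart, where both
  -- inequalities persist by continuity.
  obtain ⟨A, h1, h2⟩ : ∃ A : 𝔼,
      0 < ip n r (fderiv ℝ (Y ∘ e.symm) (e p) A) (fderiv ℝ (Y ∘ e.symm) (e p) A) ∧
      0 < ((ε : ℤ) : ℝ) *
        ip n r (fderiv ℝ (Z ∘ e.symm) (e p) A) (fderiv ℝ (Z ∘ e.symm) (e p) A) := ⟨_, h1, h2⟩
  have hd := fun {P : 𝔼 → Fin (n + 2) → ℝ} (hP : ContDiffOn ℝ ∞ P (chartDomain e U)) =>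
    (contDiffOn_ip (n := n) (r := r)
      (contDiffOn_fderiv_apply hP hnull.isOpen (contDiffOn_const (c := A)))
      (contDiffOn_fderiv_apply hP hnull.isOpen
        (contDiffOn_const (c := A)))).continuousOn.continuousAt
      (hnull.isOpen.mem_nhds (mem_chartDomain hpU hpe))
  have hev := ((hd hnull.smooth_left).eventually (lt_mem_nhds h1)).and
    (((hd hnull.smooth_right).const_mul ((ε : ℤ) : ℝ)).eventually (lt_mem_nhds h2))
  filter_upwards [h.isOpen.mem_nhds hpU, e.open_source.mem_nhds hpe,
    (e.continuousAt hpe).eventually hev] with x hxU hxe hx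
  obtain ⟨X, rfl⟩ := exists_mfderiv_chart_eq he hxe A
  refine ⟨U, Y, Z, hxU, h, X, ?_, ?_⟩
  · rw [inducedMetric_eq he h.left.1 h.isOpen hxU hxe]; exact hx.1
  · rw [inducedMetric_eq he h.right.1 h.isOpen hxU hxe]; exact hx.2

theorem IsWedge.mem_signSet_or (hf : IsWedge f y z) (hrn : r ≤ n) (hy : IsTimelikeImmersion y)
    (hz : IsTimelikeImmersion z) (hR : HasSmoothRefl f) (hc : ∀ x, ReflDerivCommute f x) (p : M) :
    p ∈ signSet 1 y z ∨ p ∈ signSet (-1) y z := by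
  obtain ⟨U, Y, Z, hp, h, hL⟩ := exists_isUnitPair hrn hf hy hz p
  obtain ⟨k, hk⟩ := hf.exists_inducedMetric_eq hR hc h hp (hL p hp).1
  obtain ⟨⟨X, hX⟩, -⟩ := (hL p hp).1
  obtain ⟨⟨X', hX'⟩, -⟩ := (hL p hp).2
  rcases lt_trichotomy k 0 with hk0 | hk0 | hk0
  · refine Or.inr ⟨U, Y, Z, hp, h, X, hX, ?_⟩
    rw [hk]
    simpa using mul_neg_of_neg_of_pos hk0 hX
  · rw [hk, hk0, zero_mul] at hX'
    exact absurd hX' (lt_irrefl _)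
  · refine Or.inl ⟨U, Y, Z, hp, h, X, hX, ?_⟩
    rw [hk]
    simpa using mul_pos hk0 hX

/-- The conformal factor between the two metrics never vanishes, so the two sign sets are open and
complementary; connectedness makes one of them everything. -/
theorem IsWedge.exists_sign [PreconnectedSpace M] (hf : IsWedge f y z) (hrn : r ≤ n)
    (hy : IsTimelikeImmersion y) (hz : IsTimelikeImmersion z) (hR : HasSmoothRefl f)
    (hc : ∀ x, ReflDerivCommute f x) : ∃ ε : ℤˣ, ∀ p, p ∈ signSet ε y z := by
  have hor := hf.mem_signSet_or hrn hy hz hR hc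
  have hcompl : (signSet 1 y z)ᶜ = signSet (-1) y z := by
    refine Set.Subset.antisymm (fun p hp => (hor p).resolve_left hp) fun p hp hp' => ?_
    obtain ⟨U, Y, Z, hpU, h, hL⟩ := exists_isUnitPair hrn hf hy hz p
    obtain ⟨k, hk⟩ := hf.exists_inducedMetric_eq hR hc h hpU (hL p hpU).1
    have h1 := mul_pos_of_mem_signSet hp h hpU hk
    have h2 := mul_pos_of_mem_signSet hp' h hpU hk
    norm_num at h1 h2
    linarith
  have hclopen : IsClopen (signSet 1 y z) :=
    ⟨⟨by rw [hcompl]; exact isOpen_signSet _ _ _⟩, isOpen_signSet _ _ _⟩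
  rcases isClopen_iff.1 hclopen with h | h
  · exact ⟨-1, fun p => (hor p).resolve_left (by rw [h]; exact Set.notMem_empty p)⟩
  · exact ⟨1, fun p => by rw [h]; exact Set.mem_univ p⟩

theorem IsWedge.isDarbouxTransform (hf : IsWedge f y z) (hrn : r ≤ n)
    (hy : IsTimelikeImmersion y) (hz : IsTimelikeImmersion z) (hR : HasSmoothRefl f)
    (hc : ∀ x, ReflDerivCommute f x) {ε : ℤˣ} (hε : ∀ p, p ∈ signSet ε y z) :
    IsDarbouxTransform ε y z := by
  have hloc : ∀ p : M, ∃ e Y, p ∈ e.source ∧ IsAdapted ε y e Y ∧ ∃ Z, IsLift z e.source Z ∧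
      ∀ x ∈ e.source, ip n r (Y x) (Z x) ≠ 0 ∧
        coordDeriv e 0 Z x ∈ Submodule.span ℝ {Z x, Y x, coordDeriv e 1 Y x} ∧
        coordDeriv e 1 Z x ∈ Submodule.span ℝ {Z x, Y x, coordDeriv e 0 Y x} := fun p => by
    obtain ⟨U, Y, Z, hp, h, hL⟩ := exists_isUnitPair hrn hf hy hz p
    obtain ⟨k, hk⟩ := hf.exists_inducedMetric_eq hR hc h hp (hL p hp).1
    have he := IsManifold.chart_mem_maximalAtlas (I := 𝓡 2) (n := ∞) p
    exact exists_adapted_chart he h.isOpen h.left h.right h.ip_eq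
      (hf.motionsCommute hR hc h he) hp (mem_chart_source _ p) (hL p hp).1.1 (hL p hp).1.2
      (mul_pos_of_mem_signSet (hε p) h hp hk) hk
  refine ⟨fun p => ?_, hz, hloc⟩
  obtain ⟨e, Y, h1, h2, -⟩ := hloc p
  exact ⟨e, Y, h1, h2⟩

/-- Exchanging the surfaces replaces the conformal factor by its inverse, which has the same sign;
this is why both halves of a Darboux pair share `ε`. -/
theorem IsWedge.mem_signSet_symm (hf : IsWedge f y z) (hrn : r ≤ n)
    (hy : IsTimelikeImmersion y) (hz : IsTimelikeImmersion z) (hR : HasSmoothRefl f)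
    (hc : ∀ x, ReflDerivCommute f x) {ε : ℤˣ} (hp : p ∈ signSet ε y z) : p ∈ signSet ε z y := by
  obtain ⟨U, Y, Z, hpU, h, hL⟩ := exists_isUnitPair hrn hf hy hz p
  obtain ⟨k, hk⟩ := hf.exists_inducedMetric_eq hR hc h hpU (hL p hpU).1
  have hpos := mul_pos_of_mem_signSet hp h hpU hk
  obtain ⟨⟨X, hX⟩, -⟩ := (hL p hpU).2
  refine ⟨U, Z, Y, hpU, h.symm, X, hX, ?_⟩
  have hε : ((ε : ℤ) : ℝ) * ((ε : ℤ) : ℝ) = 1 := by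
    rcases Int.units_eq_one_or ε with rfl | rfl <;> norm_num
  rw [hk] at hX
  have h1 : 0 < (((ε : ℤ) : ℝ) * k) * (((ε : ℤ) : ℝ) * inducedMetric n r Y p X X) := by
    calc 0 < k * inducedMetric n r Y p X X := hX
      _ = _ := by linear_combination (-k * inducedMetric n r Y p X X) * hε
  exact pos_of_mul_pos_right h1 hpos.le

theorem IsWedge.exists_isDarbouxPair [PreconnectedSpace M] (hf : IsWedge f y z) (hrn : r ≤ n)
    (hy : IsTimelikeImmersion y) (hz : IsTimelikeImmersion z) (hR : HasSmoothRefl f)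
    (hc : ∀ x, ReflDerivCommute f x) : ∃ ε : ℤˣ, IsDarbouxPair ε y z := by
  obtain ⟨ε, hε⟩ := hf.exists_sign hrn hy hz hR hc
  exact ⟨ε, hf.isDarbouxTransform hrn hy hz hR hc hε,
    hf.symm.isDarbouxTransform hrn hz hy hR hc fun p =>
      hf.mem_signSet_symm hrn hy hz hR hc (hε p)⟩

end ToDarboux

end TimelikeDarboux

end

/-! ### The equivalence of the five conditions -/

open TimelikeDarboux in
theorem mainTheorem2 {M : Type*} [TopologicalSpace M] [PreconnectedSpace M]
    [ChartedSpace (EuclideanSpace ℝ (Fin 2)) M] [IsManifold (𝓡 2) ∞ M]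
    (n r : ℕ) (hr : 1 ≤ r) (hn : r + 2 ≤ n)
    (f : M → G n r ⧸ K n r) (y z : M → Q n r) (hf : IsWedge f y z)
    (hy : IsTimelikeImmersion y) (hz : IsTimelikeImmersion z) :
    List.TFAE [
      IsCurvedFlat f,
      ∃ ε : ℤˣ, IsDarbouxPair ε y z,
      ∃ ε : ℤˣ, IsDarbouxTransform ε y z,
      ∀ p : M, ∃ U F, p ∈ U ∧ IsFrame f U F ∧ IsFlatLoop U F,
      ∀ U F, IsFrame f U F → IsFlatLoop U F] := by
  have hrn : r ≤ n := by omega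
  have hR := hasSmoothRefl hrn hf hy hz
  -- Connectedness enters here: it turns the pointwise sign into a single `ε`.
  tfae_have 1 → 2 := fun h => hf.exists_isDarbouxPair hrn hy hz hR (h.reflDerivCommute hR)
  tfae_have 2 → 3 := fun ⟨ε, h⟩ => ⟨ε, h.1⟩
  tfae_have 3 → 5 := fun ⟨ε, h⟩ U F hF =>
    (hF.isFlatLoop_iff hR).2 fun x _ => h.reflDerivCommute hf hR x
  -- Local existence of frames keeps the condition on all frames from being vacuous.
  tfae_have 5 → 4 := fun h p => by
    obtain ⟨U, Y, Z, hp, hpair, -⟩ := exists_isUnitPair hrn hf hy hz p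
    obtain ⟨V, F, hpV, hF⟩ := hf.exists_isFrame hpair hp
    exact ⟨V, F, hpV, hF, h V F hF⟩
  tfae_have 4 → 1 := fun h => hf.isCurvedFlat hrn hy hz hR fun p => by
    obtain ⟨U, F, hp, hF, hloop⟩ := h p
    exact (hF.isFlatLoop_iff hR).1 hloop p hp
  tfae_finish
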